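/- Let $n\ge 1$ and let $X,Y,Z$ be the Pauli matrices; write $\sigma^x_s,\sigma^y_s,\sigma^z_s$ for the Pauli matrices acting on qubit $s\in\{1,\dots,n\}$, and $\bm\sigma_s=(\sigma^x_s,\sigma^y_s,\sigma^z_s)$. The Majorana operators on $n$ qubits are $c_{2k-1}=Z_1\cdots Z_{k-1}X_k$ and $c_{2k}=Z_1\cdots Z_{k-1}Y_k$ ($1\le k\le n$). For $\vec\alpha=(\alpha_1<\dots<\alpha_m)$ with entries in $[2n]=\{1,\dots,2n\}$ let $|\vec\alpha|=m$ and $C_{\vec\alpha}=c_{\alpha_1}\cdots c_{\alpha_m}$. Let $\|A\|^2=\operatorname{tr}(A^\dagger A)$. For a matrix $\mathbf u$ let $\mathbf u_{\vec\alpha\vec\beta}$ be the submatrix with rows $\vec\alpha$ and columns $\vec\beta$; $\mathbf u^{\mathrm T}_{\vec\beta\vec\alpha}$ is its transpose; $\mathbf P_{\vec\eta}$ is the diagonal projector onto the modes in $\vec\eta$; $\overline{\vec\eta}$ is the complement in $[2n]$. A matchgate circuit is a product of gates $G(V,W)$, $V,W\in SU(2)$, each acting on two neighbouring qubits, where $G(V,W)$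 acts as $V$ on $\operatorname{span}(|00\rangle,|11\rangle)$ and as $W$ on $\operatorname{span}(|01\rangle,|10\rangle)$. (1) Every matchgate circuit $U$ is unitary, and there is exactly one real matrix $\mathbf u$ with $$U^\dagger c_\mu U=\sum_{\nu=1}^{2n}u_{\mu\nu}c_\nu\qquad(1\le\mu\le 2n);\tag{$*$}$$ moreover $\mathbf u\in SO(2n)$. (2) Let $U$ be a matchgate circuit or, more generally, any unitary that satisfies $(*)$ with a real matrix $\mathbf u$. For every $\vec\alpha$ and every $s$ there is exactly one complex $3\times3$ matrix $\mathbf M_s$ such that $$\frac1{2^{n+2}}\big\|[\mathbf n\cdot\bm\sigma_s,\,U^\dagger C_{\vec\alpha}U]\big\|^2=\mathbf n^*\cdot\mathbf M_s\cdot\mathbf n\qquad\text{for all }\mathbf n\in\mathbb C^3,$$ and its entries are $$M_{xx}=\tfrac12\{1-(-1)^{|\vec\alpha|}\det[\mathbf u_{\vec\alpha[2n]}(\mathbf I-2\mathbf P_{[2s-1]})\mathbf u^{\mathrm T}_{[2n]\vec\alpha}]\},$$ $$M_{yy}=\tfrac12\{1-(-1)^{|\vec\alpha|}\det[\mathbf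 u_{\vec\alpha[2n]}(\mathbf I-2\mathbf P_{[2(s-1)]\cup(2s)})\mathbf u^{\mathrm T}_{[2n]\vec\alpha}]\},$$ $$M_{zz}=\tfrac12\{1-\det[\mathbf u_{\vec\alpha[2n]}(\mathbf I-2\mathbf P_{(2s-1,2s)})\mathbf u^{\mathrm T}_{[2n]\vec\alpha}]\},$$ $$M_{xy}=M_{yx}=\det\begin{pmatrix}0&\mathbf u^{\mathrm T}_{(2s)\vec\alpha}\\ \mathbf u_{\vec\alpha(2s-1)}&\mathbf u_{\vec\alpha R}\,(\mathbf I-2\mathbf P_{\overline{[2s]}})_{RR}\,\mathbf u^{\mathrm T}_{R\vec\alpha}\end{pmatrix},\qquad R=\overline{(2s-1,2s)},$$ $$M_{xz}=M_{zx}=M_{yz}=M_{zy}=0.$$ (3) The form is efficiently computable classically, in the model of random-access programs over exact complex arithmetic ($+,-,\times,\div$, conjugation, test for zero; additions, subtractions and comparisons of natural-number indices; bounded loops) with unit cost per step. There is one program that, from $n$, $s$, $\vec\alpha$, $\mathbf n$ and a real $2n\times 2n$ matrix $\mathbf u$, computes the matrix $\mathbf M_s$ given by the formulas in (2) and the value $\mathbf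 n^*\cdot\mathbf M_s\cdot\mathbf n$ in a number of steps polynomial in $n$; and there is one program that, from $n$, $s$, $\vec\alpha$, $\mathbf n$ and the list of $N$ gates (positions and entries of $V,W$) of a matchgate circuit $U$, computes $\mathbf M_s$ and $\frac1{2^{n+2}}\|[\mathbf n\cdot\bm\sigma_s,U^\dagger C_{\vec\alpha}U]\|^2$ in a number of steps polynomial in $n+N$. -/

import Mathlib

namespace MatchgateOTO

noncomputable section

open Matrix

/-! ### Operators on `n` qubits -/

/-- Operators on `n` qubits, as matrices in the computational basis `{0,1}^n`. -/
abbrev Op (n : ℕ) : Type := Matrix (Fin n → Fin 2) (Fin n → Fin 2) ℂ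

/-- The tensor product `A 0 ⊗ ⋯ ⊗ A (n-1)` of single-qubit operators. -/
def tensor {n : ℕ} (A : Fin n → Matrix (Fin 2) (Fin 2) ℂ) : Op n :=
  Matrix.of fun x y => ∏ j, A j (x j) (y j)

/-- The Pauli matrices; the labels `x, y, z` are `0, 1, 2`. -/
def pauli : Fin 3 → Matrix (Fin 2) (Fin 2) ℂ :=
  ![!![0, 1; 1, 0], !![0, -Complex.I; Complex.I, 0], !![1, 0; 0, -1]]

/-- The Pauli matrix `σ^a` acting on qubit `s`. -/
def pauliAt {n : ℕ} (s : Fin n) (a : Fin 3) : Op n :=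
  tensor (Function.update (fun _ => 1) s (pauli a))

/-- The single-site operator `v · σ_s`. -/
def siteOp {n : ℕ} (s : Fin n) (v : Fin 3 → ℂ) : Op n :=
  ∑ a, v a • pauliAt s a

/-- The Jordan-Wigner Majorana operators, numbered from `0`:
`c (2 k) = Z ⊗ ⋯ ⊗ Z ⊗ X_k ⊗ 1 ⊗ ⋯` and `c (2 k + 1) = Z ⊗ ⋯ ⊗ Z ⊗ Y_k ⊗ 1 ⊗ ⋯`
(qubits are numbered from `0` too). -/
def majorana {n : ℕ} (μ : Fin (2 * n)) : Op n :=
  tensor fun j =>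
    if (j : ℕ) < (μ : ℕ) / 2 then pauli 2
    else if (j : ℕ) = (μ : ℕ) / 2 then (if (μ : ℕ) % 2 = 0 then pauli 0 else pauli 1)
    else 1

/-- The Majorana configuration operator `C_α = c_{α_1} ⋯ c_{α_k}` of an increasing tuple `α`. -/
def configOp {n k : ℕ} (α : Fin k ↪o Fin (2 * n)) : Op n :=
  (List.ofFn fun t => majorana (α t)).prod

/-! ### Matchgate circuits -/

/-- The two-qubit matchgate `G(V, W)`: `V` acts on the span of `|00⟩, |11⟩`, and `W` on the span
of `|01⟩, |10⟩`. -/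
def matchgateMatrix (V W : Matrix (Fin 2) (Fin 2) ℂ) :
    Matrix (Fin 2 × Fin 2) (Fin 2 × Fin 2) ℂ :=
  Matrix.of fun p q =>
    if p.1 = p.2 ∧ q.1 = q.2 then V p.1 q.1
    else if p.1 ≠ p.2 ∧ q.1 ≠ q.2 then W p.1 q.1
    else 0

/-- A matchgate `G(V, W)` with `V, W ∈ SU(2)`, placed on the neighbouring qubits
`pos, pos + 1`. -/
structure Matchgate (n : ℕ) where
  pos : ℕ
  pos_lt : pos + 1 < n
  V : Matrix.specialUnitaryGroup (Fin 2) ℂ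
  W : Matrix.specialUnitaryGroup (Fin 2) ℂ

/-- The action of a placed matchgate on all `n` qubits. -/
def Matchgate.toOp {n : ℕ} (g : Matchgate n) : Op n :=
  Matrix.of fun x y =>
    let i : Fin n := ⟨g.pos, by have := g.pos_lt; omega⟩
    let j : Fin n := ⟨g.pos + 1, g.pos_lt⟩
    if ∀ l : Fin n, l ≠ i → l ≠ j → x l = y l then
      matchgateMatrix g.V.1 g.W.1 (x i, x j) (y i, y j)
    else 0

/-- The unitary of a circuit of nearest-neighbour matchgates. -/
def circuitOp {n : ℕ} (L : List (Matchgate n)) : Op n :=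
  (L.map Matchgate.toOp).prod

/-- `U† c_μ U = ∑_ν u_{μν} c_ν` for every mode `μ`. -/
def IsModeTransition {n : ℕ} (U : Op n) (u : Matrix (Fin (2 * n)) (Fin (2 * n)) ℝ) : Prop :=
  ∀ μ, Uᴴ * majorana μ * U = ∑ ν, (u μ ν : ℂ) • majorana ν

/-! ### The out-of-time-ordered correlator and its quadratic form -/

/-- `2^{-(n+2)} ‖[v · σ_s, U† C_α U]‖²` with the Frobenius norm `‖A‖² = tr (A† A)`. -/
def oto {n k : ℕ} (U : Op n) (α : Fin k ↪o Fin (2 * n)) (s : Fin n) (v : Fin 3 → ℂ) : ℂ :=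
  let K : Op n := ⁅siteOp s v, Uᴴ * configOp α * U⁆
  1 / 2 ^ (n + 2) * Matrix.trace (Kᴴ * K)

/-- The first Majorana mode of qubit `s`. -/
def modeX {n : ℕ} (s : Fin n) : Fin (2 * n) := ⟨2 * s, by omega⟩

/-- The second Majorana mode of qubit `s`. -/
def modeY {n : ℕ} (s : Fin n) : Fin (2 * n) := ⟨2 * s + 1, by omega⟩

/-- The matrix `I - 2 P_η`, where `P_η` is the projector onto the modes in `η`. -/
def reflection {m : ℕ} (η : Finset (Fin m)) : Matrix (Fin m) (Fin m) ℝ :=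
  1 - 2 • Matrix.diagonal fun μ => if μ ∈ η then 1 else 0

/-- `det [u_{α,[2n]} (I - 2 P_η) (u_{α,[2n]})ᵀ]`. -/
def reflDet {m k : ℕ} (u : Matrix (Fin m) (Fin m) ℝ) (α : Fin k ↪o Fin m)
    (η : Finset (Fin m)) : ℝ :=
  (u.submatrix α id * reflection η * (u.submatrix α id)ᵀ).det

/-- The modes other than the two modes of qubit `s`. -/
abbrev OtherMode {n : ℕ} (s : Fin n) : Type :=
  {μ : Fin (2 * n) // μ ≠ modeX s ∧ μ ≠ modeY s}

/-- The bordered determinant with first row `(0, u_{α, 2s}ᵀ)` and first column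
`(0, u_{α, 2s-1})` (modes and qubits counted from `1` here), and remaining block
`u_{α,R} (I - 2 P)_{R,R} (u_{α,R})ᵀ`, where `R` are the modes of the other qubits and `P`
projects onto the modes of the qubits to the right of `s`. -/
def borderedDet {n k : ℕ} (u : Matrix (Fin (2 * n)) (Fin (2 * n)) ℝ)
    (α : Fin k ↪o Fin (2 * n)) (s : Fin n) : ℝ :=
  let uR : Matrix (Fin k) (OtherMode s) ℝ := u.submatrix α Subtype.val
  let D : Matrix (OtherMode s) (OtherMode s) ℝ :=
    (reflection (Finset.univ.filter fun μ => modeY s < μ)).submatrix Subtype.val Subtype.val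
  (Matrix.fromBlocks (0 : Matrix (Fin 1) (Fin 1) ℝ)
    (Matrix.of fun _ t => u (α t) (modeY s))
    (Matrix.of fun t _ => u (α t) (modeX s))
    (uR * D * uRᵀ)).det

/-- The explicit matrix `M_s` (rows and columns in the order `x, y, z`). -/
def otoMatrix {n k : ℕ} (u : Matrix (Fin (2 * n)) (Fin (2 * n)) ℝ)
    (α : Fin k ↪o Fin (2 * n)) (s : Fin n) : Matrix (Fin 3) (Fin 3) ℝ :=
  let Mxx := 1 / 2 * (1 - (-1) ^ k * reflDet u α (Finset.univ.filter fun μ => μ ≤ modeX s))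
  let Myy := 1 / 2 * (1 - (-1) ^ k *
    reflDet u α (Finset.univ.filter fun μ => μ < modeX s ∨ μ = modeY s))
  let Mzz := 1 / 2 * (1 - reflDet u α {modeX s, modeY s})
  let Mxy := borderedDet u α s
  !![Mxx, Mxy, 0; Mxy, Myy, 0; 0, 0, Mzz]

/-! ### A uniform machine model with a step count

Random access programs over exact complex arithmetic. The memory consists of natural-number
registers, which serve as loop counters and addresses, and of two-dimensional arrays of complex
numbers. Naturals can only be added and subtracted, so their bit length grows at most linearly in
the number of steps. -/

/-- A memory: natural registers `idx r`, and complex arrays `val a` with entries `val a i j`. -/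
structure Memory where
  idx : ℕ → ℕ
  val : ℕ → ℕ → ℕ → ℂ

/-- The operand `arr[idx row, idx col]`. -/
structure Cell where
  arr : ℕ
  row : ℕ
  col : ℕ

def Memory.get (m : Memory) (c : Cell) : ℂ := m.val c.arr (m.idx c.row) (m.idx c.col)

def Memory.setIdx (m : Memory) (r x : ℕ) : Memory :=
  { m with idx := Function.update m.idx r x }

def Memory.set (m : Memory) (c : Cell) (z : ℂ) : Memory :=
  { m with
    val := fun a i j =>
      if a = c.arr ∧ i = m.idx c.row ∧ j = m.idx c.col then z else m.val a i j }

/-- Programs. The constants available are natural numbers for registers, and `0`, `1`, and the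
imaginary unit for cells. `loop r b p` executes `p` with register `r` set to `0, 1, …, B - 1`,
where `B` is the content of register `b` when the loop is entered. -/
inductive Program : Type
  | skip : Program
  | putIdx (r x : ℕ) : Program
  | addIdx (r a b : ℕ) : Program
  | subIdx (r a b : ℕ) : Program
  | putZero (d : Cell) : Program
  | putOne (d : Cell) : Program
  | putI (d : Cell) : Program
  | add (d a b : Cell) : Program
  | sub (d a b : Cell) : Program
  | mul (d a b : Cell) : Program
  | div (d a b : Cell) : Program
  | conj (d a : Cell) : Program
  | seq (p q : Program) : Program
  | ifLe (a b : ℕ) (p q : Program) : Program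
  | ifZero (a : Cell) (p q : Program) : Program
  | loop (r b : ℕ) (p : Program) : Program

open Classical in
/-- The memory after running a program, and the number of steps: every elementary instruction,
every test and every loop entry and loop round costs one step. -/
def Program.run : Program → Memory → Memory × ℕ
  | skip, m => (m, 1)
  | putIdx r x, m => (m.setIdx r x, 1)
  | addIdx r a b, m => (m.setIdx r (m.idx a + m.idx b), 1)
  | subIdx r a b, m => (m.setIdx r (m.idx a - m.idx b), 1)
  | putZero d, m => (m.set d 0, 1)
  | putOne d, m => (m.set d 1, 1)
  | putI d, m => (m.set d Complex.I, 1)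
  | add d a b, m => (m.set d (m.get a + m.get b), 1)
  | sub d a b, m => (m.set d (m.get a - m.get b), 1)
  | mul d a b, m => (m.set d (m.get a * m.get b), 1)
  | div d a b, m => (m.set d (m.get a / m.get b), 1)
  | conj d a, m => (m.set d (star (m.get a)), 1)
  | seq p q, m =>
      let r₁ := p.run m
      let r₂ := q.run r₁.1
      (r₂.1, r₁.2 + r₂.2)
  | ifLe a b p q, m =>
      let r := if m.idx a ≤ m.idx b then p.run m else q.run m
      (r.1, r.2 + 1)
  | ifZero a p q, m =>
      let r := if m.get a = 0 then p.run m else q.run m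
      (r.1, r.2 + 1)
  | loop r b p, m =>
      (List.range (m.idx b)).foldl
        (fun st t =>
          let res := p.run (st.1.setIdx r t)
          (res.1, st.2 + res.2 + 1))
        (m, 1)

/-- The characteristic vector of the configuration `α`. -/
def configVec {m k : ℕ} (α : Fin k ↪o Fin m) (j : ℕ) : ℂ :=
  if ∃ t, (α t : ℕ) = j then 1 else 0

/-- The vector `v`, followed by zeros. -/
def padVec (v : Fin 3 → ℂ) (j : ℕ) : ℂ :=
  if h : j < 3 then v ⟨j, h⟩ else 0

/-- A real square matrix, followed by zeros. -/
def padMatrix {m : ℕ} (u : Matrix (Fin m) (Fin m) ℝ) (i j : ℕ) : ℂ :=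
  if h : i < m ∧ j < m then (u ⟨i, h.1⟩ ⟨j, h.2⟩ : ℂ) else 0

/-- The four entries `A 00, A 01, A 10, A 11` of a two by two matrix, followed by zeros. -/
def flatten (A : Matrix (Fin 2) (Fin 2) ℂ) (j : ℕ) : ℂ :=
  if h : j < 4 then A ⟨j / 2, by omega⟩ ⟨j % 2, by omega⟩ else 0

/-- Input given by the transition matrix: registers `0, 1` hold `n, s`, array `0` holds `u`,
row `0` of array `1` marks the modes of `α`, row `0` of array `2` holds `v`. -/
def matrixInput {n k : ℕ} (u : Matrix (Fin (2 * n)) (Fin (2 * n)) ℝ)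
    (α : Fin k ↪o Fin (2 * n)) (s : Fin n) (v : Fin 3 → ℂ) : Memory where
  idx
    | 0 => n
    | 1 => s
    | _ => 0
  val
    | 0, i, j => padMatrix u i j
    | 1, 0, j => configVec α j
    | 2, 0, j => padVec v j
    | _, _, _ => 0

/-- Input given by the circuit: registers `0, 1, 2` hold `n, s` and the number of gates; row `t` of
array `0` marks the position of the gate number `t`, rows `t` of the arrays `3, 4` hold the
entries of its matrices `V, W`; row `0` of array `1` marks the modes of `α`, row `0` of
array `2` holds `v`. -/
def circuitInput {n k : ℕ} (L : List (Matchgate n))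
    (α : Fin k ↪o Fin (2 * n)) (s : Fin n) (v : Fin 3 → ℂ) : Memory where
  idx
    | 0 => n
    | 1 => s
    | 2 => L.length
    | _ => 0
  val
    | 0, t, j => if h : t < L.length then (if (L[t]).pos = j then 1 else 0) else 0
    | 1, 0, j => configVec α j
    | 2, 0, j => padVec v j
    | 3, t, j => if h : t < L.length then flatten (L[t]).V.1 j else 0
    | 4, t, j => if h : t < L.length then flatten (L[t]).W.1 j else 0
    | _, _, _ => 0

/-- The output three by three matrix is read from array `5`. -/
def outMatrix (m : Memory) : Matrix (Fin 3) (Fin 3) ℂ :=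
  Matrix.of fun a b => m.val 5 a b

/-- The output number is read from array `6`. -/
def outValue (m : Memory) : ℂ := m.val 6 0 0

/-- The form `v* · M · v`. -/
def quadForm (M : Matrix (Fin 3) (Fin 3) ℂ) (v : Fin 3 → ℂ) : ℂ :=
  star v ⬝ᵥ (M *ᵥ v)

end

end MatchgateOTO

namespace MatchgateOTO

noncomputable section

open Matrix

/-! ### Characteristic polynomials and bordered determinants -/

section Determinants

open Polynomial

variable {ι : Type*} [Fintype ι] [DecidableEq ι]

/-! Put `O = U† C_α U`. Since `O` and the Paulis are unitary, expanding the commutator reduces the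
correlator to traces `tr (O† A O B)` with Paulis `A`, `B` on qubit `s` (`oto_eq_sum`). Let an
involution `A` act linearly on the modes, `A c_ν A = ∑ F_νμ c_μ`. Then `U A U†` acts by `u F uᵀ`,
and conjugating `C_α` by it gives a product of `k` combinations of modes. By anticommutation only
rearrangements of `α` overlap with `C_α`, each with the sign of its permutation, so the trace is
`2^n` times the minor of `u F uᵀ` on `α` (`trace_configOp_mul`, `IsModeTransition.trace_conj`).

The Paulis act by diagonal signs, which gives the diagonal of `M_s`. For the `xy` entry the
involutions `(σ^x ± σ^y)/√2` act by a common diagonal matrix plus or minus the exchange of the two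
modes of `s`. Polarization leaves the difference of two determinants that differ by a symmetric
rank-two update, and a Schur complement turns it into the bordered determinant
(`det_add_sub_det_sub`). The `xz` and `yz` entries vanish by parity: `U† (Z ⊗ ⋯ ⊗ Z) U` anticommutes
with every mode, hence commutes with `σ^z`, anticommutes with `σ^x` and `σ^y`, and commutes with `O`
up to a sign (`IsModeTransition.trace_mixed`). Uniqueness of the form is polarization again.

The four modes of a matchgate exchange even and odd two-qubit states. Their even-to-odd blocks `X,
Y, Z, i` span, over the reals, `i` times the quaternions, and the gate sends a block `B` to `W† B
V`. This is the action of `SU(2) × SU(2)` on four-space by left and right multiplication, of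
determinant one (`gate_conj_modeBlock`, `gateCoeff_det`). Orthogonality holds because conjugation
preserves the trace pairing of the modes.

For the algorithm, determinants come from the Faddeev–LeVerrier iteration, which divides only by
positive integers and so needs no pivoting. It is justified by comparing coefficients in `(X - B)
adj (X - B) = χ` and by `χ' = tr adj (X - B)`. The minor on `α` is padded by identity rows to a size
fixed by `n`. The programs are compiled from a small language of expressions and array assignments,
whose compiler is verified once (`ArithExpr.compile_spec`, `Stmt.toProgram_spec`). Polynomial
running time is read off the syntax, since all loop lengths sit in registers that the compiled code
never writes (`Program.steps_le`). -/

theorem derivative_charpoly {R : Type*} [CommRing R] (A : Matrix ι ι R) :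
    derivative A.charpoly = A.charmatrix.adjugate.trace := by
  -- The determinant is differentiated row by row. In the characteristic matrix the derivative of
  -- row `i` is a unit vector, so term `i` is a diagonal entry of the adjugate.
  have key : ∀ M : Matrix ι ι R[X], derivative M.det =
      ∑ i, (M.updateRow i fun j => derivative (M i j)).det := by
    intro M
    rw [← det_transpose M]
    simp_rw [← det_transpose (M.updateRow _ _), det_apply, derivative_sum]
    rw [Finset.sum_comm]
    refine Finset.sum_congr rfl fun σ _ => ?_
    rw [Units.smul_def, derivative_smul, derivative_prod_finset, Finset.smul_sum]
    refine Finset.sum_congr rfl fun i _ => ?_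
    rw [← Finset.mul_prod_erase _ _ (Finset.mem_univ i), Units.smul_def]
    congr 1
    simp only [transpose_apply, updateRow_self]
    rw [mul_comm]
    congr 1
    refine Finset.prod_congr rfl fun j hj => ?_
    rw [updateRow_ne (Finset.ne_of_mem_erase hj)]
  rw [charpoly, key, trace]
  refine Finset.sum_congr rfl fun i _ => ?_
  rw [diag_apply, adjugate_apply]
  congr 2
  ext j : 1
  by_cases h : i = j
  · subst h; simp
  · simp [h, Ne.symm h]

/-- One round of the Faddeev–LeVerrier iteration on the pair (matrix, coefficient). -/
def leverrierMat (B : Matrix ι ι ℂ) : ℕ → Matrix ι ι ℂ × ℂ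
  | 0 => (0, 1)
  | t + 1 =>
    let M := B * (leverrierMat B t).1 + (leverrierMat B t).2 • 1
    (M, -(B * M).trace / (t + 1))

/-- The coefficient matrices of `adj (X - B)` satisfy a downward recursion driven by the
coefficients of the characteristic polynomial. The trace identity for the derivative supplies the
next coefficient from the matrix just found. Round `t` reaches degree `card ι - t`. -/
theorem leverrierMat_spec (B : Matrix ι ι ℂ) (t : ℕ) (ht : t ≤ Fintype.card ι) :
    (leverrierMat B t).1 = B.charmatrix.adjugate.map (fun p => p.coeff (Fintype.card ι - t)) ∧
      (leverrierMat B t).2 = B.charpoly.coeff (Fintype.card ι - t) := by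
  set N := Fintype.card ι
  set adj : ℕ → Matrix ι ι ℂ := fun k => B.charmatrix.adjugate.map (fun p => p.coeff k) with hadj
  have hmul : B.charmatrix * B.charmatrix.adjugate = B.charpoly • 1 := mul_adjugate _
  have hent : ∀ i j, X * B.charmatrix.adjugate i j -
      ∑ l, C (B i l) * B.charmatrix.adjugate l j = if i = j then B.charpoly else 0 := by
    intro i j
    have := congrFun (congrFun hmul i) j
    rw [Matrix.smul_apply, one_apply, smul_eq_mul, mul_ite, mul_one, mul_zero] at this
    rw [← this, charmatrix, sub_mul, Matrix.sub_apply, Matrix.mul_apply (M := C.mapMatrix B)]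
    simp
  have hrec : ∀ k, adj k = B * adj (k + 1) + B.charpoly.coeff (k + 1) • 1 := by
    intro k
    ext i j
    have := congrArg (fun p => p.coeff (k + 1)) (hent i j)
    simp only [coeff_sub, coeff_X_mul, finsetSum_coeff, coeff_C_mul] at this
    simp only [hadj, map_apply, Matrix.add_apply, mul_apply, Matrix.smul_apply, one_apply,
      smul_eq_mul]
    rw [sub_eq_iff_eq_add] at this
    rw [this]
    split_ifs <;> simp [add_comm]
  have hrec0 : (0 : Matrix ι ι ℂ) = B * adj 0 + B.charpoly.coeff 0 • 1 := by
    ext i j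
    have := congrArg (fun p => p.coeff 0) (hent i j)
    simp only [coeff_sub, coeff_X_mul_zero, finsetSum_coeff, coeff_C_mul] at this
    simp only [hadj, map_apply, Matrix.add_apply, mul_apply, Matrix.smul_apply, one_apply,
      smul_eq_mul, Matrix.zero_apply]
    rw [sub_eq_iff_eq_add] at this
    refine this.trans ?_
    split_ifs <;> simp [add_comm]
  have hdeg : ∀ k, N < k → B.charpoly.coeff k = 0 := fun k hk =>
    coeff_eq_zero_of_natDegree_lt (by rw [charpoly_natDegree_eq_dim]; exact hk)
  have hlarge : ∃ K, ∀ k, K ≤ k → adj k = 0 := by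
    refine ⟨(∑ i, ∑ j, (B.charmatrix.adjugate i j).natDegree) + 1, fun k hk => ?_⟩
    ext i j
    change (B.charmatrix.adjugate i j).coeff k = 0
    apply coeff_eq_zero_of_natDegree_lt
    have h1 := Finset.single_le_sum (f := fun j => (B.charmatrix.adjugate i j).natDegree)
      (fun _ _ => Nat.zero_le _) (Finset.mem_univ j)
    have h2 := Finset.single_le_sum
      (f := fun i => ∑ j, (B.charmatrix.adjugate i j).natDegree)
      (fun _ _ => Nat.zero_le _) (Finset.mem_univ i)
    exact (h1.trans h2).trans_lt hk
  -- Descend from a degree beyond all entries of the adjugate: above `N` the characteristic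
  -- polynomial contributes nothing, so the recursion carries zero down.
  have hzero : adj N = 0 := by
    obtain ⟨K, hK⟩ := hlarge
    have : ∀ d, adj (N + (K - d)) = 0 := by
      intro d
      induction d with
      | zero => exact hK _ (by omega)
      | succ d ih =>
        rcases Nat.lt_or_ge d K with h | h
        · rw [hrec, show N + (K - (d + 1)) + 1 = N + (K - d) by omega, ih, hdeg _ (by omega)]
          simp
        · rwa [show K - (d + 1) = K - d by omega]
    simpa using this K
  have htr : ∀ k, (adj k).trace = (k + 1) * B.charpoly.coeff (k + 1) := by
    intro k
    have := congrArg (fun p => p.coeff k) (derivative_charpoly B)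
    simp only [coeff_derivative, trace, finsetSum_coeff, diag_apply] at this
    simp only [trace, diag_apply, hadj, map_apply]
    rw [← this, mul_comm]
  induction t with
  | zero =>
    refine ⟨by simpa [leverrierMat] using hzero.symm, ?_⟩
    have := B.charpoly_monic.coeff_natDegree
    rw [charpoly_natDegree_eq_dim] at this
    simpa [leverrierMat] using this.symm
  | succ t ih =>
    obtain ⟨h1, h2⟩ := ih (by omega)
    obtain ⟨k, hk⟩ : ∃ k, N = k + 1 + t := ⟨N - 1 - t, by omega⟩
    have e1 : N - t = k + 1 := by omega
    have e2 : N - (t + 1) = k := by omega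
    rw [e1] at h1 h2
    have hM : (leverrierMat B (t + 1)).1 = adj k := by
      rw [hrec k, ← h2]
      simp only [leverrierMat, h1, hadj]
    refine ⟨by rw [e2, hM], ?_⟩
    have hc : (leverrierMat B (t + 1)).2 = -(B * adj k).trace / (t + 1) := by
      rw [← hM]; rfl
    rw [hc, e2]
    have hone : (1 : Matrix ι ι ℂ).trace = k + 1 + t := by
      rw [trace_one]; exact_mod_cast hk
    have ht0 : (t + 1 : ℂ) ≠ 0 := by exact_mod_cast Nat.succ_ne_zero t
    rw [div_eq_iff ht0]
    -- In degree zero the recursion has no left-hand side; `hrec0`, the constant coefficient, takes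
    -- its place.
    rcases k with _ | k
    · have := congrArg trace hrec0
      rw [trace_zero, trace_add, trace_smul, hone, smul_eq_mul] at this
      push_cast at this
      linear_combination this
    · have := congrArg trace (hrec k)
      rw [htr, trace_add, trace_smul, hone, smul_eq_mul] at this
      push_cast at this ⊢
      linear_combination this

/-- The Faddeev–LeVerrier iteration for `-A` ends with the determinant of `A`. -/
theorem leverrierMat_det (A : Matrix ι ι ℂ) :
    (leverrierMat (-A) (Fintype.card ι)).2 = A.det := by
  rw [(leverrierMat_spec (-A) _ le_rfl).2, Nat.sub_self]
  have h := det_eq_sign_charpoly_coeff (-A)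
  rw [det_neg] at h
  exact (mul_left_cancel₀ (pow_ne_zero _ (neg_ne_zero.2 one_ne_zero)) h).symm

/-- Identity rows can be deleted from a determinant together with their columns. -/
theorem det_eq_det_submatrix_of_rows {R κ : Type*} [CommRing R] [Fintype κ] [DecidableEq κ]
    (M : Matrix ι ι R) (f : κ → ι) (hf : Function.Injective f)
    (h : ∀ i, i ∉ Set.range f → ∀ j, M i j = if i = j then 1 else 0) :
    M.det = (M.submatrix f f).det := by
  classical
  rw [twoBlockTriangular_det M (fun i => i ∈ Set.range f)]
  · have h2 : (M.toSquareBlockProp fun i => ¬ i ∈ Set.range f) = 1 := by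
      ext ⟨i, hi⟩ ⟨j, hj⟩
      simp [toSquareBlockProp, h i hi, one_apply]
    rw [h2, det_one, mul_one]
    convert (det_submatrix_equiv_self (Equiv.ofInjective f hf)
      (M.toSquareBlockProp fun i => i ∈ Set.range f)).symm
    rfl
  · intro i hi j hj
    rw [h i hi, if_neg]
    rintro rfl
    exact hi hj

/-- The polarized symmetric rank-two update is a bordered determinant. -/
theorem det_add_sub_det_sub {R : Type*} [CommRing R] (B : Matrix ι ι R) (hB : Bᵀ = B)
    (a b : ι → R) :
    (B + (vecMulVec a b + vecMulVec b a)).det - (B - (vecMulVec a b + vecMulVec b a)).det =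
      -4 * (fromBlocks (0 : Matrix (Fin 1) (Fin 1) R) (of fun _ t => b t)
        (of fun t _ => a t) B).det := by
  -- Only the top two rows `p`, `q` vary; the rows below are `(a i, b i, B i)`. The determinant is
  -- thus linear in `p` and in `q`, and the Schur complement of an identity corner recovers the
  -- updated matrix.
  set Q : (Fin 2 ⊕ ι → R) → (Fin 2 ⊕ ι → R) → Matrix (Fin 2 ⊕ ι) (Fin 2 ⊕ ι) R := fun p q =>
    of (Sum.elim ![p, q] fun i => Sum.elim ![a i, b i] (B i)) with hQ
  have upd0 : ∀ p p' q, Q p q = (Q p' q).updateRow (Sum.inl 0) p := by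
    intro p p' q
    ext (i | i) j
    · fin_cases i <;> simp [hQ, updateRow_apply]
    · simp [hQ, updateRow_apply]
  have upd1 : ∀ p q q', Q p q = (Q p q').updateRow (Sum.inl 1) q := by
    intro p q q'
    ext (i | i) j
    · fin_cases i <;> simp [hQ, updateRow_apply]
    · simp [hQ, updateRow_apply]
  have lin0 : ∀ p p' q (t : R), (Q (p + t • p') q).det = (Q p q).det + t * (Q p' q).det := by
    intro p p' q t
    rw [upd0 (p + t • p') 0, det_updateRow_add, det_updateRow_smul, ← upd0, ← upd0]
  have lin1 : ∀ p q q' (t : R), (Q p (q + t • q')).det = (Q p q).det + t * (Q p q').det := by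
    intro p q q' t
    rw [upd1 p (q + t • q') 0, det_updateRow_add, det_updateRow_smul, ← upd1, ← upd1]
  set e : Fin 2 → Fin 2 ⊕ ι → R := fun i => Pi.single (Sum.inl i) 1 with he
  have schur : ∀ t : R, (B - t • (vecMulVec a b + vecMulVec b a)).det =
      (Q (e 0 + t • Sum.elim (fun _ => 0) b) (e 1 + t • Sum.elim (fun _ => 0) a)).det := by
    intro t
    have : Q (e 0 + t • Sum.elim (fun _ => 0) b) (e 1 + t • Sum.elim (fun _ => 0) a) =
        fromBlocks 1 (of ![t • b, t • a]) (of fun i => ![a i, b i]) B := by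
      ext (i | i) (j | j)
      · fin_cases i <;> fin_cases j <;> simp [hQ, he]
      · fin_cases i <;> simp [hQ, he]
      · simp [hQ]
      · simp [hQ]
    rw [this, det_fromBlocks_one₁₁]
    congr 1
    ext i j
    simp [mul_apply, Fin.sum_univ_two, vecMulVec_apply]
    ring
  -- The second row is a unit vector and is deleted with its column, leaving the border `b` above
  -- and `a` at the left.
  have bord0 : (Q (Sum.elim (fun _ => 0) b) (e 1)).det =
      (fromBlocks (0 : Matrix (Fin 1) (Fin 1) R) (of fun _ t => b t) (of fun t _ => a t) B).det := by
    rw [det_eq_det_submatrix_of_rows _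
      (Sum.map (fun _ : Fin 1 => (0 : Fin 2)) (id : ι → ι))
      (Function.Injective.sumMap (Function.injective_of_subsingleton _) Function.injective_id)]
    · congr 1
      ext (i | i) (j | j) <;> simp [hQ]
    · rintro (i | i) hi j
      · fin_cases i
        · exact absurd ⟨Sum.inl 0, rfl⟩ hi
        · simp [hQ, he, Pi.single_apply, eq_comm]
      · exact absurd ⟨Sum.inr i, rfl⟩ hi
  -- Here the first row is deleted and the roles of `a` and `b` are exchanged; transposing undoes
  -- this because `B` is symmetric.
  have bord1 : (Q (e 0) (Sum.elim (fun _ => 0) a)).det =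
      (fromBlocks (0 : Matrix (Fin 1) (Fin 1) R) (of fun _ t => b t) (of fun t _ => a t) B).det := by
    rw [det_eq_det_submatrix_of_rows _
      (Sum.map (fun _ : Fin 1 => (1 : Fin 2)) (id : ι → ι))
      (Function.Injective.sumMap (Function.injective_of_subsingleton _) Function.injective_id),
      ← det_transpose]
    · congr 1
      ext (i | i) (j | j)
      · simp [hQ]
      · simp [hQ]
      · simp [hQ]
      · simpa [hQ] using congrFun (congrFun hB i) j
    · rintro (i | i) hi j
      · fin_cases i
        · simp [hQ, he, Pi.single_apply, eq_comm]
        · exact absurd ⟨Sum.inl 0, rfl⟩ hi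
      · exact absurd ⟨Sum.inr i, rfl⟩ hi
  -- Between `t = 1` and `t = -1` the terms of even order cancel, and each of the two linear terms
  -- is the bordered determinant: hence the factor `-4`.
  have hp := schur 1
  have hm := schur (-1)
  rw [lin0, lin1, lin1, bord0, bord1] at hp hm
  rw [one_smul] at hp
  rw [neg_one_smul, sub_neg_eq_add] at hm
  rw [hp, hm]
  ring

end Determinants

/-! ### Tensor products, Pauli matrices and Majorana relations -/

section Tensor

variable {n : ℕ}

theorem tensor_mul (A B : Fin n → Matrix (Fin 2) (Fin 2) ℂ) :
    tensor A * tensor B = tensor fun j => A j * B j := by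
  ext x y
  simp only [tensor, mul_apply, of_apply, ← Finset.prod_mul_distrib]
  rw [Finset.prod_univ_sum, Fintype.piFinset_univ]

theorem tensor_one : tensor (fun _ : Fin n => (1 : Matrix (Fin 2) (Fin 2) ℂ)) = 1 := by
  ext x y
  simp only [tensor, of_apply, one_apply, Finset.prod_ite_zero, Finset.prod_const_one,
    Finset.mem_univ, true_imp_iff, funext_iff]

theorem tensor_conjTranspose (A : Fin n → Matrix (Fin 2) (Fin 2) ℂ) :
    (tensor A)ᴴ = tensor fun j => (A j)ᴴ := by
  ext x y
  simp [tensor, conjTranspose_apply, star_prod]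

theorem tensor_update_apply (A : Fin n → Matrix (Fin 2) (Fin 2) ℂ) (i : Fin n)
    (B : Matrix (Fin 2) (Fin 2) ℂ) (x y : Fin n → Fin 2) :
    tensor (Function.update A i B) x y =
      B (x i) (y i) * ∏ j ∈ Finset.univ.erase i, A j (x j) (y j) := by
  rw [tensor, of_apply, ← Finset.mul_prod_erase _ _ (Finset.mem_univ i), Function.update_self]
  congr 1
  refine Finset.prod_congr rfl fun j hj => ?_
  rw [Function.update_of_ne (Finset.ne_of_mem_erase hj)]

theorem tensor_update_add (A : Fin n → Matrix (Fin 2) (Fin 2) ℂ) (i : Fin n)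
    (B C : Matrix (Fin 2) (Fin 2) ℂ) :
    tensor (Function.update A i (B + C)) =
      tensor (Function.update A i B) + tensor (Function.update A i C) := by
  ext x y
  simp only [Matrix.add_apply, tensor_update_apply, add_mul]

theorem tensor_update_smul (A : Fin n → Matrix (Fin 2) (Fin 2) ℂ) (i : Fin n) (z : ℂ)
    (B : Matrix (Fin 2) (Fin 2) ℂ) :
    tensor (Function.update A i (z • B)) = z • tensor (Function.update A i B) := by
  ext x y
  simp only [Matrix.smul_apply, tensor_update_apply, smul_eq_mul, mul_assoc]

theorem tensor_anticomm (A B : Fin n → Matrix (Fin 2) (Fin 2) ℂ) (i : Fin n)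
    (h : ∀ j, j ≠ i → A j * B j = B j * A j) (hi : A i * B i = -(B i * A i)) :
    tensor A * tensor B = -(tensor B * tensor A) := by
  rw [tensor_mul, tensor_mul]
  have : (fun j => A j * B j) = Function.update (fun j => B j * A j) i ((-1 : ℂ) • (B i * A i)) := by
    funext j
    by_cases hj : j = i
    · subst hj; simp [hi]
    · simp [hj, h j hj]
  rw [this, tensor_update_smul, Function.update_eq_self, neg_one_smul]

theorem pauli_mul_self (a : Fin 3) : pauli a * pauli a = 1 := by
  fin_cases a <;> ext i j <;> fin_cases i <;> fin_cases j <;> simp [pauli, mul_apply]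

theorem pauli_anticomm {a b : Fin 3} (h : a ≠ b) : pauli a * pauli b = -(pauli b * pauli a) := by
  fin_cases a <;> fin_cases b <;> first
    | exact absurd rfl h
    | (ext i j; fin_cases i <;> fin_cases j <;> simp [pauli, mul_apply])

theorem pauli_conjTranspose (a : Fin 3) : (pauli a)ᴴ = pauli a := by
  fin_cases a <;> ext i j <;> fin_cases i <;> fin_cases j <;> simp [pauli]

/-- The tensor factor of a Majorana operator at a given qubit. -/
def majoranaFactor (μ j : ℕ) : Matrix (Fin 2) (Fin 2) ℂ :=
  if j < μ / 2 then pauli 2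
  else if j = μ / 2 then (if μ % 2 = 0 then pauli 0 else pauli 1)
  else 1

theorem majorana_eq_tensor (μ : Fin (2 * n)) :
    majorana μ = tensor fun j : Fin n => majoranaFactor μ j := rfl

theorem majorana_mul_self (μ : Fin (2 * n)) : majorana μ * majorana μ = 1 := by
  rw [majorana_eq_tensor, tensor_mul, ← tensor_one]
  congr 1
  funext j
  unfold majoranaFactor
  split_ifs <;> simp [pauli_mul_self]

theorem majorana_conjTranspose (μ : Fin (2 * n)) : (majorana μ)ᴴ = majorana μ := by
  rw [majorana_eq_tensor, tensor_conjTranspose]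
  congr 1
  funext j
  unfold majoranaFactor
  split_ifs <;> simp [pauli_conjTranspose]

/-- For `μ < ν` the qubit of `μ` decides: there `X` or `Y` meets the `Z` of the longer string, or
`X` meets `Y` if both modes share the qubit. At every other qubit the factors are equal or one of
them is the identity. -/
theorem majorana_anticomm {μ ν : Fin (2 * n)} (h : μ ≠ ν) :
    majorana μ * majorana ν = -(majorana ν * majorana μ) := by
  have key : ∀ μ ν : Fin (2 * n), μ < ν →
      majorana μ * majorana ν = -(majorana ν * majorana μ) := by
    intro μ ν h
    have hlt : (μ : ℕ) < ν := h
    refine tensor_anticomm _ _ ⟨μ / 2, by omega⟩ (fun j hj => ?_) ?_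
    · have hj' : (j : ℕ) ≠ μ / 2 := fun h => hj (Fin.ext h)
      rcases Nat.lt_or_ge j ((μ : ℕ) / 2) with h1 | h1
      · have h2 : (j : ℕ) < ν / 2 := by omega
        simp [h1, h2]
      · have h2 : ¬ (j : ℕ) < μ / 2 := by omega
        simp [h2, hj']
    · rcases Nat.lt_or_ge ((μ : ℕ) / 2) ((ν : ℕ) / 2) with h1 | h1
      · simp only [lt_irrefl, if_false, if_true, h1]
        split_ifs <;> exact pauli_anticomm (by decide)
      · have h2 : (μ : ℕ) / 2 = ν / 2 := by omega
        have h3 : (μ : ℕ) % 2 = 0 := by omega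
        have h4 : (ν : ℕ) % 2 = 1 := by omega
        simp only [h2, h3, h4, lt_irrefl, if_false, if_true, one_ne_zero]
        exact pauli_anticomm (by decide)
  rcases lt_or_gt_of_ne h with h | h
  · exact key _ _ h
  · rw [key _ _ h, neg_neg]

theorem trace_one_op : trace (1 : Op n) = 2 ^ n := by
  simp [trace_one]

theorem trace_eq_zero_of_anticomm {A B : Op n} (h : A * B = -(B * A)) : trace (A * B) = 0 := by
  have h1 : trace (A * B) = -trace (A * B) := by
    conv_lhs => rw [h, trace_neg, trace_mul_comm]
  exact self_eq_neg.1 h1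

theorem trace_majorana_mul (μ ν : Fin (2 * n)) :
    trace (majorana μ * majorana ν) = if μ = ν then (2 : ℂ) ^ n else 0 := by
  split_ifs with h
  · subst h; rw [majorana_mul_self, trace_one_op]
  · exact trace_eq_zero_of_anticomm (majorana_anticomm h)

/-- Pairing with a mode under the trace extracts its coefficient. -/
theorem majorana_coeff_injective {f g : Fin (2 * n) → ℂ}
    (h : ∑ ν, f ν • majorana ν = ∑ ν, g ν • majorana ν) : f = g := by
  funext μ
  have := congrArg (fun A => trace (majorana μ * A)) h
  simpa [Finset.mul_sum, trace_sum, trace_majorana_mul] using this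

end Tensor

/-! ### Signs in products of anticommuting elements -/

section AnticommutingProducts

theorem mul_prod_ofFn_of_sign {R : Type*} [Ring R] {k : ℕ} (c : R) (a : Fin k → R) (ε : Fin k → ℤ)
    (h : ∀ t, c * a t = ε t • (a t * c)) :
    c * (List.ofFn a).prod = (∏ t, ε t) • ((List.ofFn a).prod * c) := by
  induction k with
  | zero => simp
  | succ k ih =>
    rw [List.ofFn_succ, List.prod_cons, Fin.prod_univ_succ, ← mul_assoc, h, smul_mul_assoc,
      mul_assoc, ih _ (fun t => ε t.succ) fun t => h t.succ]
    simp only [mul_smul_comm, mul_smul, mul_assoc]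

/-- Adjacent transpositions generate the permutation group, and each costs one sign. Quantifying
over `a` lets the multiplicative step apply the claim to the permuted family, which anticommutes as
well. -/
theorem prod_ofFn_comp_perm {R : Type*} [Ring R] {k : ℕ} (σ : Equiv.Perm (Fin k)) :
    ∀ a : Fin k → R, (∀ s t, s ≠ t → a s * a t = -(a t * a s)) →
      (List.ofFn (a ∘ σ)).prod = (Equiv.Perm.sign σ : ℤ) • (List.ofFn a).prod := by
  rcases k with _ | k
  · intro a _
    simp [Subsingleton.elim σ 1]
  have hσ : σ ∈ Submonoid.closure
      (Set.range fun i : Fin k => Equiv.swap i.castSucc i.succ) := by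
    rw [Equiv.Perm.mclosure_swap_castSucc_succ]; trivial
  induction hσ using Submonoid.closure_induction with
  | one => intro a _; simp
  | mul σ τ _ _ hσ hτ =>
    intro a ha
    have h1 := hτ (a ∘ σ) fun s t hst => ha _ _ fun h => hst (σ.injective h)
    rw [hσ a ha] at h1
    rw [Equiv.Perm.coe_mul, ← Function.comp_assoc, h1, smul_smul, Equiv.Perm.sign_mul, mul_comm]
    simp
  | mem σ hσ =>
    obtain ⟨i, rfl⟩ := hσ
    intro a ha
    simp only
    rw [Equiv.Perm.sign_swap (Fin.castSucc_lt_succ).ne]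
    simp only [Units.val_neg, Units.val_one, neg_smul, one_smul]
    clear σ
    induction k with
    | zero => exact i.elim0
    | succ k ih =>
      -- A swap of the first two factors is computed directly; any other one fixes the first factor,
      -- which is split off.
      refine Fin.cases ?_ (fun i => ?_) i
      · rw [List.ofFn_succ, List.ofFn_succ, List.ofFn_succ (f := a), List.ofFn_succ]
        have hrest : ∀ t : Fin k, (a ∘ Equiv.swap (0 : Fin (k + 1)).castSucc (0 : Fin (k + 1)).succ)
            t.succ.succ = a t.succ.succ := by
          intro t
          rw [Function.comp_apply, Equiv.swap_apply_of_ne_of_ne]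
          · exact Fin.succ_ne_zero _
          · exact fun h => Fin.succ_ne_zero _ (Fin.succ_injective _ h)
        simp only [hrest, List.prod_cons]
        have e0 : (Equiv.swap (0 : Fin (k + 1)).castSucc (0 : Fin (k + 1)).succ) 0 = 1 :=
          Equiv.swap_apply_left _ _
        have e1 : (Equiv.swap (0 : Fin (k + 1)).castSucc (0 : Fin (k + 1)).succ) (Fin.succ 0) = 0 :=
          Equiv.swap_apply_right _ _
        rw [Function.comp_apply, Function.comp_apply, e0, e1, ← mul_assoc, ← mul_assoc,
          ha 1 0 (by simp)]
        simp
      · have hzero : Equiv.swap i.succ.castSucc i.succ.succ 0 = 0 :=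
          Equiv.swap_apply_of_ne_of_ne (Fin.succ_ne_zero i.castSucc).symm
            (Fin.succ_ne_zero i.succ).symm
        have hsucc : (fun t : Fin (k + 1) => (a ∘ Equiv.swap i.succ.castSucc i.succ.succ) t.succ) =
            (fun t => a t.succ) ∘ Equiv.swap i.castSucc i.succ := by
          funext t
          exact congrArg a ((Fin.succ_injective _).swap_apply i.castSucc i.succ t)
        rw [List.ofFn_succ, List.ofFn_succ (f := a), List.prod_cons, List.prod_cons, ← mul_neg,
          ← ih i (fun t => a t.succ) fun s t hst => ha _ _ fun h => hst (Fin.succ_injective _ h),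
          hsucc, Function.comp_apply, hzero]

theorem prod_ofFn_sum {R ι : Type*} [Ring R] [Algebra ℂ R] [Fintype ι] {k : ℕ}
    (G : Fin k → ι → ℂ) (c : ι → R) :
    (List.ofFn fun t => ∑ ν, G t ν • c ν).prod =
      ∑ f : Fin k → ι, (∏ t, G t (f t)) • (List.ofFn fun t => c (f t)).prod := by
  classical
  have := (MultilinearMap.mkPiAlgebraFin ℂ k R).map_sum (fun t ν => G t ν • c ν)
  simp only [MultilinearMap.map_smul_univ, MultilinearMap.mkPiAlgebraFin_apply] at this
  exact this

end AnticommutingProducts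

/-! ### Overlaps of Majorana configuration operators -/

section ConfigOp

variable {n k : ℕ}

theorem configOp_mem_unitary (α : Fin k ↪o Fin (2 * n)) :
    (configOp α)ᴴ * configOp α = 1 ∧ configOp α * (configOp α)ᴴ = 1 := by
  have h : configOp α ∈ unitary (Op n) := by
    refine Submonoid.list_prod_mem _ fun x hx => ?_
    obtain ⟨t, rfl⟩ := (List.mem_ofFn' _ _).1 hx
    rw [Unitary.mem_iff, star_eq_conjTranspose, majorana_conjTranspose, majorana_mul_self]
    exact ⟨rfl, rfl⟩
  exact Unitary.mem_iff.1 h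

theorem majorana_mul_prod (μ : Fin (2 * n)) (f : Fin k → Fin (2 * n)) :
    majorana μ * (List.ofFn fun t => majorana (f t)).prod =
      (∏ t, if f t = μ then 1 else -1 : ℤ) •
        ((List.ofFn fun t => majorana (f t)).prod * majorana μ) := by
  refine mul_prod_ofFn_of_sign _ _ _ fun t => ?_
  split_ifs with h
  · rw [h, one_smul]
  · rw [majorana_anticomm (Ne.symm h), neg_one_zsmul]

/-- The mode `α s` passes the second product, which lacks it, with sign `(-1)^k`, but passes `C_α`,
which contains it once, with the opposite sign. Conjugating by this mode therefore negates the
trace. -/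
theorem trace_configOp_mul_of_notMem (α : Fin k ↪o Fin (2 * n)) (f : Fin k → Fin (2 * n))
    (s : Fin k) (hs : ∀ t, f t ≠ α s) :
    trace ((configOp α)ᴴ * (List.ofFn fun t => majorana (f t)).prod) = 0 := by
  set P := (List.ofFn fun t => majorana (f t)).prod
  set c := majorana (α s)
  have hP : c * P = (-1 : ℤ) ^ k • (P * c) := by
    rw [majorana_mul_prod]
    simp [hs, P, c]
  have hC : c * configOp α = (-(-1) ^ k : ℤ) • (configOp α * c) := by
    rw [configOp, majorana_mul_prod]
    congr 1
    have : ∀ t, (if α t = α s then 1 else -1 : ℤ) = (-1) * (if t = s then -1 else 1) := by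
      intro t
      by_cases h : t = s <;> simp [h]
    simp only [this, Finset.prod_mul_distrib, Finset.prod_ite_eq', Finset.prod_const]
    simp
  have hc : c * c = 1 := majorana_mul_self _
  have hC' : (configOp α)ᴴ * c = (-(-1) ^ k : ℤ) • (c * (configOp α)ᴴ) := by
    have := congrArg conjTranspose hC
    rw [conjTranspose_mul, conjTranspose_smul, conjTranspose_mul, majorana_conjTranspose] at this
    simpa using this
  have h1 : trace ((configOp α)ᴴ * P) = -trace ((configOp α)ᴴ * P) := by
    calc trace ((configOp α)ᴴ * P) = trace (((configOp α)ᴴ * c) * (c * P)) := by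
          rw [mul_assoc, ← mul_assoc c c, hc, one_mul]
      _ = -trace (c * (configOp α)ᴴ * (P * c)) := by
          rw [hC', hP, smul_mul_smul_comm]
          have : (-(-1) ^ k * (-1) ^ k : ℤ) = -1 := by
            rw [neg_mul, ← mul_pow]; simp
          rw [this, neg_one_zsmul, trace_neg]
      _ = -trace ((configOp α)ᴴ * P) := by
          rw [mul_assoc, trace_mul_comm, mul_assoc, mul_assoc, hc, mul_one]
  exact self_eq_neg.1 h1

/-- The overlap of a configuration operator with a product of mode combinations. -/
theorem trace_configOp_mul (α : Fin k ↪o Fin (2 * n)) (G : Fin k → Fin (2 * n) → ℂ) :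
    trace ((configOp α)ᴴ * (List.ofFn fun t => ∑ ν, G t ν • majorana ν).prod) =
      2 ^ n * (of fun t s => G t (α s)).det := by
  rw [prod_ofFn_sum, Finset.mul_sum, trace_sum, ← det_transpose, det_apply, Finset.mul_sum]
  symm
  refine Fintype.sum_of_injective (fun σ : Equiv.Perm (Fin k) => (α ∘ σ : Fin k → Fin (2 * n)))
    ?_ _ _ ?_ ?_
  · intro σ τ h
    ext t : 1
    exact α.injective (congrFun h t)
  · intro f hf
    have : ∃ s, ∀ t, f t ≠ α s := by
      -- If `f` hits every mode of `α`, chosen preimages form an injective, hence bijective,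
      -- self-map of `Fin k`, so `f` is a rearrangement of `α` after all.
      by_contra! hcon
      choose g hg using hcon
      have hinj : Function.Injective g := fun s t h => α.injective (by rw [← hg, ← hg, h])
      refine hf ⟨(Equiv.ofBijective g (Finite.injective_iff_bijective.1 hinj)).symm, ?_⟩
      funext t
      simp only [Function.comp_apply]
      rw [← hg]
      exact congrArg f (Equiv.ofBijective_apply_symm_apply g _ t)
    obtain ⟨s, hs⟩ := this
    rw [mul_smul_comm, trace_smul, trace_configOp_mul_of_notMem α f s hs, smul_zero]
  · intro σ
    have h := prod_ofFn_comp_perm σ (fun t => majorana (α t) : Fin k → Op n)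
      fun s t hst => majorana_anticomm fun h => hst (α.injective h)
    have h' : (List.ofFn fun t => majorana ((α ∘ σ) t) : List (Op n)).prod =
        (Equiv.Perm.sign σ : ℤ) • configOp α := h
    have h'' : (configOp α)ᴴ * (List.ofFn fun t => majorana ((α ∘ σ) t) : List (Op n)).prod =
        (Equiv.Perm.sign σ : ℤ) • 1 := by
      rw [h', mul_smul_comm, (configOp_mem_unitary α).1]
    rw [Matrix.mul_smul, h'', trace_smul, trace_smul, trace_one_op, Units.smul_def]
    simp [mul_comm, mul_left_comm]

end ConfigOp

/-! ### Linear action of a unitary on the modes -/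

section Transition

variable {n k : ℕ} {U : Op n} {u : Matrix (Fin (2 * n)) (Fin (2 * n)) ℝ}

theorem IsModeTransition.unique {u' : Matrix (Fin (2 * n)) (Fin (2 * n)) ℝ}
    (h : IsModeTransition U u) (h' : IsModeTransition U u') : u' = u := by
  ext μ ν
  have := congrFun (majorana_coeff_injective ((h' μ).symm.trans (h μ))) ν
  exact_mod_cast this

theorem IsModeTransition.mul {U' : Op n} {u' : Matrix (Fin (2 * n)) (Fin (2 * n)) ℝ}
    (h : IsModeTransition U u) (h' : IsModeTransition U' u') :
    IsModeTransition (U * U') (u * u') := by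
  intro μ
  have : (U * U')ᴴ * majorana μ * (U * U') = U'ᴴ * (Uᴴ * majorana μ * U) * U' := by
    simp only [conjTranspose_mul, mul_assoc]
  rw [this, h μ, Finset.mul_sum, Finset.sum_mul]
  have h'' : ∀ ν, U'ᴴ * majorana ν * U' = ∑ κ, (u' ν κ : ℂ) • majorana κ := h'
  simp only [Matrix.mul_smul, Matrix.smul_mul, h'', Finset.smul_sum, smul_smul]
  rw [Finset.sum_comm]
  refine Finset.sum_congr rfl fun ν _ => ?_
  rw [← Finset.sum_smul, mul_apply]
  push_cast
  rfl

theorem IsModeTransition.one : IsModeTransition (1 : Op n) 1 := by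
  intro μ
  simp [one_apply]

/-- Modes are orthogonal of equal norm for the trace pairing, and conjugation by `U` preserves that
pairing. -/
theorem IsModeTransition.mul_transpose (h : IsModeTransition U u)
    (hU : U ∈ unitaryGroup (Fin n → Fin 2) ℂ) : u * uᵀ = 1 := by
  have hUU : U * Uᴴ = 1 := mem_unitaryGroup_iff.1 hU
  ext μ ν
  have h1 : ∀ μ ν : Fin (2 * n), (Uᴴ * majorana μ * U) * (Uᴴ * majorana ν * U) =
      Uᴴ * (majorana μ * majorana ν) * U := by
    intro μ ν
    calc _ = Uᴴ * majorana μ * (U * Uᴴ) * majorana ν * U := by simp only [mul_assoc]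
      _ = _ := by rw [hUU, mul_one]; simp only [mul_assoc]
  have h2 : trace ((Uᴴ * majorana μ * U) * (Uᴴ * majorana ν * U)) =
      trace (majorana μ * majorana ν) := by
    rw [h1, mul_assoc, trace_mul_comm, mul_assoc, hUU, mul_one]
  rw [h, h, trace_majorana_mul, Finset.sum_mul, trace_sum] at h2
  simp only [Finset.mul_sum, trace_sum, Matrix.smul_mul, Matrix.mul_smul, trace_smul,
    trace_majorana_mul, smul_eq_mul, mul_ite, mul_zero, Finset.sum_ite_eq, Finset.mem_univ,
    if_true] at h2
  rw [mul_apply, one_apply]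
  have h3 : ((∑ j, u μ j * u ν j : ℝ) : ℂ) * 2 ^ n = ((if μ = ν then 1 else 0 : ℝ) : ℂ) * 2 ^ n := by
    rw [Complex.ofReal_sum, Finset.sum_mul]
    convert h2 using 1
    · refine Finset.sum_congr rfl fun j _ => ?_
      push_cast; ring
    · split_ifs <;> simp
  exact_mod_cast mul_right_cancel₀ (pow_ne_zero n two_ne_zero) h3

/-- The inverse conjugation has the inverse matrix, which is the transpose by orthogonality. -/
theorem IsModeTransition.conj_inv (h : IsModeTransition U u)
    (hU : U ∈ unitaryGroup (Fin n → Fin 2) ℂ) (ν : Fin (2 * n)) :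
    U * majorana ν * Uᴴ = ∑ κ, (u κ ν : ℂ) • majorana κ := by
  have hUU : U * Uᴴ = 1 := mem_unitaryGroup_iff.1 hU
  have hu : uᵀ * u = 1 := mul_eq_one_comm.1 (h.mul_transpose hU)
  have h1 : ∀ κ, majorana κ = ∑ ν, (u κ ν : ℂ) • (U * majorana ν * Uᴴ) := by
    intro κ
    calc majorana κ = (U * Uᴴ) * majorana κ * (U * Uᴴ) := by rw [hUU]; simp
      _ = U * (Uᴴ * majorana κ * U) * Uᴴ := by simp only [mul_assoc]
      _ = _ := by
        rw [h κ, Finset.mul_sum, Finset.sum_mul]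
        simp only [Matrix.mul_smul, Matrix.smul_mul]
  calc U * majorana ν * Uᴴ = ∑ l, ((uᵀ * u) ν l : ℂ) • (U * majorana l * Uᴴ) := by
        simp [hu, one_apply]
    _ = ∑ κ, (u κ ν : ℂ) • ∑ l, (u κ l : ℂ) • (U * majorana l * Uᴴ) := by
        simp only [Finset.smul_sum, smul_smul]
        rw [Finset.sum_comm]
        refine Finset.sum_congr rfl fun l _ => ?_
        rw [← Finset.sum_smul, mul_apply]
        push_cast
        rfl
    _ = _ := by simp only [← h1]

theorem conj_prod_ofFn {R : Type*} [Ring R] {A B : R} (hAB : A * B = 1) (hBA : B * A = 1)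
    (a : Fin k → R) :
    A * (List.ofFn a).prod * B = (List.ofFn fun t => A * a t * B).prod := by
  induction k with
  | zero => simpa using hAB
  | succ k ih =>
    rw [List.ofFn_succ, List.ofFn_succ, List.prod_cons, List.prod_cons, ← ih]
    calc _ = A * a 0 * (1 * ((List.ofFn fun i => a i.succ).prod * B)) := by
          simp only [one_mul, mul_assoc]
      _ = _ := by rw [← hBA]; simp only [mul_assoc]

/-- The out-of-time-ordered trace of an involution that acts linearly on the modes. -/
theorem IsModeTransition.trace_conj (h : IsModeTransition U u)
    (hU : U ∈ unitaryGroup (Fin n → Fin 2) ℂ) (α : Fin k ↪o Fin (2 * n)) {A : Op n}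
    (hA : A * A = 1) {F : Matrix (Fin (2 * n)) (Fin (2 * n)) ℝ}
    (hF : ∀ ν, A * majorana ν * A = ∑ μ, (F ν μ : ℂ) • majorana μ) :
    trace ((Uᴴ * configOp α * U)ᴴ * A * (Uᴴ * configOp α * U) * A) =
      2 ^ n * ((u.submatrix α id * F * (u.submatrix α id)ᵀ).det : ℝ) := by
  have hUU : U * Uᴴ = 1 := mem_unitaryGroup_iff.1 hU
  have hUU' : Uᴴ * U = 1 := mem_unitaryGroup_iff'.1 hU
  -- Cyclicity moves the evolution from `C_α` onto `A`. The result is again an involution, so it can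
  -- be inserted between all factors of `C_α`.
  set B := U * A * Uᴴ with hBdef
  have hB : B * B = 1 := by
    calc B * B = U * A * (Uᴴ * U) * A * Uᴴ := by simp only [hBdef, mul_assoc]
      _ = U * (A * A) * Uᴴ := by rw [hUU', mul_one]; simp only [mul_assoc]
      _ = 1 := by rw [hA, mul_one, hUU]
  have hBc : ∀ μ, B * majorana μ * B = ∑ κ, ((u * F * uᵀ) μ κ : ℂ) • majorana κ := by
    intro μ
    calc B * majorana μ * B = U * (A * (Uᴴ * majorana μ * U) * A) * Uᴴ := by
          simp only [hBdef, mul_assoc]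
      _ = ∑ κ, ((u * F * uᵀ) μ κ : ℂ) • majorana κ := by
        rw [h μ]
        simp only [Finset.mul_sum, Finset.sum_mul, Matrix.mul_smul, Matrix.smul_mul, hF,
          Finset.smul_sum, smul_smul, h.conj_inv hU]
        rw [Finset.sum_comm' (t' := Finset.univ) (s' := fun _ => Finset.univ) (by simp)]
        rw [Finset.sum_congr rfl fun j _ => Finset.sum_comm]
        rw [Finset.sum_comm]
        refine Finset.sum_congr rfl fun κ _ => ?_
        simp only [← Finset.sum_smul]
        congr 1
        simp only [mul_apply, transpose_apply]
        push_cast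
        simp only [Finset.sum_mul]
  have h1 : trace ((Uᴴ * configOp α * U)ᴴ * A * (Uᴴ * configOp α * U) * A) =
      trace ((configOp α)ᴴ * (B * configOp α * B)) := by
    have : (Uᴴ * configOp α * U)ᴴ * A * (Uᴴ * configOp α * U) * A =
        Uᴴ * ((configOp α)ᴴ * U * A * Uᴴ * configOp α * U * A) := by
      simp only [conjTranspose_mul, conjTranspose_conjTranspose, mul_assoc]
    rw [this, trace_mul_comm]
    simp only [hBdef, mul_assoc]
  rw [h1, configOp, conj_prod_ofFn hB hB]
  simp only [hBc]
  rw [← configOp, trace_configOp_mul α fun t ν => ((u * F * uᵀ) (α t) ν : ℂ)]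
  congr 1
  have h2 : (u.submatrix α id * F * (u.submatrix α id)ᵀ) = (u * F * uᵀ).submatrix α α := rfl
  rw [h2]
  exact (RingHom.map_det Complex.ofRealHom _).symm

end Transition

/-! ### Single-qubit involutions acting on the modes -/

section SiteOperators

variable {n : ℕ}

/-- The single-qubit matrix `v · σ`. -/
def siteMatrix (v : Fin 3 → ℂ) : Matrix (Fin 2) (Fin 2) ℂ := ∑ a, v a • pauli a

theorem siteOp_eq_tensor (s : Fin n) (v : Fin 3 → ℂ) :
    siteOp s v = tensor (Function.update (fun _ => 1) s (siteMatrix v)) := by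
  simp only [siteOp, siteMatrix, Fin.sum_univ_three, tensor_update_add, tensor_update_smul,
    pauliAt]

theorem siteOp_mul_self (s : Fin n) {v : Fin 3 → ℂ} (hv : siteMatrix v * siteMatrix v = 1) :
    siteOp s v * siteOp s v = 1 := by
  rw [siteOp_eq_tensor, tensor_mul, ← tensor_one]
  congr 1
  funext j
  by_cases h : j = s
  · subst h; simp [hv]
  · simp [h]

theorem siteOp_conj_majorana (s : Fin n) (v : Fin 3 → ℂ) (ν : Fin (2 * n)) :
    siteOp s v * majorana ν * siteOp s v =
      tensor (Function.update (fun j : Fin n => majoranaFactor ν j) s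
        (siteMatrix v * majoranaFactor ν s * siteMatrix v)) := by
  rw [siteOp_eq_tensor, majorana_eq_tensor, tensor_mul, tensor_mul]
  congr 1
  funext j
  by_cases h : j = s
  · subst h; simp
  · simp [h]

theorem majorana_eq_update (s : Fin n) (ν : Fin (2 * n)) {B : Matrix (Fin 2) (Fin 2) ℂ}
    (hB : majoranaFactor ν s = B) :
    tensor (Function.update (fun j : Fin n => majoranaFactor ν j) s B) = majorana ν := by
  subst hB
  rw [majorana_eq_tensor, Function.update_eq_self s (fun j : Fin n => majoranaFactor ν j)]

theorem majoranaFactor_of_lt {ν j : ℕ} (h : ν / 2 < j) : majoranaFactor ν j = 1 := by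
  rw [majoranaFactor, if_neg (by omega), if_neg (by omega)]

theorem majoranaFactor_of_gt {ν j : ℕ} (h : j < ν / 2) : majoranaFactor ν j = pauli 2 := by
  rw [majoranaFactor, if_pos h]

theorem majoranaFactor_even (j : ℕ) : majoranaFactor (2 * j) j = pauli 0 := by
  rw [majoranaFactor, if_neg (by omega), if_pos (by omega), if_pos (by omega)]

theorem majoranaFactor_odd (j : ℕ) : majoranaFactor (2 * j + 1) j = pauli 1 := by
  rw [majoranaFactor, if_neg (by omega), if_pos (by omega), if_neg (by omega)]

theorem majoranaFactor_succ_of_ne {i j : ℕ} (h : j ≠ i) :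
    majoranaFactor (2 * i + 1) j = majoranaFactor (2 * i) j := by
  simp only [majoranaFactor, show (2 * i + 1) / 2 = i by omega, show 2 * i / 2 = i by omega, h,
    if_false]

/-- Replacing the factor of one mode of a qubit by that of the other mode. -/
theorem tensor_update_modeX (s : Fin n) :
    tensor (Function.update (fun j : Fin n => majoranaFactor (modeX s) j) s (pauli 1)) =
      majorana (modeY s) := by
  rw [← majorana_eq_update s (modeY s) (majoranaFactor_odd s)]
  congr 1
  funext j
  by_cases h : j = s
  · subst h; simp
  · simp only [ne_eq, h, not_false_eq_true, Function.update_of_ne]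
    exact (majoranaFactor_succ_of_ne fun h' => h (Fin.ext h')).symm

theorem tensor_update_modeY (s : Fin n) :
    tensor (Function.update (fun j : Fin n => majoranaFactor (modeY s) j) s (pauli 0)) =
      majorana (modeX s) := by
  rw [← majorana_eq_update s (modeX s) (majoranaFactor_even s)]
  congr 1
  funext j
  by_cases h : j = s
  · subst h; simp
  · simp only [ne_eq, h, not_false_eq_true, Function.update_of_ne]
    exact majoranaFactor_succ_of_ne fun h' => h (Fin.ext h')

theorem modeX_ne_modeY (s : Fin n) : modeX s ≠ modeY s := by
  intro h
  have := congrArg Fin.val h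
  simp [modeX, modeY] at this

theorem mode_cases (s : Fin n) (ν : Fin (2 * n)) :
    ν < modeX s ∨ ν = modeX s ∨ ν = modeY s ∨ modeY s < ν := by
  simp only [modeX, modeY, Fin.ext_iff, Fin.lt_def]
  omega

theorem reflection_eq_diagonal {m : ℕ} (η : Finset (Fin m)) :
    reflection η = diagonal fun μ => if μ ∈ η then -1 else 1 := by
  ext μ ν
  by_cases h : μ = ν
  · subst h
    by_cases hμ : μ ∈ η <;> simp only [reflection, two_smul] <;> simp [hμ]
  · simp only [reflection, two_smul]
    simp [h]

/-- The action on the modes of conjugation by `x σ^x_s + y σ^y_s`, for `x ^ 2 + y ^ 2 = 1`. -/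
def planarConj (s : Fin n) (x y : ℝ) : Matrix (Fin (2 * n)) (Fin (2 * n)) ℝ :=
  (diagonal fun ν => if ν < modeX s then 1 else if ν = modeX s then x ^ 2 - y ^ 2
    else if ν = modeY s then y ^ 2 - x ^ 2 else -1) +
  (2 * x * y) • (Matrix.single (modeX s) (modeY s) 1 + Matrix.single (modeY s) (modeX s) 1)

theorem siteMatrix_planar_sq {x y : ℝ} (h : x ^ 2 + y ^ 2 = 1) :
    siteMatrix ![(x : ℂ), y, 0] * siteMatrix ![(x : ℂ), y, 0] = 1 := by
  have h' : (x : ℂ) ^ 2 + y ^ 2 = 1 := by exact_mod_cast h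
  ext i j
  fin_cases i <;> fin_cases j <;>
    simp [siteMatrix, pauli, Fin.sum_univ_three, mul_apply] <;>
    linear_combination h' - (y : ℂ) ^ 2 * Complex.I_sq

theorem siteMatrix_planar_conj_zero {x y : ℝ} :
    siteMatrix ![(x : ℂ), y, 0] * pauli 0 * siteMatrix ![(x : ℂ), y, 0] =
      ((x : ℂ) ^ 2 - y ^ 2) • pauli 0 + (2 * x * y : ℂ) • pauli 1 := by
  ext i j
  fin_cases i <;> fin_cases j <;>
    simp [siteMatrix, pauli, Fin.sum_univ_three, mul_apply]
  · linear_combination (y : ℂ) ^ 2 * Complex.I_sq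
  · linear_combination (y : ℂ) ^ 2 * Complex.I_sq

theorem siteMatrix_planar_conj_one {x y : ℝ} :
    siteMatrix ![(x : ℂ), y, 0] * pauli 1 * siteMatrix ![(x : ℂ), y, 0] =
      (2 * x * y : ℂ) • pauli 0 + ((y : ℂ) ^ 2 - x ^ 2) • pauli 1 := by
  ext i j
  fin_cases i <;> fin_cases j <;>
    simp [siteMatrix, pauli, Fin.sum_univ_three, mul_apply]
  · linear_combination (-2 * x * y + y ^ 2 * Complex.I : ℂ) * Complex.I_sq
  · linear_combination (-2 * x * y - y ^ 2 * Complex.I : ℂ) * Complex.I_sq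

theorem siteMatrix_planar_conj_two {x y : ℝ} (h : x ^ 2 + y ^ 2 = 1) :
    siteMatrix ![(x : ℂ), y, 0] * pauli 2 * siteMatrix ![(x : ℂ), y, 0] = (-1 : ℂ) • pauli 2 := by
  have h' : (x : ℂ) ^ 2 + y ^ 2 = 1 := by exact_mod_cast h
  ext i j
  fin_cases i <;> fin_cases j <;>
    simp [siteMatrix, pauli, Fin.sum_univ_three, mul_apply]
  · linear_combination (y : ℂ) ^ 2 * Complex.I_sq - h'
  · linear_combination h' - (y : ℂ) ^ 2 * Complex.I_sq

/-- Only the tensor factor at `s` changes. It is `1` for earlier modes, `X` or `Y` for the two modes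
of `s`, and `Z` for later modes; the involution fixes `1`, negates `Z` and reflects the plane of `X`
and `Y`. -/
theorem planar_conj_majorana (s : Fin n) {x y : ℝ} (h : x ^ 2 + y ^ 2 = 1) (ν : Fin (2 * n)) :
    siteOp s ![(x : ℂ), y, 0] * majorana ν * siteOp s ![(x : ℂ), y, 0] =
      ∑ μ, (planarConj s x y ν μ : ℂ) • majorana μ := by
  have hne := modeX_ne_modeY s
  have hXY : modeX s < modeY s := by simp [modeX, modeY, Fin.lt_def]
  rw [siteOp_conj_majorana]
  rcases mode_cases s ν with hν | rfl | rfl | hν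
  · have h1 : (ν : ℕ) / 2 < s := by simp only [modeX, Fin.lt_def] at hν; omega
    rw [majoranaFactor_of_lt h1, mul_one, siteMatrix_planar_sq h,
      majorana_eq_update s ν (majoranaFactor_of_lt h1)]
    have h2 : modeX s ≠ ν := hν.ne'
    have h3 : modeY s ≠ ν := (hν.trans hXY).ne'
    simp [planarConj, hν, h2, h3, diagonal_apply]
  · have h1 : majoranaFactor (modeX s) s = pauli 0 := majoranaFactor_even s
    rw [h1, siteMatrix_planar_conj_zero, tensor_update_add, tensor_update_smul,
      tensor_update_smul, majorana_eq_update s _ h1, tensor_update_modeX]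
    simp [planarConj, diagonal_apply, Matrix.single_apply, hne.symm, add_smul,
      Finset.sum_add_distrib, ite_smul, apply_ite Complex.ofReal]
  · have h1 : majoranaFactor (modeY s) s = pauli 1 := majoranaFactor_odd s
    rw [h1, siteMatrix_planar_conj_one, tensor_update_add, tensor_update_smul,
      tensor_update_smul, majorana_eq_update s _ h1, tensor_update_modeY, add_comm]
    simp [planarConj, diagonal_apply, Matrix.single_apply, hne, hne.symm, add_smul, hXY.not_gt,
      Finset.sum_add_distrib, ite_smul, apply_ite Complex.ofReal]
  · have h1 : (s : ℕ) < ν / 2 := by simp only [modeY, Fin.lt_def] at hν; omega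
    rw [majoranaFactor_of_gt h1, siteMatrix_planar_conj_two h, tensor_update_smul,
      majorana_eq_update s ν (majoranaFactor_of_gt h1)]
    have h2 : modeX s ≠ ν := (hXY.trans hν).ne
    have h3 : modeY s ≠ ν := hν.ne
    simp [planarConj, (hXY.trans hν).not_gt, h2, h3, h2.symm, h3.symm, diagonal_apply,
      apply_ite Complex.ofReal]

theorem siteMatrix_single (a : Fin 3) : siteMatrix (Pi.single a 1) = pauli a := by
  simp [siteMatrix, Pi.single_apply]

theorem siteOp_single (s : Fin n) (a : Fin 3) : siteOp s (Pi.single a 1) = pauliAt s a := by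
  simp [siteOp, Pi.single_apply]

theorem pauliAt_two_conj_majorana (s : Fin n) (ν : Fin (2 * n)) :
    pauliAt s 2 * majorana ν * pauliAt s 2 =
      ∑ μ, (reflection {modeX s, modeY s} ν μ : ℂ) • majorana μ := by
  have hXY : modeX s < modeY s := by simp [modeX, modeY, Fin.lt_def]
  have hanti : ∀ a : Fin 3, a ≠ 2 → pauli 2 * pauli a * pauli 2 = (-1 : ℂ) • pauli a := by
    intro a ha
    rw [pauli_anticomm (Ne.symm ha), neg_mul, mul_assoc, pauli_mul_self, mul_one, neg_one_smul]
  rw [← siteOp_single, siteOp_conj_majorana, siteMatrix_single, reflection_eq_diagonal]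
  rcases mode_cases s ν with hν | rfl | rfl | hν
  · have h1 : (ν : ℕ) / 2 < s := by simp only [modeX, Fin.lt_def] at hν; omega
    rw [majoranaFactor_of_lt h1, mul_one, pauli_mul_self,
      majorana_eq_update s ν (majoranaFactor_of_lt h1)]
    simp [diagonal_apply, hν.ne, (hν.trans hXY).ne]
  · have h1 : majoranaFactor (modeX s) s = pauli 0 := majoranaFactor_even s
    rw [h1, hanti 0 (by decide), tensor_update_smul, majorana_eq_update s _ h1]
    simp [diagonal_apply, apply_ite Complex.ofReal]
  · have h1 : majoranaFactor (modeY s) s = pauli 1 := majoranaFactor_odd s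
    rw [h1, hanti 1 (by decide), tensor_update_smul, majorana_eq_update s _ h1]
    simp [diagonal_apply, apply_ite Complex.ofReal]
  · have h1 : (s : ℕ) < ν / 2 := by simp only [modeY, Fin.lt_def] at hν; omega
    rw [majoranaFactor_of_gt h1, pauli_mul_self, one_mul,
      majorana_eq_update s ν (majoranaFactor_of_gt h1)]
    simp [diagonal_apply, hν.ne', (hXY.trans hν).ne']

end SiteOperators

/-! ### Jordan–Wigner strings and the parity operator -/

section Parity

variable {n k : ℕ}

theorem pauliAt_mul (s : Fin n) (a b : Fin 3) :
    pauliAt s a * pauliAt s b =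
      tensor (Function.update (fun _ => 1) s (pauli a * pauli b)) := by
  rw [pauliAt, pauliAt, tensor_mul]
  congr 1
  funext j
  by_cases h : j = s
  · subst h; simp
  · simp [h]

theorem pauliAt_mul_self (s : Fin n) (a : Fin 3) : pauliAt s a * pauliAt s a = 1 := by
  rw [pauliAt_mul, pauli_mul_self, Function.update_eq_self_iff.2 rfl, tensor_one]

theorem pauliAt_conjTranspose (s : Fin n) (a : Fin 3) : (pauliAt s a)ᴴ = pauliAt s a := by
  rw [pauliAt, tensor_conjTranspose]
  congr 1
  funext j
  by_cases h : j = s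
  · subst h; simp [pauli_conjTranspose]
  · simp [h]

theorem trace_pauliAt_mul (s : Fin n) (a b : Fin 3) :
    trace (pauliAt s a * pauliAt s b) = if a = b then (2 : ℂ) ^ n else 0 := by
  split_ifs with h
  · subst h; rw [pauliAt_mul_self, trace_one_op]
  · refine trace_eq_zero_of_anticomm ?_
    rw [pauliAt_mul, pauliAt_mul, pauli_anticomm h, ← neg_one_smul ℂ, tensor_update_smul,
      neg_one_smul]

theorem pauliAt_two_eq (s : Fin n) :
    pauliAt s 2 = (-Complex.I) • (majorana (modeX s) * majorana (modeY s)) := by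
  rw [majorana_eq_tensor, majorana_eq_tensor, tensor_mul, pauliAt]
  have h : pauli 2 = (-Complex.I) • (pauli 0 * pauli 1) := by
    ext i j
    fin_cases i <;> fin_cases j <;> simp [pauli]
  rw [h, tensor_update_smul]
  congr 2
  funext j
  by_cases hj : j = s
  · subst hj
    rw [Function.update_self]
    exact congrArg₂ _ (majoranaFactor_even j).symm (majoranaFactor_odd j).symm
  · rw [Function.update_of_ne hj]
    have h1 : majoranaFactor (modeY s) j = majoranaFactor (modeX s) j :=
      majoranaFactor_succ_of_ne fun h' => hj (Fin.ext h')
    rw [h1]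
    have h2 : (j : ℕ) ≠ s := fun h' => hj (Fin.ext h')
    simp only [majoranaFactor, modeX, show 2 * (s : ℕ) / 2 = s by omega, h2, if_false]
    split_ifs <;> simp [pauli_mul_self]

/-- The Jordan–Wigner string on the first `t` qubits. -/
def zString (n t : ℕ) : Op n := tensor fun j : Fin n => if (j : ℕ) < t then pauli 2 else 1

theorem zString_zero : zString n 0 = 1 := by
  simp [zString, tensor_one]

theorem zString_succ (s : Fin n) : zString n (s + 1) = zString n s * pauliAt s 2 := by
  rw [zString, zString, pauliAt, tensor_mul]
  congr 1
  funext j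
  by_cases hj : j = s
  · subst hj; simp
  · have h2 : (j : ℕ) ≠ s := fun h' => hj (Fin.ext h')
    rw [Function.update_of_ne hj, mul_one]
    simp only [show (j : ℕ) < s + 1 ↔ (j : ℕ) < s by omega]

/-- The string cancels the tail of the mode, because `Z` squares to one. -/
theorem zString_mul_majorana (s : Fin n) (ν : Fin (2 * n)) (a : Fin 3) (hν : (ν : ℕ) / 2 = s)
    (ha : majoranaFactor ν s = pauli a) : zString n s * majorana ν = pauliAt s a := by
  rw [zString, majorana_eq_tensor, pauliAt, tensor_mul]
  congr 1
  funext j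
  by_cases hj : j = s
  · subst hj; simp [ha]
  · have h2 : (j : ℕ) ≠ s := fun h' => hj (Fin.ext h')
    rw [Function.update_of_ne hj, majoranaFactor, hν]
    simp only [h2, if_false]
    split_ifs <;> simp [pauli_mul_self]

/-- `σ^z_s` is a product of two modes, so `W` commutes with it and with every string of them.
`σ^x_s` and `σ^y_s` are such a string times one mode, hence odd. -/
theorem anticomm_mul_pauliAt {W : Op n} (hW : ∀ ν, W * majorana ν = -(majorana ν * W))
    (s : Fin n) : W * pauliAt s 2 = pauliAt s 2 * W ∧
      ∀ a : Fin 3, a ≠ 2 → W * pauliAt s a = -(pauliAt s a * W) := by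
  have hz : ∀ s, W * pauliAt s 2 = pauliAt s 2 * W := by
    intro s
    rw [pauliAt_two_eq, Matrix.mul_smul, Matrix.smul_mul, ← mul_assoc, hW, neg_mul, mul_assoc,
      hW, mul_neg, neg_neg, mul_assoc]
  have hs : ∀ t, t ≤ n → W * zString n t = zString n t * W := by
    intro t
    induction t with
    | zero => intro _; rw [zString_zero, one_mul, mul_one]
    | succ t ih =>
      intro ht
      have h := zString_succ ⟨t, ht⟩
      simp only at h
      rw [h, ← mul_assoc, ih (by omega), mul_assoc, hz, mul_assoc]
  refine ⟨hz s, fun a ha => ?_⟩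
  have key : ∀ ν, zString n s * majorana ν = pauliAt s a → W * pauliAt s a = -(pauliAt s a * W) := by
    intro ν h
    rw [← h, ← mul_assoc, hs s s.2.le, mul_assoc, hW, mul_neg, mul_assoc]
  fin_cases a
  · exact key _ (zString_mul_majorana s (modeX s) 0 (by simp [modeX]) (majoranaFactor_even s))
  · exact key _ (zString_mul_majorana s (modeY s) 1 (by simp [modeY]; omega) (majoranaFactor_odd s))
  · exact absurd rfl ha

/-- The parity operator `Z ⊗ ⋯ ⊗ Z`. -/
def parityOp (n : ℕ) : Op n := tensor fun _ => pauli 2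

theorem parityOp_mul_self : parityOp n * parityOp n = 1 := by
  rw [parityOp, tensor_mul, ← tensor_one]
  simp [pauli_mul_self]

theorem parityOp_mul_majorana (ν : Fin (2 * n)) :
    parityOp n * majorana ν = -(majorana ν * parityOp n) := by
  refine tensor_anticomm _ _ ⟨ν / 2, by omega⟩ (fun j hj => ?_) ?_
  · have hj' : (j : ℕ) ≠ ν / 2 := fun h => hj (Fin.ext h)
    simp only [hj', if_false]
    split_ifs <;> simp
  · simp only [lt_irrefl, if_false, if_true]
    split_ifs <;> exact pauli_anticomm (by decide)

end Parity

/-! ### The correlator as a quadratic form -/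

section Correlator

variable {n k : ℕ} {U : Op n} {u : Matrix (Fin (2 * n)) (Fin (2 * n)) ℝ}

/-- Traces mixing `σ^z` with `σ^x` or `σ^y` vanish by parity. -/
theorem IsModeTransition.trace_mixed (h : IsModeTransition U u)
    (hU : U ∈ unitaryGroup (Fin n → Fin 2) ℂ) (α : Fin k ↪o Fin (2 * n)) (s : Fin n) {a : Fin 3}
    (ha : a ≠ 2) :
    trace ((Uᴴ * configOp α * U)ᴴ * pauliAt s a * (Uᴴ * configOp α * U) * pauliAt s 2) = 0 ∧
    trace ((Uᴴ * configOp α * U)ᴴ * pauliAt s 2 * (Uᴴ * configOp α * U) * pauliAt s a) = 0 := by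
  have hUU : U * Uᴴ = 1 := mem_unitaryGroup_iff.1 hU
  have hUU' : Uᴴ * U = 1 := mem_unitaryGroup_iff'.1 hU
  -- The evolved parity still anticommutes with every mode, because `U` maps modes to linear
  -- combinations of modes.
  set W := Uᴴ * parityOp n * U with hWdef
  have hconj : ∀ A B : Op n, (Uᴴ * A * U) * (Uᴴ * B * U) = Uᴴ * (A * B) * U := by
    intro A B
    calc _ = Uᴴ * A * (U * Uᴴ) * B * U := by simp only [mul_assoc]
      _ = _ := by rw [hUU, mul_one]; simp only [mul_assoc]
  have hWW : W * W = 1 := by rw [hWdef, hconj, parityOp_mul_self, mul_one, hUU']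
  have hW : ∀ ν, W * majorana ν = -(majorana ν * W) := by
    intro ν
    have h1 : majorana ν = Uᴴ * (U * majorana ν * Uᴴ) * U := by
      calc majorana ν = (Uᴴ * U) * majorana ν * (Uᴴ * U) := by rw [hUU']; simp
        _ = _ := by simp only [mul_assoc]
    have h2 : parityOp n * (U * majorana ν * Uᴴ) = -((U * majorana ν * Uᴴ) * parityOp n) := by
      rw [h.conj_inv hU, Finset.mul_sum, Finset.sum_mul, ← Finset.sum_neg_distrib]
      refine Finset.sum_congr rfl fun κ _ => ?_
      rw [Matrix.mul_smul, Matrix.smul_mul, parityOp_mul_majorana, smul_neg]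
    rw [h1, hWdef, hconj, hconj, h2]
    simp
  obtain ⟨hz, hxy⟩ := anticomm_mul_pauliAt hW s
  have hx := hxy a ha
  set O := Uᴴ * configOp α * U with hOdef
  have hO : W * O = (-1 : ℂ) ^ k • (O * W) := by
    rw [hWdef, hOdef, hconj, hconj, configOp,
      mul_prod_ofFn_of_sign (parityOp n) _ (fun _ => (-1 : ℤ)) fun t => by
        rw [parityOp_mul_majorana, neg_one_zsmul]]
    simp only [Finset.prod_const, Finset.card_univ, Fintype.card_fin]
    rcases Nat.even_or_odd k with hk | hk <;> simp [hk.neg_one_pow]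
  have hO' : W * Oᴴ = (-1 : ℂ) ^ k • (Oᴴ * W) := by
    have hWH : Wᴴ = W := by
      rw [hWdef, conjTranspose_mul, conjTranspose_mul, conjTranspose_conjTranspose, parityOp,
        tensor_conjTranspose]
      simp only [pauli_conjTranspose, mul_assoc]
    have h1 := congrArg conjTranspose hO
    rw [conjTranspose_mul W O, conjTranspose_smul, conjTranspose_mul O W, hWH] at h1
    rw [h1, smul_smul]
    simp [← mul_pow]
  -- The signs from passing `O` and its adjoint cancel, so only the oddness of `σ^a` remains.
  have hsq : ((-1 : ℂ) ^ k) * (-1) ^ k = 1 := by rw [← mul_pow]; simp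
  have hvanish : ∀ Y : Op n, W * Y = -(Y * W) → trace Y = 0 := by
    intro Y hY
    have h1 : trace Y = -trace Y := by
      calc trace Y = trace (W * (W * Y)) := by rw [← mul_assoc, hWW, one_mul]
        _ = -trace (W * (Y * W)) := by rw [hY, mul_neg, trace_neg]
        _ = -trace Y := by rw [trace_mul_comm, mul_assoc, hWW, mul_one]
    exact self_eq_neg.1 h1
  constructor <;> apply hvanish
  · calc W * (Oᴴ * pauliAt s a * O * pauliAt s 2)
        = W * Oᴴ * pauliAt s a * O * pauliAt s 2 := by simp only [mul_assoc]
      _ = (-1 : ℂ) ^ k • (Oᴴ * (W * pauliAt s a) * O * pauliAt s 2) := by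
        rw [hO']; simp only [Matrix.smul_mul, mul_assoc]
      _ = (-1 : ℂ) ^ k • -(Oᴴ * pauliAt s a * (W * O) * pauliAt s 2) := by
        rw [hx]; simp only [neg_mul, mul_neg, mul_assoc]
      _ = -(Oᴴ * pauliAt s a * O * (W * pauliAt s 2)) := by
        rw [hO]
        simp only [Matrix.smul_mul, Matrix.mul_smul, smul_neg, smul_smul, hsq, one_smul, mul_assoc]
      _ = _ := by rw [hz]; simp only [mul_assoc]
  · calc W * (Oᴴ * pauliAt s 2 * O * pauliAt s a)
        = W * Oᴴ * pauliAt s 2 * O * pauliAt s a := by simp only [mul_assoc]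
      _ = (-1 : ℂ) ^ k • (Oᴴ * (W * pauliAt s 2) * O * pauliAt s a) := by
        rw [hO']; simp only [Matrix.smul_mul, mul_assoc]
      _ = (-1 : ℂ) ^ k • (Oᴴ * pauliAt s 2 * (W * O) * pauliAt s a) := by
        rw [hz]; simp only [mul_assoc]
      _ = Oᴴ * pauliAt s 2 * O * (W * pauliAt s a) := by
        rw [hO]
        simp only [Matrix.smul_mul, Matrix.mul_smul, smul_smul, hsq, one_smul, mul_assoc]
      _ = _ := by rw [hx]; simp only [mul_neg, mul_assoc]

/-- `σ^x_s` fixes the modes up to its own `X` mode and negates the later ones, the opposite of the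
reflection. This overall sign is the origin of `(-1)^k` in the entries `xx` and `yy`. -/
theorem planarConj_one_zero (s : Fin n) :
    planarConj s 1 0 = -reflection (Finset.univ.filter fun μ => μ ≤ modeX s) := by
  rw [reflection_eq_diagonal, planarConj, mul_zero, zero_smul, add_zero, diagonal_neg]
  congr 1
  funext ν
  have hXY : modeX s < modeY s := by simp [modeX, modeY, Fin.lt_def]
  rcases mode_cases s ν with hν | rfl | rfl | hν
  · simp [hν, hν.le]
  · simp
  · simp [hXY.not_ge, hXY.not_gt, hXY.ne']
  · have := hXY.trans hν
    simp [this.not_ge, this.not_gt, this.ne', hν.ne']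

theorem planarConj_zero_one (s : Fin n) :
    planarConj s 0 1 =
      -reflection (Finset.univ.filter fun μ => μ < modeX s ∨ μ = modeY s) := by
  rw [reflection_eq_diagonal, planarConj, mul_zero, zero_mul, zero_smul, add_zero, diagonal_neg]
  congr 1
  funext ν
  have hXY : modeX s < modeY s := by simp [modeX, modeY, Fin.lt_def]
  rcases mode_cases s ν with hν | rfl | rfl | hν
  · simp [hν]
  · simp [hXY.ne]
  · simp [hXY.not_gt, hXY.ne']
  · have := hXY.trans hν
    simp [this.not_gt, this.ne', hν.ne']

theorem det_submatrix_neg_reflection (α : Fin k ↪o Fin (2 * n)) (η : Finset (Fin (2 * n))) :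
    (u.submatrix α id * -reflection η * (u.submatrix α id)ᵀ).det = (-1) ^ k * reflDet u α η := by
  rw [Matrix.mul_neg, Matrix.neg_mul, det_neg, Fintype.card_fin, reflDet]

/-- The diagonal action on the modes of the qubits other than `s`. -/
def outerSign (s : Fin n) (ν : Fin (2 * n)) : ℝ :=
  if ν < modeX s then 1 else if ν = modeX s then 0 else if ν = modeY s then 0 else -1

/-- Restricting to the other modes amounts to giving the two modes of `s` weight zero. This makes
the bordered block comparable with the full planar action. -/
theorem otherMode_mul (u : Matrix (Fin (2 * n)) (Fin (2 * n)) ℝ) (α : Fin k ↪o Fin (2 * n))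
    (s : Fin n) :
    (u.submatrix α Subtype.val : Matrix (Fin k) (OtherMode s) ℝ) *
      ((reflection (Finset.univ.filter fun μ => modeY s < μ)).submatrix Subtype.val Subtype.val :
        Matrix (OtherMode s) (OtherMode s) ℝ) *
      (u.submatrix α Subtype.val : Matrix (Fin k) (OtherMode s) ℝ)ᵀ =
      u.submatrix α id * diagonal (outerSign s) * (u.submatrix α id)ᵀ := by
  have hXY : modeX s < modeY s := by simp [modeX, modeY, Fin.lt_def]
  rw [reflection_eq_diagonal, submatrix_diagonal _ _ Subtype.val_injective]
  ext t t'
  rw [mul_apply, mul_apply]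
  simp only [mul_diagonal, submatrix_apply, transpose_apply, id]
  refine Fintype.sum_of_injective Subtype.val Subtype.val_injective _ _ ?_ ?_
  · intro ν hν
    rcases mode_cases s ν with h | rfl | rfl | h
    · exact absurd ⟨⟨ν, h.ne, (h.trans hXY).ne⟩, rfl⟩ hν
    · simp [outerSign]
    · simp [outerSign, hXY.not_gt, hXY.ne']
    · exact absurd ⟨⟨ν, (hXY.trans h).ne', h.ne'⟩, rfl⟩ hν
  · rintro ⟨ν, h1, h2⟩
    rcases mode_cases s ν with h | h | h | h
    · simp [outerSign, h, (h.trans hXY).not_gt]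
    · exact absurd h h1
    · exact absurd h h2
    · simp [outerSign, h, h1, h2, (hXY.trans h).not_gt]

theorem borderedDet_eq (u : Matrix (Fin (2 * n)) (Fin (2 * n)) ℝ) (α : Fin k ↪o Fin (2 * n))
    (s : Fin n) :
    borderedDet u α s = (fromBlocks (0 : Matrix (Fin 1) (Fin 1) ℝ)
      (of fun _ t => u (α t) (modeY s)) (of fun t _ => u (α t) (modeX s))
      (u.submatrix α id * diagonal (outerSign s) * (u.submatrix α id)ᵀ)).det := by
  rw [← otherMode_mul]
  rfl

/-- On the diagonals of the plane, `x² - y²` vanishes and `2xy = ±1`. Both involutions share the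
diagonal part `outerSign` and differ only in the sign of the exchange of the two modes, a symmetric
rank-two term. -/
theorem det_planar_sub (u : Matrix (Fin (2 * n)) (Fin (2 * n)) ℝ) (α : Fin k ↪o Fin (2 * n))
    (s : Fin n) {r : ℝ} (hr : 2 * r * r = 1) :
    (u.submatrix α id * planarConj s r r * (u.submatrix α id)ᵀ).det -
      (u.submatrix α id * planarConj s r (-r) * (u.submatrix α id)ᵀ).det =
        -4 * borderedDet u α s := by
  set B := u.submatrix α id * diagonal (outerSign s) * (u.submatrix α id)ᵀ with hB
  have hsym : Bᵀ = B := by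
    rw [hB, transpose_mul, transpose_mul, transpose_transpose, diagonal_transpose,
      Matrix.mul_assoc]
  have key : ∀ ε : ℝ, (ε * ε = 1) →
      u.submatrix α id * planarConj s r (ε * r) * (u.submatrix α id)ᵀ =
      B + ε • (vecMulVec (fun t => u (α t) (modeX s)) (fun t => u (α t) (modeY s)) +
        vecMulVec (fun t => u (α t) (modeY s)) (fun t => u (α t) (modeX s))) := by
    intro ε hε
    have hε2 : (ε * r) ^ 2 = r ^ 2 := by rw [mul_pow, pow_two ε, hε, one_mul]
    have hone : (2 * r * (ε * r)) = ε := by linear_combination ε * hr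
    rw [planarConj, hε2, sub_self, hone, Matrix.mul_add, Matrix.add_mul, Matrix.mul_smul,
      Matrix.smul_mul, Matrix.mul_add, Matrix.add_mul]
    congr 2
    congr 1 <;>
    · ext t t'
      simp [mul_apply, vecMulVec_apply, Matrix.single_apply, ite_and]
  have hp := key 1 (by norm_num)
  have hm := key (-1) (by norm_num)
  rw [one_mul, one_smul] at hp
  rw [neg_one_mul, neg_one_smul, ← sub_eq_add_neg] at hm
  rw [hp, hm, det_add_sub_det_sub _ hsym, borderedDet_eq]

/-- The four-point function behind the correlator. -/
def otoTrace (U : Op n) (α : Fin k ↪o Fin (2 * n)) (A B : Op n) : ℂ :=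
  trace ((Uᴴ * configOp α * U)ᴴ * A * (Uᴴ * configOp α * U) * B)

theorem otoTrace_add_left (α : Fin k ↪o Fin (2 * n)) (A A' B : Op n) :
    otoTrace U α (A + A') B = otoTrace U α A B + otoTrace U α A' B := by
  simp only [otoTrace, mul_add, add_mul, trace_add]

theorem otoTrace_add_right (α : Fin k ↪o Fin (2 * n)) (A B B' : Op n) :
    otoTrace U α A (B + B') = otoTrace U α A B + otoTrace U α A B' := by
  simp only [otoTrace, mul_add, trace_add]

theorem otoTrace_smul (α : Fin k ↪o Fin (2 * n)) (z w : ℂ) (A B : Op n) :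
    otoTrace U α (z • A) (w • B) = z * w * otoTrace U α A B := by
  simp only [otoTrace, Matrix.mul_smul, Matrix.smul_mul, trace_smul, smul_eq_mul]
  ring

/-- The correlator as a sesquilinear form in the coefficients of the single-site operator. -/
theorem oto_eq_sum (hU : U ∈ unitaryGroup (Fin n → Fin 2) ℂ) (α : Fin k ↪o Fin (2 * n))
    (s : Fin n) (v : Fin 3 → ℂ) :
    oto U α s v = ∑ a, ∑ b, star (v a) * v b * ((if a = b then 1 / 2 else 0) -
      1 / 2 ^ (n + 2) * (otoTrace U α (pauliAt s a) (pauliAt s b) +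
        otoTrace U α (pauliAt s b) (pauliAt s a))) := by
  have hUU : U * Uᴴ = 1 := mem_unitaryGroup_iff.1 hU
  have hUU' : Uᴴ * U = 1 := mem_unitaryGroup_iff'.1 hU
  obtain ⟨hC, hC'⟩ := configOp_mem_unitary α
  set O := Uᴴ * configOp α * U with hO
  have hOO : Oᴴ * O = 1 := by
    calc Oᴴ * O = Uᴴ * (configOp α)ᴴ * (U * Uᴴ) * configOp α * U := by
          simp only [hO, conjTranspose_mul, conjTranspose_conjTranspose, mul_assoc]
      _ = Uᴴ * ((configOp α)ᴴ * configOp α) * U := by rw [hUU, mul_one]; simp only [mul_assoc]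
      _ = 1 := by rw [hC, mul_one, hUU']
  have hOO' : O * Oᴴ = 1 := mul_eq_one_comm.1 hOO
  have hK : ⁅siteOp s v, O⁆ = ∑ a, v a • (pauliAt s a * O - O * pauliAt s a) := by
    rw [Ring.lie_def, siteOp, Finset.sum_mul, Finset.mul_sum, ← Finset.sum_sub_distrib]
    simp only [Matrix.smul_mul, Matrix.mul_smul, smul_sub]
  have hpair : ∀ a b, trace ((pauliAt s a * O - O * pauliAt s a)ᴴ *
      (pauliAt s b * O - O * pauliAt s b)) = 2 * (if a = b then (2 : ℂ) ^ n else 0) -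
      (otoTrace U α (pauliAt s a) (pauliAt s b) + otoTrace U α (pauliAt s b) (pauliAt s a)) := by
    intro a b
    rw [conjTranspose_sub, conjTranspose_mul _ O, conjTranspose_mul O, pauliAt_conjTranspose, sub_mul,
      mul_sub, mul_sub, trace_sub, trace_sub, trace_sub]
    have h1 : trace (Oᴴ * pauliAt s a * (pauliAt s b * O)) = if a = b then (2 : ℂ) ^ n else 0 := by
      rw [← trace_pauliAt_mul s, mul_assoc, trace_mul_comm]
      simp only [mul_assoc, hOO', mul_one]
    have h2 : trace (pauliAt s a * Oᴴ * (O * pauliAt s b)) = if a = b then (2 : ℂ) ^ n else 0 := by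
      rw [← trace_pauliAt_mul s, mul_assoc, ← mul_assoc Oᴴ, hOO, one_mul]
    have h3 : trace (Oᴴ * pauliAt s a * (O * pauliAt s b)) =
        otoTrace U α (pauliAt s a) (pauliAt s b) := by
      rw [otoTrace, ← hO]; simp only [mul_assoc]
    have h4 : trace (pauliAt s a * Oᴴ * (pauliAt s b * O)) =
        otoTrace U α (pauliAt s b) (pauliAt s a) := by
      rw [otoTrace, ← hO, mul_assoc, trace_mul_comm]; simp only [mul_assoc]
    rw [h1, h2, h3, h4]
    ring
  simp only [oto]
  rw [← hO, hK, conjTranspose_sum, Finset.sum_mul, trace_sum, Finset.mul_sum]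
  refine Finset.sum_congr rfl fun a _ => ?_
  rw [Finset.mul_sum, trace_sum, Finset.mul_sum]
  refine Finset.sum_congr rfl fun b _ => ?_
  rw [conjTranspose_smul, Matrix.smul_mul, Matrix.mul_smul, trace_smul, trace_smul, hpair,
    smul_eq_mul, smul_eq_mul]
  have h2n : (2 : ℂ) ^ (n + 2) = 4 * 2 ^ n := by ring
  rw [h2n]
  split_ifs <;> field_simp <;> ring

theorem oto_eq_quadForm (h : IsModeTransition U u) (hU : U ∈ unitaryGroup (Fin n → Fin 2) ℂ)
    (α : Fin k ↪o Fin (2 * n)) (s : Fin n) (v : Fin 3 → ℂ) :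
    oto U α s v = quadForm ((otoMatrix u α s).map Complex.ofReal) v := by
  have hplanar : ∀ x y : ℝ, x ^ 2 + y ^ 2 = 1 →
      otoTrace U α (siteOp s ![(x : ℂ), y, 0]) (siteOp s ![(x : ℂ), y, 0]) =
      2 ^ n * ((u.submatrix α id * planarConj s x y * (u.submatrix α id)ᵀ).det : ℝ) :=
    fun x y hxy => h.trace_conj hU α (siteOp_mul_self s (siteMatrix_planar_sq hxy))
      (planar_conj_majorana s hxy)
  have hsite : ∀ x y : ℂ, siteOp s ![x, y, 0] = x • pauliAt s 0 + y • pauliAt s 1 := by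
    intro x y
    simp [siteOp, Fin.sum_univ_three]
  have h00 : otoTrace U α (pauliAt s 0) (pauliAt s 0) =
      2 ^ n * ((-1) ^ k * (reflDet u α (Finset.univ.filter fun μ => μ ≤ modeX s) : ℝ)) := by
    have := hplanar 1 0 (by norm_num)
    rw [hsite, planarConj_one_zero, det_submatrix_neg_reflection] at this
    simpa using this
  have h11 : otoTrace U α (pauliAt s 1) (pauliAt s 1) =
      2 ^ n * ((-1) ^ k *
        (reflDet u α (Finset.univ.filter fun μ => μ < modeX s ∨ μ = modeY s) : ℝ)) := by
    have := hplanar 0 1 (by norm_num)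
    rw [hsite, planarConj_zero_one, det_submatrix_neg_reflection] at this
    simpa using this
  have h22 : otoTrace U α (pauliAt s 2) (pauliAt s 2) =
      2 ^ n * (reflDet u α {modeX s, modeY s} : ℝ) :=
    h.trace_conj hU α (pauliAt_mul_self s 2) (pauliAt_two_conj_majorana s)
  obtain ⟨r, hr⟩ : ∃ r : ℝ, 2 * r * r = 1 := by
    refine ⟨Real.sqrt (1 / 2), ?_⟩
    rw [mul_assoc, Real.mul_self_sqrt (by norm_num)]
    norm_num
  -- Polarization: subtracting the traces for `r(σ^x + σ^y)` and `r(σ^x - σ^y)` cancels the diagonal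
  -- terms and doubles the mixed ones, and `2r² = 1`.
  have h01 : otoTrace U α (pauliAt s 0) (pauliAt s 1) + otoTrace U α (pauliAt s 1) (pauliAt s 0) =
      2 ^ n * (-4 * (borderedDet u α s : ℝ)) := by
    have hp := hplanar r r (by linear_combination hr)
    have hm := hplanar r (-r) (by linear_combination hr)
    have hd := congrArg Complex.ofReal (det_planar_sub u α s hr)
    push_cast at hd
    rw [hsite] at hp hm
    simp only [otoTrace_add_left, otoTrace_add_right, otoTrace_smul] at hp hm
    have hr' : 2 * (r : ℂ) * r = 1 := by exact_mod_cast hr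
    push_cast at hp hm
    rw [← hd, mul_sub, ← hp, ← hm]
    linear_combination -(otoTrace U α (pauliAt s 0) (pauliAt s 1) +
      otoTrace U α (pauliAt s 1) (pauliAt s 0)) * hr'
  obtain ⟨h02, h20⟩ := h.trace_mixed hU α s (a := 0) (by decide)
  obtain ⟨h12, h21⟩ := h.trace_mixed hU α s (a := 1) (by decide)
  rw [← otoTrace] at h02 h20 h12 h21
  have h10 := (add_comm (otoTrace U α (pauliAt s 1) (pauliAt s 0)) _).trans h01
  have h2n : (2 : ℂ) ^ (n + 2) = 4 * 2 ^ n := by ring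
  rw [oto_eq_sum hU]
  simp only [Fin.sum_univ_three, h00, h11, h22, h01, h10, h02, h20, h12, h21, quadForm, dotProduct,
    mulVec, Pi.star_apply, map_apply, otoMatrix, h2n]
  simp only [of_apply, cons_val_zero, cons_val_one, cons_val]
  simp
  field_simp
  ring

/-- Complex polarization: the vectors `e_a + e_b` and `e_a + i e_b` separate `M a b` from `M b a`,
so no hermiticity is needed. -/
theorem quadForm_injective {M N : Matrix (Fin 3) (Fin 3) ℂ}
    (h : ∀ v, quadForm M v = quadForm N v) : M = N := by
  have hexp : ∀ (M : Matrix (Fin 3) (Fin 3) ℂ) (v : Fin 3 → ℂ),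
      quadForm M v = ∑ a, ∑ b, star (v a) * M a b * v b := by
    intro M v
    simp only [quadForm, dotProduct, mulVec, Finset.mul_sum, Pi.star_apply, mul_assoc]
  have hpol : ∀ (M : Matrix (Fin 3) (Fin 3) ℂ) (a b : Fin 3) (z : ℂ),
      quadForm M (Pi.single a 1 + z • Pi.single b 1) =
        M a a + z * M a b + star z * M b a + star z * z * M b b := by
    intro M a b z
    rw [hexp]
    fin_cases a <;> fin_cases b <;> simp [Fin.sum_univ_three] <;> ring
  have hdiag : ∀ a, M a a = N a a := by
    intro a
    have := h (Pi.single a 1 + (0 : ℂ) • Pi.single a 1)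
    rw [hpol, hpol] at this
    simpa using this
  ext a b
  have h1 := h (Pi.single a 1 + (1 : ℂ) • Pi.single b 1)
  have h2 := h (Pi.single a 1 + Complex.I • Pi.single b 1)
  rw [hpol, hpol, hdiag a, hdiag b] at h1 h2
  simp only [star_one, Complex.star_def, Complex.conj_I] at h1 h2
  linear_combination (1 / 2) * h1 - (1 / 2) * Complex.I * h2 +
    (1 / 2) * (M a b - N a b - M b a + N b a) * Complex.I_sq

theorem oto_eq_quadForm_iff (h : IsModeTransition U u) (hU : U ∈ unitaryGroup (Fin n → Fin 2) ℂ)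
    (α : Fin k ↪o Fin (2 * n)) (s : Fin n) (M : Matrix (Fin 3) (Fin 3) ℂ) :
    (∀ v, oto U α s v = quadForm M v) ↔ M = (otoMatrix u α s).map Complex.ofReal := by
  constructor
  · intro hM
    exact quadForm_injective fun v => (hM v).symm.trans (oto_eq_quadForm h hU α s v)
  · rintro rfl v
    exact oto_eq_quadForm h hU α s v

end Correlator

/-! ### Two-qubit operators inside `n` qubits -/

section Embedding

variable {n : ℕ}

/-- The operator that is `G` on the qubits `i, j` and `T l` on every other qubit `l`. -/
def embed (T : Fin n → Matrix (Fin 2) (Fin 2) ℂ) (i j : Fin n)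
    (G : Matrix (Fin 2 × Fin 2) (Fin 2 × Fin 2) ℂ) : Op n :=
  of fun x y => (∏ l with l ≠ i ∧ l ≠ j, T l (x l) (y l)) * G (x i, x j) (y i, y j)

theorem embed_add (T : Fin n → Matrix (Fin 2) (Fin 2) ℂ) (i j : Fin n)
    (G H : Matrix (Fin 2 × Fin 2) (Fin 2 × Fin 2) ℂ) :
    embed T i j (G + H) = embed T i j G + embed T i j H := by
  ext x y
  simp [embed, mul_add]

theorem embed_smul (T : Fin n → Matrix (Fin 2) (Fin 2) ℂ) (i j : Fin n) (z : ℂ)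
    (G : Matrix (Fin 2 × Fin 2) (Fin 2 × Fin 2) ℂ) :
    embed T i j (z • G) = z • embed T i j G := by
  ext x y
  simp [embed, mul_left_comm]

theorem embed_zero (T : Fin n → Matrix (Fin 2) (Fin 2) ℂ) (i j : Fin n) :
    embed T i j 0 = 0 := by
  ext x y
  simp [embed]

theorem embed_sum {ι : Type*} (S : Finset ι) (T : Fin n → Matrix (Fin 2) (Fin 2) ℂ) (i j : Fin n)
    (G : ι → Matrix (Fin 2 × Fin 2) (Fin 2 × Fin 2) ℂ) :
    embed T i j (∑ r ∈ S, G r) = ∑ r ∈ S, embed T i j (G r) :=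
  map_sum (⟨⟨embed T i j, embed_zero T i j⟩, embed_add T i j⟩ :
    Matrix (Fin 2 × Fin 2) (Fin 2 × Fin 2) ℂ →+ Op n) _ _

theorem embed_conjTranspose (T : Fin n → Matrix (Fin 2) (Fin 2) ℂ) (i j : Fin n)
    (G : Matrix (Fin 2 × Fin 2) (Fin 2 × Fin 2) ℂ) :
    (embed T i j G)ᴴ = embed (fun l => (T l)ᴴ) i j Gᴴ := by
  ext x y
  simp [embed, conjTranspose_apply]

theorem embed_congr {T S : Fin n → Matrix (Fin 2) (Fin 2) ℂ} {i j : Fin n}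
    (h : ∀ l, l ≠ i → l ≠ j → T l = S l) (G : Matrix (Fin 2 × Fin 2) (Fin 2 × Fin 2) ℂ) :
    embed T i j G = embed S i j G := by
  ext x y
  simp only [embed, of_apply]
  congr 1
  refine Finset.prod_congr rfl fun l hl => ?_
  rw [Finset.mem_filter] at hl
  rw [h l hl.2.1 hl.2.2]

open Kronecker in
theorem embed_kronecker (T : Fin n → Matrix (Fin 2) (Fin 2) ℂ) {i j : Fin n} (hij : i ≠ j)
    (A B : Matrix (Fin 2) (Fin 2) ℂ) :
    embed T i j (A ⊗ₖ B) = tensor (Function.update (Function.update T i A) j B) := by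
  ext x y
  rw [tensor_update_apply, embed, of_apply, kroneckerMap_apply,
    ← Finset.mul_prod_erase _ _ (Finset.mem_erase.2 ⟨hij, Finset.mem_univ i⟩),
    Function.update_self]
  have : (Finset.univ.erase j).erase i = Finset.univ.filter fun l : Fin n => l ≠ i ∧ l ≠ j := by
    ext l; simp
  rw [this, mul_comm, mul_comm (A _ _), mul_assoc]
  congr 2
  refine Finset.prod_congr rfl fun l hl => ?_
  rw [Finset.mem_filter] at hl
  rw [Function.update_of_ne hl.2.1]

open Kronecker in
theorem tensor_eq_embed (T : Fin n → Matrix (Fin 2) (Fin 2) ℂ) {i j : Fin n} (hij : i ≠ j) :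
    tensor T = embed T i j (T i ⊗ₖ T j) := by
  rw [embed_kronecker T hij, Function.update_eq_self, Function.update_eq_self]

open Kronecker in
-- For Kronecker products this is the product rule for tensors. Matrix units on two qubits are
-- Kronecker products, so bilinearity gives the rest.
theorem embed_mul (T S : Fin n → Matrix (Fin 2) (Fin 2) ℂ) {i j : Fin n} (hij : i ≠ j)
    (G H : Matrix (Fin 2 × Fin 2) (Fin 2 × Fin 2) ℂ) :
    embed T i j G * embed S i j H = embed (fun l => T l * S l) i j (G * H) := by
  have hkron : ∀ A B C D : Matrix (Fin 2) (Fin 2) ℂ,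
      embed T i j (A ⊗ₖ B) * embed S i j (C ⊗ₖ D) =
        embed (fun l => T l * S l) i j (A ⊗ₖ B * C ⊗ₖ D) := by
    intro A B C D
    rw [← mul_kronecker_mul, embed_kronecker T hij, embed_kronecker S hij,
      embed_kronecker _ hij, tensor_mul]
    congr 1
    funext l
    by_cases hj : l = j
    · subst hj; simp
    · by_cases hi : l = i
      · subst hi; simp [hj]
      · simp [hi, hj]
  have hsingle : ∀ (p q : Fin 2 × Fin 2) (z : ℂ), Matrix.single p q z =
      Matrix.single p.1 q.1 z ⊗ₖ Matrix.single p.2 q.2 (1 : ℂ) := by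
    intro p q z
    rw [single_kronecker_single, mul_one]
  induction G using Matrix.induction_on' with
  | h_zero => simp [embed_zero]
  | h_add G G' hG hG' => rw [embed_add, add_mul, hG, hG', add_mul, embed_add]
  | h_std_basis p q z =>
    induction H using Matrix.induction_on' with
    | h_zero => simp [embed_zero]
    | h_add H H' hH hH' => rw [embed_add, mul_add, hH, hH', mul_add, embed_add]
    | h_std_basis p' q' z' => rw [hsingle, hsingle, hkron]

theorem embed_one_one {i j : Fin n} (hij : i ≠ j) : embed (fun _ => 1) i j 1 = (1 : Op n) := by
  rw [← tensor_one, tensor_eq_embed _ hij, one_kronecker_one]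

end Embedding

/-! ### A single matchgate and its four modes -/

section TwoQubits

theorem matchgateMatrix_mul (V W V' W' : Matrix (Fin 2) (Fin 2) ℂ) :
    matchgateMatrix V W * matchgateMatrix V' W' = matchgateMatrix (V * V') (W * W') := by
  ext ⟨p₁, p₂⟩ ⟨q₁, q₂⟩
  fin_cases p₁ <;> fin_cases p₂ <;> fin_cases q₁ <;> fin_cases q₂ <;>
    simp [matchgateMatrix, mul_apply, Fintype.sum_prod_type, Fin.sum_univ_two]

theorem matchgateMatrix_one : matchgateMatrix 1 1 = 1 := by
  ext ⟨p₁, p₂⟩ ⟨q₁, q₂⟩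
  fin_cases p₁ <;> fin_cases p₂ <;> fin_cases q₁ <;> fin_cases q₂ <;>
    simp [matchgateMatrix, one_apply]

theorem matchgateMatrix_conjTranspose (V W : Matrix (Fin 2) (Fin 2) ℂ) :
    (matchgateMatrix V W)ᴴ = matchgateMatrix Vᴴ Wᴴ := by
  ext ⟨p₁, p₂⟩ ⟨q₁, q₂⟩
  fin_cases p₁ <;> fin_cases p₂ <;> fin_cases q₁ <;> fin_cases q₂ <;>
    simp [matchgateMatrix]

open Kronecker in
theorem zz_eq_matchgateMatrix : pauli 2 ⊗ₖ pauli 2 = matchgateMatrix 1 (-1) := by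
  ext ⟨p₁, p₂⟩ ⟨q₁, q₂⟩
  fin_cases p₁ <;> fin_cases p₂ <;> fin_cases q₁ <;> fin_cases q₂ <;>
    simp [matchgateMatrix, pauli]

/-- The hermitian parity-changing operator with block `B` from even to odd states. -/
def oddMatrix (B : Matrix (Fin 2) (Fin 2) ℂ) : Matrix (Fin 2 × Fin 2) (Fin 2 × Fin 2) ℂ :=
  of fun p q =>
    if p.1 ≠ p.2 ∧ q.1 = q.2 then B p.1 q.1
    else if p.1 = p.2 ∧ q.1 ≠ q.2 then star (B q.1 p.1)
    else 0

/-- The gate is block diagonal in parity, with `V` on even and `W` on odd states. -/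
theorem oddMatrix_conj (V W B : Matrix (Fin 2) (Fin 2) ℂ) :
    (matchgateMatrix V W)ᴴ * oddMatrix B * matchgateMatrix V W = oddMatrix (Wᴴ * B * V) := by
  rw [matchgateMatrix_conjTranspose]
  ext ⟨p₁, p₂⟩ ⟨q₁, q₂⟩
  fin_cases p₁ <;> fin_cases p₂ <;> fin_cases q₁ <;> fin_cases q₂ <;>
    simp [matchgateMatrix, oddMatrix, mul_apply, Fintype.sum_prod_type, Fin.sum_univ_two] <;> ring

theorem oddMatrix_add (B C : Matrix (Fin 2) (Fin 2) ℂ) :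
    oddMatrix (B + C) = oddMatrix B + oddMatrix C := by
  ext p q
  simp only [oddMatrix, of_apply, Matrix.add_apply]
  split_ifs <;> simp

/-- The scalar must be real because the odd-to-even block carries a complex conjugate. -/
theorem oddMatrix_smul (r : ℝ) (B : Matrix (Fin 2) (Fin 2) ℂ) :
    oddMatrix ((r : ℂ) • B) = (r : ℂ) • oddMatrix B := by
  ext p q
  simp only [oddMatrix, of_apply, Matrix.smul_apply]
  split_ifs <;> simp

/-- The even-to-odd blocks of the four Majorana operators of two qubits. -/
def modeBlock : Fin 4 → Matrix (Fin 2) (Fin 2) ℂ :=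
  ![pauli 0, pauli 1, pauli 2, Complex.I • 1]

open Kronecker in
theorem kronecker_eq_oddMatrix :
    pauli 0 ⊗ₖ 1 = oddMatrix (modeBlock 0) ∧ pauli 1 ⊗ₖ 1 = oddMatrix (modeBlock 1) ∧
    pauli 2 ⊗ₖ pauli 0 = oddMatrix (modeBlock 2) ∧
    pauli 2 ⊗ₖ pauli 1 = oddMatrix (modeBlock 3) := by
  refine ⟨?_, ?_, ?_, ?_⟩ <;> ext ⟨p₁, p₂⟩ ⟨q₁, q₂⟩ <;>
  fin_cases p₁ <;> fin_cases p₂ <;> fin_cases q₁ <;> fin_cases q₂ <;>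
    simp [oddMatrix, modeBlock, pauli]

/-- The first column of the block of mode number `q`, applied to the first column of `V`. -/
def gateColumn (V : Matrix (Fin 2) (Fin 2) ℂ) : ℕ → ℂ × ℂ
  | 0 => (V 1 0, V 0 0)
  | 1 => (-(Complex.I * V 1 0), Complex.I * V 0 0)
  | 2 => (V 0 0, -V 1 0)
  | _ => (Complex.I * V 0 0, Complex.I * V 1 0)

/-- The first column of `Wᴴ B V`, where `B` is the block of mode number `q`. -/
def gateImage (V W : Matrix (Fin 2) (Fin 2) ℂ) (q : ℕ) : ℂ × ℂ :=
  (star (W 0 0) * (gateColumn V q).1 + star (W 1 0) * (gateColumn V q).2,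
    star (W 0 1) * (gateColumn V q).1 + star (W 1 1) * (gateColumn V q).2)

/-- The transition coefficients of a matchgate between its four modes. -/
def gateCoeff (V W : Matrix (Fin 2) (Fin 2) ℂ) (q : ℕ) : ℕ → ℝ
  | 0 => (gateImage V W q).2.re
  | 1 => (gateImage V W q).2.im
  | 2 => (gateImage V W q).1.re
  | _ => (gateImage V W q).1.im

/-- With determinant one, the conjugate transpose is the adjugate; comparing entries gives the
quaternion form of `V`. -/
theorem specialUnitary_entries (V : specialUnitaryGroup (Fin 2) ℂ) :
    V.1 1 1 = star (V.1 0 0) ∧ V.1 1 0 = -star (V.1 0 1) ∧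
      V.1 0 0 * star (V.1 0 0) + V.1 0 1 * star (V.1 0 1) = 1 := by
  obtain ⟨hU, hdet⟩ := mem_specialUnitaryGroup_iff.1 V.2
  have h1 : V.1ᴴ * V.1 = 1 := mem_unitaryGroup_iff'.1 hU
  have h2 : V.1ᴴ = adjugate V.1 := by
    calc V.1ᴴ = V.1ᴴ * (V.1 * adjugate V.1) := by rw [mul_adjugate, hdet, one_smul, mul_one]
      _ = adjugate V.1 := by rw [← mul_assoc, h1, one_mul]
  rw [adjugate_fin_two] at h2
  have h00 := congrFun (congrFun h2 0) 0
  have h10 := congrFun (congrFun h2 1) 0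
  simp only [conjTranspose_apply, of_apply, cons_val_zero, cons_val_one, cons_val', cons_val_fin_one] at h00 h10
  refine ⟨h00.symm, by rw [h10, neg_neg], ?_⟩
  have h3 : V.1 * V.1ᴴ = 1 := mem_unitaryGroup_iff.1 hU
  have := congrFun (congrFun h3 0) 0
  simpa [mul_apply, Fin.sum_univ_two] using this

theorem gate_conj_modeBlock (V W : specialUnitaryGroup (Fin 2) ℂ) (q : Fin 4) :
    W.1ᴴ * modeBlock q * V.1 =
      ∑ r : Fin 4, (gateCoeff V.1 W.1 q r : ℂ) • modeBlock r := by
  obtain ⟨hV1, hV2, -⟩ := specialUnitary_entries V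
  obtain ⟨hW1, hW2, -⟩ := specialUnitary_entries W
  -- A real combination of the blocks `X, Y, Z, i` is determined by its first column `(z, w)`: the
  -- coefficients are the real and imaginary parts of `w`, then of `z`.
  have hsum : ∑ r : Fin 4, (gateCoeff V.1 W.1 q r : ℂ) • modeBlock r =
      !![(gateImage V.1 W.1 q).1, star (gateImage V.1 W.1 q).2;
        (gateImage V.1 W.1 q).2, -star (gateImage V.1 W.1 q).1] := by
    ext i j
    fin_cases i <;> fin_cases j <;>
      simp [Fin.sum_univ_four, gateCoeff, modeBlock, pauli, Complex.ext_iff]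
  rw [hsum]
  ext i j
  fin_cases q <;> fin_cases i <;> fin_cases j <;>
    simp [modeBlock, gateImage, gateColumn, pauli, mul_apply, Fin.sum_univ_two, hV1, hV2, hW1,
      hW2] <;> ring

theorem gateCoeff_det (V W : specialUnitaryGroup (Fin 2) ℂ) :
    (of fun q r : Fin 4 => gateCoeff V.1 W.1 q r).det = 1 := by
  have hnorm : ∀ V : specialUnitaryGroup (Fin 2) ℂ, (V.1 0 0).re ^ 2 + (V.1 0 0).im ^ 2 +
      (V.1 1 0).re ^ 2 + (V.1 1 0).im ^ 2 = 1 := by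
    intro V
    obtain ⟨-, h2, h3⟩ := specialUnitary_entries V
    have := congrArg Complex.re h3
    rw [h2]
    simp at this ⊢
    linarith
  obtain ⟨hW1, hW2, -⟩ := specialUnitary_entries W
  have hW3 : W.1 0 1 = -star (W.1 1 0) := by rw [hW2, star_neg, star_star, neg_neg]
  have hV := hnorm V
  have hW := hnorm W
  -- Right multiplication by `V` and left multiplication by `W†` separate into two factors. Each has
  -- as determinant the square of a quaternion norm.
  have hfac : (of fun q r : Fin 4 => gateCoeff V.1 W.1 q r) =
      !![(V.1 0 0).re, (V.1 0 0).im, (V.1 1 0).re, (V.1 1 0).im;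
        -(V.1 0 0).im, (V.1 0 0).re, (V.1 1 0).im, -(V.1 1 0).re;
        -(V.1 1 0).re, -(V.1 1 0).im, (V.1 0 0).re, (V.1 0 0).im;
        -(V.1 1 0).im, (V.1 1 0).re, -(V.1 0 0).im, (V.1 0 0).re] *
      !![(W.1 0 0).re, (W.1 0 0).im, (W.1 1 0).re, -(W.1 1 0).im;
        -(W.1 0 0).im, (W.1 0 0).re, (W.1 1 0).im, (W.1 1 0).re;
        -(W.1 1 0).re, -(W.1 1 0).im, (W.1 0 0).re, -(W.1 0 0).im;
        (W.1 1 0).im, -(W.1 1 0).re, (W.1 0 0).im, (W.1 0 0).re] := by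
    ext q r
    fin_cases q <;> fin_cases r <;>
      simp [gateCoeff, gateImage, gateColumn, mul_apply, Fin.sum_univ_four, hW1, hW3] <;> ring
  have hl : ∀ p₀ p₁ s₀ s₁ : ℝ, (!![p₀, p₁, s₀, s₁; -p₁, p₀, s₁, -s₀; -s₀, -s₁, p₀, p₁;
      -s₁, s₀, -p₁, p₀] : Matrix (Fin 4) (Fin 4) ℝ).det =
      (p₀ ^ 2 + p₁ ^ 2 + s₀ ^ 2 + s₁ ^ 2) ^ 2 := by
    intro p₀ p₁ s₀ s₁
    simp [det_succ_row_zero, Fin.sum_univ_succ, Fin.succAbove]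
    ring
  have hr : ∀ c₀ c₁ e₀ e₁ : ℝ, (!![c₀, c₁, e₀, -e₁; -c₁, c₀, e₁, e₀; -e₀, -e₁, c₀, -c₁;
      e₁, -e₀, c₁, c₀] : Matrix (Fin 4) (Fin 4) ℝ).det =
      (c₀ ^ 2 + c₁ ^ 2 + e₀ ^ 2 + e₁ ^ 2) ^ 2 := by
    intro c₀ c₁ e₀ e₁
    simp [det_succ_row_zero, Fin.sum_univ_succ, Fin.succAbove]
    ring
  rw [hfac, det_mul, hl, hr, hV, hW]
  norm_num

end TwoQubits

/-! ### Transition matrices of placed gates and circuits -/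

section Gates

variable {n : ℕ}

/-- The first qubit of a placed matchgate. -/
def Matchgate.left (g : Matchgate n) : Fin n := ⟨g.pos, by have := g.pos_lt; omega⟩

/-- The second qubit of a placed matchgate. -/
def Matchgate.right (g : Matchgate n) : Fin n := ⟨g.pos + 1, g.pos_lt⟩

theorem Matchgate.left_ne_right (g : Matchgate n) : g.left ≠ g.right := by
  intro h
  have := congrArg Fin.val h
  simp [left, right] at this

theorem Matchgate.toOp_eq_embed (g : Matchgate n) :
    g.toOp = embed (fun _ => 1) g.left g.right (matchgateMatrix g.V.1 g.W.1) := by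
  ext x y
  simp only [Matchgate.toOp, embed, of_apply, one_apply, Finset.prod_ite_zero,
    Finset.prod_const_one, Finset.mem_filter, Finset.mem_univ, true_and, and_imp]
  change (if ∀ l : Fin n, l ≠ g.left → l ≠ g.right → x l = y l then
    matchgateMatrix g.V.1 g.W.1 (x g.left, x g.right) (y g.left, y g.right) else 0) = _
  split_ifs <;> simp

theorem Matchgate.conj_embed (g : Matchgate n) (T : Fin n → Matrix (Fin 2) (Fin 2) ℂ)
    (G : Matrix (Fin 2 × Fin 2) (Fin 2 × Fin 2) ℂ) :
    g.toOpᴴ * embed T g.left g.right G * g.toOp = embed T g.left g.right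
      ((matchgateMatrix g.V.1 g.W.1)ᴴ * G * matchgateMatrix g.V.1 g.W.1) := by
  rw [g.toOp_eq_embed, embed_conjTranspose, embed_mul _ _ g.left_ne_right,
    embed_mul _ _ g.left_ne_right]
  simp

theorem specialUnitary_conjTranspose_mul (V : specialUnitaryGroup (Fin 2) ℂ) : V.1ᴴ * V.1 = 1 :=
  mem_unitaryGroup_iff'.1 (mem_specialUnitaryGroup_iff.1 V.2).1

theorem Matchgate.toOp_mem_unitaryGroup (g : Matchgate n) :
    g.toOp ∈ unitaryGroup (Fin n → Fin 2) ℂ := by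
  rw [mem_unitaryGroup_iff', star_eq_conjTranspose, g.toOp_eq_embed, embed_conjTranspose,
    embed_mul _ _ g.left_ne_right, matchgateMatrix_conjTranspose, matchgateMatrix_mul,
    specialUnitary_conjTranspose_mul, specialUnitary_conjTranspose_mul, matchgateMatrix_one]
  simp only [conjTranspose_one, mul_one]
  exact embed_one_one g.left_ne_right

/-- The entries of the transition matrix of a matchgate. -/
def Matchgate.coeff (g : Matchgate n) (i j : ℕ) : ℝ :=
  if 2 * g.pos ≤ i ∧ i < 2 * g.pos + 4 ∧ 2 * g.pos ≤ j ∧ j < 2 * g.pos + 4 then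
    gateCoeff g.V.1 g.W.1 (i - 2 * g.pos) (j - 2 * g.pos)
  else if i = j then 1 else 0

/-- The transition matrix of a matchgate. -/
def Matchgate.transition (g : Matchgate n) : Matrix (Fin (2 * n)) (Fin (2 * n)) ℝ :=
  of fun i j => g.coeff i j

/-- The modes of a placed matchgate. -/
def Matchgate.mode (g : Matchgate n) (q : Fin 4) : Fin (2 * n) :=
  ⟨2 * g.pos + q, by have := g.pos_lt; omega⟩

theorem Matchgate.mode_injective (g : Matchgate n) : Function.Injective g.mode := by
  intro q r h
  have := congrArg Fin.val h
  simp only [mode] at this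
  exact Fin.ext (by omega)

theorem Matchgate.mem_range_mode (g : Matchgate n) (μ : Fin (2 * n)) :
    μ ∈ Set.range g.mode ↔ 2 * g.pos ≤ μ ∧ (μ : ℕ) < 2 * g.pos + 4 := by
  constructor
  · rintro ⟨q, rfl⟩
    simp only [mode]
    omega
  · rintro ⟨h1, h2⟩
    exact ⟨⟨μ - 2 * g.pos, by omega⟩, Fin.ext (by simp only [mode]; omega)⟩

theorem Matchgate.transition_of_notMem (g : Matchgate n) {μ : Fin (2 * n)}
    (h : μ ∉ Set.range g.mode) (ν : Fin (2 * n)) :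
    g.transition μ ν = if μ = ν then 1 else 0 := by
  rw [g.mem_range_mode] at h
  rw [transition, of_apply, coeff, if_neg (by tauto)]
  simp only [Fin.ext_iff]

theorem Matchgate.transition_mode (g : Matchgate n) (q r : Fin 4) :
    g.transition (g.mode q) (g.mode r) = gateCoeff g.V.1 g.W.1 q r := by
  rw [transition, of_apply, coeff, if_pos]
  · simp [mode]
  · simp only [mode]; omega

theorem Matchgate.transition_mode_of_notMem (g : Matchgate n) (q : Fin 4) {ν : Fin (2 * n)}
    (h : ν ∉ Set.range g.mode) : g.transition (g.mode q) ν = 0 := by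
  have h' : g.mode q ≠ ν := fun h' => h ⟨q, h'⟩
  rw [g.mem_range_mode] at h
  rw [transition, of_apply, coeff, if_neg (by tauto), if_neg fun h => h' (Fin.ext h)]

theorem Matchgate.transition_det (g : Matchgate n) : g.transition.det = 1 := by
  rw [det_eq_det_submatrix_of_rows g.transition g.mode g.mode_injective
    fun μ hμ ν => g.transition_of_notMem hμ ν, ← gateCoeff_det g.V g.W]
  congr 1
  ext q r
  exact g.transition_mode q r

/-- Outside the two qubits all four modes have the same factors, `Z` to the left and `1` to the
right, so a single background serves for all of them. -/
theorem Matchgate.majorana_mode (g : Matchgate n) (q : Fin 4) :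
    majorana (g.mode q) = embed (fun j : Fin n => majoranaFactor (2 * g.pos) j) g.left g.right
      (oddMatrix (modeBlock q)) := by
  obtain ⟨h0, h1, h2, h3⟩ := kronecker_eq_oddMatrix
  rw [majorana_eq_tensor, tensor_eq_embed _ g.left_ne_right]
  rw [embed_congr (S := fun j : Fin n => majoranaFactor (2 * g.pos) j)]
  · congr 1
    fin_cases q
    · refine Eq.trans ?_ h0
      congr 1
      · exact majoranaFactor_even _
      · exact majoranaFactor_of_lt (by simp [mode, right])
    · refine Eq.trans ?_ h1
      congr 1
      · exact majoranaFactor_odd _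
      · exact majoranaFactor_of_lt (by simp [mode, right]; omega)
    · refine Eq.trans ?_ h2
      congr 1
      · exact majoranaFactor_of_gt (by simp [mode, left])
      · exact majoranaFactor_even (g.pos + 1)
    · refine Eq.trans ?_ h3
      congr 1
      · exact majoranaFactor_of_gt (by simp [mode, left]; omega)
      · exact majoranaFactor_odd (g.pos + 1)
  · intro l hl hr
    have hl' : (l : ℕ) ≠ g.pos := fun h => hl (Fin.ext h)
    have hr' : (l : ℕ) ≠ g.pos + 1 := fun h => hr (Fin.ext h)
    simp only [mode]
    rcases Nat.lt_or_ge l g.pos with h | h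
    · rw [majoranaFactor_of_gt (by omega), majoranaFactor_of_gt (by omega)]
    · rw [majoranaFactor_of_lt (by omega), majoranaFactor_of_lt (by omega)]

theorem Matchgate.isModeTransition (g : Matchgate n) : IsModeTransition g.toOp g.transition := by
  intro μ
  by_cases hμ : μ ∈ Set.range g.mode
  · obtain ⟨q, rfl⟩ := hμ
    have hsum : ∑ ν, (g.transition (g.mode q) ν : ℂ) • majorana ν =
        ∑ r : Fin 4, (gateCoeff g.V.1 g.W.1 q r : ℂ) • majorana (g.mode r) := by
      symm
      refine Fintype.sum_of_injective g.mode g.mode_injective _ _ (fun ν hν => ?_) fun r => ?_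
      · rw [g.transition_mode_of_notMem q hν, Complex.ofReal_zero, zero_smul]
      · rw [g.transition_mode]
    rw [hsum, g.majorana_mode, g.conj_embed, oddMatrix_conj, gate_conj_modeBlock]
    simp only [g.majorana_mode, ← embed_smul, ← embed_sum, ← oddMatrix_smul]
    congr 1
    simp only [Fin.sum_univ_four, oddMatrix_add]
  · have hsum : ∑ ν, (g.transition μ ν : ℂ) • majorana ν = majorana μ := by
      simp only [g.transition_of_notMem hμ]
      simp
    rw [hsum, majorana_eq_tensor, tensor_eq_embed _ g.left_ne_right, g.conj_embed]
    rw [g.mem_range_mode] at hμ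
    congr 1
    -- A mode outside the gate restricts to `1 ⊗ 1` or `Z ⊗ Z` on the pair; both are constant on
    -- each parity sector and commute with the gate.
    rcases Nat.lt_or_ge (μ : ℕ) (2 * g.pos) with h | h
    · rw [majoranaFactor_of_lt (by simp only [left]; omega),
        majoranaFactor_of_lt (by simp only [right]; omega), one_kronecker_one, mul_one,
        matchgateMatrix_conjTranspose, matchgateMatrix_mul, specialUnitary_conjTranspose_mul,
        specialUnitary_conjTranspose_mul, matchgateMatrix_one]
    · rw [majoranaFactor_of_gt (by simp only [left]; omega),
        majoranaFactor_of_gt (by simp only [right]; omega), zz_eq_matchgateMatrix,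
        matchgateMatrix_conjTranspose, matchgateMatrix_mul, matchgateMatrix_mul, mul_one, mul_neg,
        mul_one, neg_mul, specialUnitary_conjTranspose_mul, specialUnitary_conjTranspose_mul]

theorem circuitOp_mem_unitaryGroup (L : List (Matchgate n)) :
    circuitOp L ∈ unitaryGroup (Fin n → Fin 2) ℂ := by
  refine Submonoid.list_prod_mem _ fun x hx => ?_
  obtain ⟨g, -, rfl⟩ := List.mem_map.1 hx
  exact g.toOp_mem_unitaryGroup

/-- The transition matrix of a circuit. -/
def circuitTransition (L : List (Matchgate n)) : Matrix (Fin (2 * n)) (Fin (2 * n)) ℝ :=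
  (L.map Matchgate.transition).prod

theorem isModeTransition_circuit (L : List (Matchgate n)) :
    IsModeTransition (circuitOp L) (circuitTransition L) := by
  induction L with
  | nil => exact IsModeTransition.one
  | cons g L ih => exact g.isModeTransition.mul ih

theorem circuitTransition_det (L : List (Matchgate n)) : (circuitTransition L).det = 1 := by
  induction L with
  | nil => exact det_one
  | cons g L ih =>
    rw [circuitTransition, List.map_cons, List.prod_cons, det_mul, g.transition_det, one_mul]
    exact ih

theorem circuitTransition_mem (L : List (Matchgate n)) :
    circuitTransition L ∈ specialOrthogonalGroup (Fin (2 * n)) ℝ := by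
  rw [mem_specialOrthogonalGroup_iff, mem_orthogonalGroup_iff]
  exact ⟨(isModeTransition_circuit L).mul_transpose (circuitOp_mem_unitaryGroup L),
    circuitTransition_det L⟩

end Gates

/-! ### Loop invariants and memory updates -/

section Loops

theorem foldl_range_induction {σ : Type*} (f : σ → ℕ → σ) (P : ℕ → σ → Prop) {N : ℕ} {x : σ}
    (h0 : P 0 x) (hs : ∀ t y, t < N → P t y → P (t + 1) (f y t)) :
    P N ((List.range N).foldl f x) := by
  induction N with
  | zero => exact h0
  | succ N ih =>
    rw [List.range_succ, List.foldl_append]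
    exact hs N _ (Nat.lt_succ_self N) (ih fun t y ht => hs t y (ht.trans (Nat.lt_succ_self N)))

/-- An invariant of the memory along the rounds of a loop. -/
theorem Program.loop_induction (P : ℕ → Memory → Prop) {r b : ℕ} {p : Program} {m : Memory}
    (h0 : P 0 m) (hs : ∀ t m', t < m.idx b → P t m' → P (t + 1) (p.run (m'.setIdx r t)).1) :
    P (m.idx b) ((Program.loop r b p).run m).1 := by
  simp only [Program.run]
  exact foldl_range_induction (σ := Memory × ℕ) _ (fun t st => P t st.1) h0
    fun t y ht hy => hs t y.1 ht hy

@[simp] theorem Memory.setIdx_idx (m : Memory) (r x r' : ℕ) :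
    (m.setIdx r x).idx r' = if r' = r then x else m.idx r' := by
  simp [Memory.setIdx, Function.update_apply]

@[simp] theorem Memory.setIdx_val (m : Memory) (r x : ℕ) : (m.setIdx r x).val = m.val := rfl

@[simp] theorem Memory.set_idx (m : Memory) (c : Cell) (z : ℂ) : (m.set c z).idx = m.idx := rfl

theorem Memory.set_val_self (m : Memory) (c : Cell) (z : ℂ) :
    (m.set c z).val c.arr (m.idx c.row) (m.idx c.col) = z := by
  simp [Memory.set]

theorem Memory.set_val_of_ne (m : Memory) (c : Cell) (z : ℂ) {a : ℕ} (h : a ≠ c.arr) :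
    (m.set c z).val a = m.val a := by
  funext i j
  simp [Memory.set, h]

end Loops

/-! ### Step bounds from program syntax -/

section StepCount

open Polynomial

/-- A polynomial step bound, in terms of a bound on the lengths of the loops. -/
def Program.cost : Program → Polynomial ℕ
  | .seq p q => p.cost + q.cost
  | .ifLe _ _ p q => p.cost + q.cost + 1
  | .ifZero _ p q => p.cost + q.cost + 1
  | .loop _ _ p => 1 + X * (p.cost + 1)
  | _ => 1

/-- All loops of the program have their lengths in the registers `B`, which are never written. -/
def Program.boundedBy (B : List ℕ) : Program → Bool
  | .putIdx r _ => !B.elem r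
  | .addIdx r _ _ => !B.elem r
  | .subIdx r _ _ => !B.elem r
  | .seq p q => p.boundedBy B && q.boundedBy B
  | .ifLe _ _ p q => p.boundedBy B && q.boundedBy B
  | .ifZero _ p q => p.boundedBy B && q.boundedBy B
  | .loop r b p => !B.elem r && B.elem b && p.boundedBy B
  | _ => true

/-- The registers in `B` keep their contents throughout, so every loop, however deeply nested, has
at most `N` rounds. The induction must carry this preservation along with the bound. -/
theorem Program.steps_le {B : List ℕ} {N : ℕ} (p : Program) (hp : p.boundedBy B = true) :
    ∀ m : Memory, (∀ b ∈ B, m.idx b ≤ N) →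
      (p.run m).2 ≤ p.cost.eval N ∧ ∀ b ∈ B, (p.run m).1.idx b = m.idx b := by
  have hset : ∀ (m : Memory) (r x : ℕ), r ∉ B → ∀ b ∈ B, (m.setIdx r x).idx b = m.idx b := by
    intro m r x hr b hb
    rw [Memory.setIdx_idx, if_neg]
    rintro rfl
    exact hr hb
  induction p with
  | seq p q hp' hq' =>
    intro m hm
    simp only [boundedBy, Bool.and_eq_true] at hp
    obtain ⟨h1, h2⟩ := hp' hp.1 m hm
    obtain ⟨h3, h4⟩ := hq' hp.2 (p.run m).1 fun b hb => (h2 b hb).symm ▸ hm b hb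
    refine ⟨?_, fun b hb => (h4 b hb).trans (h2 b hb)⟩
    simp only [run, cost, eval_add]
    exact Nat.add_le_add h1 h3
  | ifLe a b p q hp' hq' =>
    intro m hm
    simp only [boundedBy, Bool.and_eq_true] at hp
    obtain ⟨h1, h2⟩ := hp' hp.1 m hm
    obtain ⟨h3, h4⟩ := hq' hp.2 m hm
    simp only [run, cost, eval_add, eval_one]
    split_ifs
    · exact ⟨by omega, h2⟩
    · exact ⟨by omega, h4⟩
  | ifZero a p q hp' hq' =>
    intro m hm
    simp only [boundedBy, Bool.and_eq_true] at hp
    obtain ⟨h1, h2⟩ := hp' hp.1 m hm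
    obtain ⟨h3, h4⟩ := hq' hp.2 m hm
    simp only [run, cost, eval_add, eval_one]
    split_ifs
    · exact ⟨by omega, h2⟩
    · exact ⟨by omega, h4⟩
  | loop r b p hp' =>
    intro m hm
    simp only [boundedBy, Bool.and_eq_true, Bool.not_eq_true', List.elem_eq_mem,
      decide_eq_false_iff_not, decide_eq_true_eq] at hp
    obtain ⟨⟨hr, hb⟩, hp⟩ := hp
    simp only [run, cost, eval_add, eval_one, eval_mul, eval_X]
    have key := foldl_range_induction (σ := Memory × ℕ)
      (fun st t => ((p.run (st.1.setIdx r t)).1, st.2 + (p.run (st.1.setIdx r t)).2 + 1))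
      (fun t st => st.2 ≤ 1 + t * (p.cost.eval N + 1) ∧ ∀ b ∈ B, st.1.idx b = m.idx b)
      (N := m.idx b) (x := (m, 1)) ⟨by simp, fun _ _ => rfl⟩ (by
        rintro t ⟨m', c⟩ - ⟨hc, hm'⟩
        have h1 : ∀ b ∈ B, (m'.setIdx r t).idx b = m.idx b := fun b hb =>
          (hset m' r t hr b hb).trans (hm' b hb)
        obtain ⟨h2, h3⟩ := hp' hp (m'.setIdx r t) fun b hb => (h1 b hb).symm ▸ hm b hb
        refine ⟨?_, fun b hb => (h3 b hb).trans (h1 b hb)⟩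
        simp only at hc ⊢
        rw [Nat.succ_mul]
        omega)
    refine ⟨key.1.trans ?_, key.2⟩
    exact Nat.add_le_add_left (Nat.mul_le_mul_right _ (hm b hb)) 1
  | putIdx r x | addIdx r x y | subIdx r x y =>
    intro m hm
    simp only [boundedBy, Bool.not_eq_true', List.elem_eq_mem, decide_eq_false_iff_not] at hp
    exact ⟨by simp [run, cost], hset m r _ hp⟩
  | _ =>
    intro m hm
    simp [run, cost]

end StepCount

/-! ### Arithmetic expressions and their compiler -/

section Expressions

/-- Binary operations of complex arithmetic. -/
inductive ArithOp
  | add | sub | mul | div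

def ArithOp.eval : ArithOp → ℂ → ℂ → ℂ
  | add => (· + ·)
  | sub => (· - ·)
  | mul => (· * ·)
  | div => (· / ·)

def ArithOp.instr : ArithOp → Cell → Cell → Cell → Program
  | add => Program.add
  | sub => Program.sub
  | mul => Program.mul
  | div => Program.div

/-- Arithmetic expressions over cells, with sums over register ranges, index arithmetic and
index comparisons. Arrays from `32` on and registers from `16` on serve as scratch memory of the
compiled code; register `15` holds zero. -/
inductive ArithExpr
  | zero | one | imag
  | cell (c : Cell)
  | bin (o : ArithOp) (e f : ArithExpr)
  | conj (e : ArithExpr)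
  | sum (r b : ℕ) (e : ArithExpr)
  | bindAdd (r a b : ℕ) (e : ArithExpr)
  | bindSub (r a b : ℕ) (e : ArithExpr)
  | ifLe (a b : ℕ) (e f : ArithExpr)

namespace ArithExpr

@[simp] def eval : ArithExpr → Memory → ℂ
  | zero, _ => 0
  | one, _ => 1
  | imag, _ => Complex.I
  | cell c, m => m.val c.arr (m.idx c.row) (m.idx c.col)
  | bin o e f, m => o.eval (e.eval m) (f.eval m)
  | conj e, m => star (e.eval m)
  | sum r b e, m => ∑ t ∈ Finset.range (m.idx b), e.eval (m.setIdx r t)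
  | bindAdd r a b e, m => e.eval (m.setIdx r (m.idx a + m.idx b))
  | bindSub r a b e, m => e.eval (m.setIdx r (m.idx a - m.idx b))
  | ifLe a b e f, m => if m.idx a ≤ m.idx b then e.eval m else f.eval m

/-- The registers an expression reads. -/
def free : ArithExpr → List ℕ
  | zero | one | imag => []
  | cell c => [c.row, c.col]
  | bin _ e f => e.free ++ f.free
  | conj e => e.free
  | sum r b e => b :: e.free.filter (· != r)
  | bindAdd r a b e => a :: b :: e.free.filter (· != r)
  | bindSub r a b e => a :: b :: e.free.filter (· != r)
  | ifLe a b e f => a :: b :: (e.free ++ f.free)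

/-- The registers the compiled expression writes. -/
def bound : ArithExpr → List ℕ
  | zero | one | imag | cell _ => []
  | bin _ e f => e.bound ++ f.bound
  | conj e => e.bound
  | sum r _ e => r :: e.bound
  | bindAdd r _ _ e => r :: e.bound
  | bindSub r _ _ e => r :: e.bound
  | ifLe _ _ e f => e.bound ++ f.bound

/-- The arrays an expression reads. -/
def arrays : ArithExpr → List ℕ
  | zero | one | imag => []
  | cell c => [c.arr]
  | bin _ e f => e.arrays ++ f.arrays
  | conj e => e.arrays
  | sum _ _ e => e.arrays
  | bindAdd _ _ _ e => e.arrays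
  | bindSub _ _ _ e => e.arrays
  | ifLe _ _ e f => e.arrays ++ f.arrays

/-- Static check: bound registers are not captured, and scratch memory is not accessed. -/
def ok : ArithExpr → Bool
  | zero | one | imag => true
  | cell c => decide (c.arr < 32)
  | bin _ e f => e.ok && f.ok && e.bound.all fun x => !f.free.elem x
  | conj e => e.ok
  | sum r _ e => e.ok && decide (16 ≤ r) && e.bound.all fun x => x != r && !e.free.elem x
  | bindAdd r _ _ e => e.ok && decide (16 ≤ r)
  | bindSub r _ _ e => e.ok && decide (16 ≤ r)
  | ifLe _ _ e f => e.ok && f.ok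

/-- The cell that holds the value of a subexpression at depth `d`. -/
def temp (d : ℕ) : Cell := ⟨32 + d, 15, 15⟩

/-- A stack discipline: code at depth `d` leaves its result in array `32 + d` and may overwrite only
that array and higher ones. There is no copy instruction, so a cell is loaded by adding it to zero.
-/
def compile : ArithExpr → ℕ → Program
  | zero, d => .putZero (temp d)
  | one, d => .putOne (temp d)
  | imag, d => .putI (temp d)
  | cell c, d => .seq (.putZero (temp d)) (.add (temp d) (temp d) c)
  | bin o e f, d => .seq (e.compile d) (.seq (f.compile (d + 1))
      (o.instr (temp d) (temp d) (temp (d + 1))))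
  | conj e, d => .seq (e.compile d) (.conj (temp d) (temp d))
  | sum r b e, d => .seq (.putZero (temp d))
      (.loop r b (.seq (e.compile (d + 1)) (.add (temp d) (temp d) (temp (d + 1)))))
  | bindAdd r a b e, d => .seq (.addIdx r a b) (e.compile d)
  | bindSub r a b e, d => .seq (.subIdx r a b) (e.compile d)
  | ifLe a b e f, d => .ifLe a b (e.compile d) (f.compile d)

theorem eval_congr (e : ArithExpr) : ∀ {m m' : Memory}, (∀ r ∈ e.free, m.idx r = m'.idx r) →
    (∀ a ∈ e.arrays, m.val a = m'.val a) → e.eval m = e.eval m' := by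
  have hset : ∀ {e : ArithExpr} {m m' : Memory} (r x : ℕ),
      (∀ r' ∈ e.free.filter (· != r), m.idx r' = m'.idx r') →
      ∀ r' ∈ e.free, (m.setIdx r x).idx r' = (m'.setIdx r x).idx r' := by
    intro e m m' r x h r' hr'
    by_cases hrr : r' = r
    · simp [hrr]
    · simp [hrr, h r' (List.mem_filter.2 ⟨hr', by simpa using hrr⟩)]
  induction e with
  | zero | one | imag => intros; rfl
  | cell c =>
    intro m m' h1 h2
    simp only [free, arrays, List.mem_cons, List.not_mem_nil, or_false, forall_eq_or_imp,
      forall_eq] at h1 h2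
    simp [h1.1, h1.2, h2]
  | bin o e f he hf =>
    intro m m' h1 h2
    simp only [free, arrays, List.mem_append] at h1 h2
    simp only [eval]
    rw [he (fun r hr => h1 r (.inl hr)) fun a ha => h2 a (.inl ha),
      hf (fun r hr => h1 r (.inr hr)) fun a ha => h2 a (.inr ha)]
  | conj e he =>
    intro m m' h1 h2
    simp only [eval]
    rw [he h1 h2]
  | sum r b e he =>
    intro m m' h1 h2
    simp only [free, arrays, List.mem_cons, forall_eq_or_imp] at h1 h2
    simp only [eval]
    rw [h1.1]
    exact Finset.sum_congr rfl fun t _ => he (hset r t h1.2) h2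
  | bindAdd r a b e he | bindSub r a b e he =>
    intro m m' h1 h2
    simp only [free, arrays, List.mem_cons, forall_eq_or_imp] at h1 h2
    simp only [eval]
    rw [h1.1, h1.2.1]
    exact he (hset r _ h1.2.2) h2
  | ifLe a b e f he hf =>
    intro m m' h1 h2
    simp only [free, arrays, List.mem_cons, List.mem_append, forall_eq_or_imp] at h1 h2
    simp only [eval]
    rw [h1.1, h1.2.1, he (fun r hr => h1.2.2 r (.inl hr)) fun a ha => h2 a (.inl ha),
      hf (fun r hr => h1.2.2 r (.inr hr)) fun a ha => h2 a (.inr ha)]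

theorem bound_ge (e : ArithExpr) (he : e.ok = true) : ∀ r ∈ e.bound, 16 ≤ r := by
  induction e with
  | zero | one | imag | cell => simp [bound]
  | bin o e f he' hf' | ifLe a b e f he' hf' =>
    simp only [ok, Bool.and_eq_true] at he
    intro r hr
    simp only [bound, List.mem_append] at hr
    grind
  | conj e he' => exact he' he
  | sum r b e he' | bindAdd r a b e he' | bindSub r a b e he' =>
    simp only [ok, Bool.and_eq_true, decide_eq_true_eq] at he
    intro r' hr
    simp only [bound, List.mem_cons] at hr
    grind

theorem arrays_lt (e : ArithExpr) (he : e.ok = true) : ∀ a ∈ e.arrays, a < 32 := by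
  induction e with
  | zero | one | imag => simp [arrays]
  | cell c => simpa [arrays, ok] using he
  | bin o e f he' hf' | ifLe a b e f he' hf' =>
    simp only [ok, Bool.and_eq_true] at he
    intro r hr
    simp only [arrays, List.mem_append] at hr
    grind
  | conj e he' => exact he' he
  | sum r b e he' | bindAdd r a b e he' | bindSub r a b e he' =>
    simp only [ok, Bool.and_eq_true, decide_eq_true_eq] at he
    exact he' (by grind)

theorem temp_set_self {m : Memory} (hm : m.idx 15 = 0) (d : ℕ) (z : ℂ) :
    (m.set (temp d) z).val (32 + d) 0 0 = z := by
  have := m.set_val_self (temp d) z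
  simpa only [temp, hm] using this

theorem temp_set_of_lt (m : Memory) {d a : ℕ} (h : a < 32 + d) (z : ℂ) :
    (m.set (temp d) z).val a = m.val a :=
  m.set_val_of_ne _ _ (by simp only [temp]; omega)

theorem get_temp {m : Memory} (hm : m.idx 15 = 0) (d : ℕ) :
    m.get (temp d) = m.val (32 + d) 0 0 := by
  simp only [Memory.get, temp, hm]

/-- Running the compiled expression stores its value and preserves the rest of the memory. -/
theorem compile_spec (e : ArithExpr) (he : e.ok = true) : ∀ (m : Memory) (d : ℕ), m.idx 15 = 0 →
    ((e.compile d).run m).1.val (32 + d) 0 0 = e.eval m ∧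
    (∀ r, r ∉ e.bound → ((e.compile d).run m).1.idx r = m.idx r) ∧
    ∀ a, a < 32 + d → ((e.compile d).run m).1.val a = m.val a := by
  have h15 : ∀ e : ArithExpr, e.ok = true → 15 ∉ e.bound := fun e he h =>
    absurd (e.bound_ge he 15 h) (by norm_num)
  induction e with
  | zero | one | imag =>
    intro m d hm
    exact ⟨temp_set_self hm d _, fun _ _ => rfl, fun a ha => temp_set_of_lt m ha _⟩
  | cell c =>
    intro m d hm
    have hm' : (m.set (temp d) 0).idx 15 = 0 := hm
    have hc : c.arr < 32 := by simpa [ok] using he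
    refine ⟨?_, fun _ _ => rfl, fun a ha => ?_⟩
    · simp only [compile, Program.run]
      rw [temp_set_self hm', get_temp hm', temp_set_self hm, zero_add, Memory.get,
        temp_set_of_lt m (by omega)]
      rfl
    · simp only [compile, Program.run]
      rw [temp_set_of_lt _ ha, temp_set_of_lt _ ha]
  | bin o e f he' hf' =>
    intro m d hm
    simp only [ok, Bool.and_eq_true, List.all_eq_true, Bool.not_eq_true', List.elem_eq_mem,
      decide_eq_false_iff_not] at he
    obtain ⟨⟨heo, hfo⟩, hef⟩ := he
    obtain ⟨a1, a2, a3⟩ := he' heo m d hm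
    set m₁ := ((e.compile d).run m).1
    have hm₁ : m₁.idx 15 = 0 := (a2 15 (h15 e heo)).trans hm
    obtain ⟨b1, b2, b3⟩ := hf' hfo m₁ (d + 1) hm₁
    set m₂ := ((f.compile (d + 1)).run m₁).1
    have hm₂ : m₂.idx 15 = 0 := (b2 15 (h15 f hfo)).trans hm₁
    -- The code for `e` has already run; the static check ensures that it wrote no register or array
    -- read by `f`.
    have hf : f.eval m₁ = f.eval m := f.eval_congr (fun r hr => a2 r fun h => hef r h hr)
      fun a ha => a3 a (by have := f.arrays_lt hfo a ha; omega)
    have hrun : (((bin o e f).compile d).run m).1 =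
        m₂.set (temp d) (o.eval (e.eval m) (f.eval m)) := by
      have h1 : m₂.get (temp d) = e.eval m := by rw [get_temp hm₂, b3 _ (by omega), a1]
      have h2 : m₂.get (temp (d + 1)) = f.eval m := by rw [get_temp hm₂, b1, hf]
      rw [← h1, ← h2]
      cases o <;> rfl
    rw [hrun]
    refine ⟨temp_set_self hm₂ _ _, fun r hr => ?_, fun a ha => ?_⟩
    · simp only [bound, List.mem_append, not_or] at hr
      exact (b2 r hr.2).trans (a2 r hr.1)
    · rw [temp_set_of_lt _ ha, b3 a (by omega), a3 a ha]
  | conj e he' =>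
    intro m d hm
    obtain ⟨a1, a2, a3⟩ := he' he m d hm
    set m₁ := ((e.compile d).run m).1
    have hm₁ : m₁.idx 15 = 0 := (a2 15 (h15 e he)).trans hm
    have hrun : (((conj e).compile d).run m).1 = m₁.set (temp d) (star (m₁.get (temp d))) := rfl
    rw [hrun, get_temp hm₁, a1]
    exact ⟨temp_set_self hm₁ _ _, a2, fun a ha => by rw [temp_set_of_lt _ ha, a3 a ha]⟩
  | sum r b e he' =>
    intro m d hm
    have hok := he
    simp only [ok, Bool.and_eq_true, List.all_eq_true, Bool.not_eq_true', List.elem_eq_mem,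
      decide_eq_false_iff_not, decide_eq_true_eq, bne_iff_ne] at he
    obtain ⟨⟨heo, hr⟩, hb⟩ := he
    have hrun : (((sum r b e).compile d).run m).1 = ((Program.loop r b (.seq (e.compile (d + 1))
      (.add (temp d) (temp d) (temp (d + 1))))).run (m.set (temp d) 0)).1 := rfl
    rw [hrun]
    have key := Program.loop_induction
      (fun T m' => m'.val (32 + d) 0 0 = ∑ t ∈ Finset.range T, e.eval (m.setIdx r t) ∧
        (∀ r', r' ∉ (sum r b e).bound → m'.idx r' = m.idx r') ∧
        ∀ a, a < 32 + d → m'.val a = m.val a)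
      (r := r) (b := b) (p := .seq (e.compile (d + 1)) (.add (temp d) (temp d) (temp (d + 1))))
      (m := m.set (temp d) 0)
      ⟨by rw [temp_set_self hm, Finset.sum_range_zero], fun _ _ => rfl,
        fun a ha => temp_set_of_lt m ha _⟩
      (by
        rintro t m' - ⟨c1, c2, c3⟩
        have hm' : (m'.setIdx r t).idx 15 = 0 := by
          rw [Memory.setIdx_idx, if_neg (by omega), c2 15 (h15 _ hok), hm]
        obtain ⟨a1, a2, a3⟩ := he' heo (m'.setIdx r t) (d + 1) hm'
        have hrun' : ((Program.seq (e.compile (d + 1)) (.add (temp d) (temp d)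
            (temp (d + 1)))).run (m'.setIdx r t)).1 =
          (((e.compile (d + 1)).run (m'.setIdx r t)).1).set (temp d)
            ((((e.compile (d + 1)).run (m'.setIdx r t)).1).get (temp d) +
              (((e.compile (d + 1)).run (m'.setIdx r t)).1).get (temp (d + 1))) := rfl
        rw [hrun']
        set m₁ := ((e.compile (d + 1)).run (m'.setIdx r t)).1
        have hm₁ : m₁.idx 15 = 0 := (a2 15 (h15 e heo)).trans hm'
        -- Earlier rounds may have changed bound registers, but apart from the counter `r`, which is
        -- reset, none of them is free in `e`.
        have hev : e.eval (m'.setIdx r t) = e.eval (m.setIdx r t) := by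
          refine e.eval_congr (fun r' hr' => ?_) fun a ha => c3 a ?_
          · rw [Memory.setIdx_idx, Memory.setIdx_idx]
            split_ifs with h
            · rfl
            · refine c2 r' ?_
              simp only [bound, List.mem_cons, not_or]
              exact ⟨h, fun h' => (hb r' h').2 hr'⟩
          · have := e.arrays_lt heo a ha
            omega
        refine ⟨?_, fun r' hr' => ?_, fun a ha => ?_⟩
        · rw [temp_set_self hm₁, get_temp hm₁, get_temp hm₁, a1, a3 _ (by omega),
            Memory.setIdx_val, c1, hev, Finset.sum_range_succ]
        · have hr'' := hr'
          simp only [bound, List.mem_cons, not_or] at hr''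
          rw [Memory.set_idx, a2 r' hr''.2, Memory.setIdx_idx, if_neg hr''.1, c2 r' hr']
        · rw [temp_set_of_lt _ ha, a3 a (by omega), Memory.setIdx_val, c3 a ha])
    exact key
  | bindAdd r a b e he' | bindSub r a b e he' =>
    intro m d hm
    simp only [ok, Bool.and_eq_true, decide_eq_true_eq] at he
    obtain ⟨heo, hr⟩ := he
    have key : ∀ x,
        ((e.compile d).run (m.setIdx r x)).1.val (32 + d) 0 0 = e.eval (m.setIdx r x) ∧
        (∀ r', r' ∉ r :: e.bound → ((e.compile d).run (m.setIdx r x)).1.idx r' = m.idx r') ∧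
        ∀ a, a < 32 + d → ((e.compile d).run (m.setIdx r x)).1.val a = m.val a := by
      intro x
      obtain ⟨a1, a2, a3⟩ := he' heo (m.setIdx r x) d (by
        rw [Memory.setIdx_idx, if_neg (by omega), hm])
      refine ⟨a1, fun r' hr' => ?_, a3⟩
      simp only [List.mem_cons, not_or] at hr'
      rw [a2 r' hr'.2, Memory.setIdx_idx, if_neg hr'.1]
    exact key _
  | ifLe a b e f he' hf' =>
    intro m d hm
    simp only [ok, Bool.and_eq_true] at he
    obtain ⟨a1, a2, a3⟩ := he' he.1 m d hm
    obtain ⟨b1, b2, b3⟩ := hf' he.2 m d hm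
    simp only [compile, Program.run, eval, bound, List.mem_append, not_or]
    split_ifs
    · exact ⟨a1, fun r hr => a2 r hr.1, a3⟩
    · exact ⟨b1, fun r hr => b2 r hr.2, b3⟩

end ArithExpr

end Expressions

/-! ### Array assignments and their compilation -/

section Statements

/-- Replacing a whole array. -/
def Memory.setArr (m : Memory) (A : ℕ) (f : ℕ → ℕ → ℂ) : Memory :=
  { m with val := Function.update m.val A f }

@[simp] theorem Memory.setArr_idx (m : Memory) (A : ℕ) (f : ℕ → ℕ → ℂ) :
    (m.setArr A f).idx = m.idx := rfl

@[simp] theorem Memory.setArr_val (m : Memory) (A : ℕ) (f : ℕ → ℕ → ℂ) (a : ℕ) :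
    (m.setArr A f).val a = if a = A then f else m.val a := by
  simp [Memory.setArr, Function.update_apply]

/-- Straight-line matrix programs with loops: `assign A b c e` sets the entries `(i, j)` of the
array `A` to `e`, where `i` and `j` run below the contents of the registers `b` and `c`; in `e`
they are the contents of the registers `16` and `17`. -/
inductive Stmt
  | assign (A b c : ℕ) (e : ArithExpr)
  | seq (s t : Stmt)
  | loop (r b : ℕ) (s : Stmt)

namespace Stmt

/-- The effect of a statement, disregarding scratch memory. -/
def den : Stmt → Memory → Memory
  | assign A b c e, m => m.setArr A fun i j =>
      if i < m.idx b ∧ j < m.idx c then e.eval ((m.setIdx 16 i).setIdx 17 j) else m.val A i j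
  | seq s t, m => t.den (s.den m)
  | loop r b s, m => (List.range (m.idx b)).foldl (fun m' t => s.den (m'.setIdx r t)) m

/-- Conjugating twice copies the scratch result into the target without needing a zeroed cell. -/
def toProgram : Stmt → Program
  | assign A b c e => .loop 16 b (.loop 17 c (.seq (e.compile 0)
      (.seq (.conj (ArithExpr.temp 0) (ArithExpr.temp 0))
        (.conj ⟨A, 16, 17⟩ (ArithExpr.temp 0)))))
  | seq s t => .seq s.toProgram t.toProgram
  | loop r b s => .loop r b s.toProgram

/-- Static check of a statement. -/
def ok : Stmt → Bool
  | assign A b c e => decide (A < 32) && decide (b < 16) && decide (c < 16) && e.ok &&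
      !e.arrays.elem A && (e.bound.all fun x => x != 16 && x != 17 && !e.free.elem x) &&
      e.free.all fun x => decide (x < 18)
  | seq s t => s.ok && t.ok
  | loop r b s => decide (r < 15) && decide (b < 16) && s.ok

/-- Two memories agree outside of the scratch memory. -/
structure Agree (m m' : Memory) : Prop where
  idx : ∀ r, r < 16 → m.idx r = m'.idx r
  val : ∀ a, a < 32 → m.val a = m'.val a
  zero : m.idx 15 = 0

/-- The loops overwrite `A` entry by entry while `den` replaces it at once. They agree because `e`
may not read `A`, so partial assignment cannot affect later entries. -/
theorem assign_spec {A b c : ℕ} {e : ArithExpr} (hs : (assign A b c e).ok = true) {m m' : Memory}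
    (h : Agree m m') : Agree ((assign A b c e).toProgram.run m).1 ((assign A b c e).den m') := by
  simp only [ok, Bool.and_eq_true, List.all_eq_true, Bool.not_eq_true', List.elem_eq_mem,
    decide_eq_false_iff_not, decide_eq_true_eq, bne_iff_ne] at hs
  obtain ⟨⟨⟨⟨⟨⟨hA, hb⟩, hc⟩, he⟩, hAe⟩, hbound⟩, hfree⟩ := hs
  set body : Program := .seq (e.compile 0) (.seq (.conj (ArithExpr.temp 0) (ArithExpr.temp 0))
    (.conj ⟨A, 16, 17⟩ (ArithExpr.temp 0)))
  set F : ℕ → ℕ → ℂ := fun i j => e.eval ((m'.setIdx 16 i).setIdx 17 j)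
  have hge : ∀ r, r < 18 → r ∈ e.free ∨ r < 16 ∨ r = 16 ∨ r = 17 → r ∉ e.bound := by
    intro r hr h hrb
    have h1 := hbound r hrb
    have h2 := e.bound_ge he r hrb
    omega
  -- `Q S m₀` says that exactly the entries in `S` have been assigned
  let Q : (ℕ → ℕ → Prop) → Memory → Prop := fun S m₀ =>
    (∀ r, r < 16 → m₀.idx r = m'.idx r) ∧ (∀ a, a < 32 → a ≠ A → m₀.val a = m'.val a) ∧
      ∀ i j, (S i j → m₀.val A i j = F i j) ∧ (¬ S i j → m₀.val A i j = m'.val A i j)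
  have hbody : ∀ (S : ℕ → ℕ → Prop) (m₀ : Memory) (i j : ℕ), Q S m₀ → m₀.idx 16 = i →
      Q (fun i' j' => S i' j' ∨ (i' = i ∧ j' = j)) (body.run (m₀.setIdx 17 j)).1 ∧
        (body.run (m₀.setIdx 17 j)).1.idx 16 = i := by
    rintro S m₀ i j ⟨q1, q2, q3⟩ hi
    have h15 : (m₀.setIdx 17 j).idx 15 = 0 := by
      rw [Memory.setIdx_idx, if_neg (by norm_num), q1 15 (by norm_num), ← h.idx 15 (by norm_num),
        h.zero]
    obtain ⟨a1, a2, a3⟩ := e.compile_spec he (m₀.setIdx 17 j) 0 h15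
    set m₁ := ((e.compile 0).run (m₀.setIdx 17 j)).1 with hm₁
    have hidx : ∀ r, r < 18 → m₁.idx r = if r = 17 then j else m₀.idx r := by
      intro r hr
      rw [a2 r (hge r hr (by omega)), Memory.setIdx_idx]
    have hm15 : m₁.idx 15 = 0 := by rw [hidx 15 (by norm_num)]; simpa using h15
    have hev : e.eval (m₀.setIdx 17 j) = F i j := by
      refine e.eval_congr (fun r hr => ?_) fun a ha => ?_
      · have := hfree r hr
        simp only [Memory.setIdx_idx]
        split_ifs with h1 h2
        · rfl
        · rw [h2, hi]
        · exact q1 r (by omega)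
      · exact q2 a (e.arrays_lt he a ha) fun h => hAe (h ▸ ha)
    have hrun : (body.run (m₀.setIdx 17 j)).1 =
        (m₁.set (ArithExpr.temp 0) (star (F i j))).set ⟨A, 16, 17⟩ (F i j) := by
      have h1 : (body.run (m₀.setIdx 17 j)).1 =
          (m₁.set (ArithExpr.temp 0) (star (m₁.get (ArithExpr.temp 0)))).set ⟨A, 16, 17⟩
            (star ((m₁.set (ArithExpr.temp 0) (star (m₁.get (ArithExpr.temp 0)))).get
              (ArithExpr.temp 0))) := rfl
      rw [h1, ArithExpr.get_temp (m := m₁.set _ _) hm15, ArithExpr.temp_set_self hm15, star_star,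
        ArithExpr.get_temp hm15, a1, hev]
    rw [hrun]
    have h16 : m₁.idx 16 = i := by rw [hidx 16 (by norm_num), if_neg (by norm_num), hi]
    have h17 : m₁.idx 17 = j := by rw [hidx 17 (by norm_num), if_pos rfl]
    refine ⟨⟨fun r hr => ?_, fun a ha haA => ?_, fun i' j' => ?_⟩, h16⟩
    · rw [Memory.set_idx, Memory.set_idx, hidx r (by omega), if_neg (by omega), q1 r hr]
    · rw [Memory.set_val_of_ne _ _ _ haA, ArithExpr.temp_set_of_lt _ (by omega), a3 a (by omega)]
      exact q2 a ha haA
    · have hval : ((m₁.set (ArithExpr.temp 0) (star (F i j))).set ⟨A, 16, 17⟩ (F i j)).val A i' j' =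
          if i' = i ∧ j' = j then F i j else m₀.val A i' j' := by
        have h1 : (m₁.set (ArithExpr.temp 0) (star (F i j))).val A = m₀.val A := by
          rw [ArithExpr.temp_set_of_lt _ (by omega), a3 A (by omega), Memory.setIdx_val]
        change (if A = A ∧ i' = m₁.idx 16 ∧ j' = m₁.idx 17 then F i j
          else (m₁.set (ArithExpr.temp 0) (star (F i j))).val A i' j') = _
        simp only [h16, h17, true_and, h1]
      rw [hval]
      constructor
      · intro hS
        split_ifs with hij
        · rw [hij.1, hij.2]
        · exact (q3 i' j').1 (hS.resolve_right hij)
      · intro hS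
        rw [if_neg fun hij => hS (.inr hij)]
        exact (q3 i' j').2 fun h => hS (.inl h)
  have hQ0 : Q (fun i _ => i < 0) m :=
    ⟨h.idx, fun a ha _ => h.val a ha, fun i j => ⟨fun h => absurd h (by omega),
      fun _ => by rw [h.val A hA]⟩⟩
  have hQcongr : ∀ {S S' : ℕ → ℕ → Prop} {m₀ : Memory}, (∀ i j, S i j ↔ S' i j) → Q S m₀ →
      Q S' m₀ := by
    intro S S' m₀ hSS h
    have : S = S' := by funext i j; exact propext (hSS i j)
    rwa [← this]
  -- After `T` outer rounds the first `T` rows are assigned; the inner invariant adds an initial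
  -- segment of the current row.
  have houter := Program.loop_induction (r := 16) (b := b) (p := .loop 17 c body) (m := m)
    (fun T m₀ => Q (fun i j => i < T ∧ j < m'.idx c) m₀)
    (hQcongr (by simp) hQ0) (by
      intro i m₀ _ hQ
      have hc' : (m₀.setIdx 16 i).idx c = m'.idx c := by
        rw [Memory.setIdx_idx, if_neg (by omega), hQ.1 c hc]
      have hinner := Program.loop_induction (r := 17) (b := c) (p := body) (m := m₀.setIdx 16 i)
        (fun T m₁ => Q (fun i' j' => (i' < i ∧ j' < m'.idx c) ∨ (i' = i ∧ j' < T)) m₁ ∧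
          m₁.idx 16 = i)
        ⟨hQcongr (S := fun i' j' => i' < i ∧ j' < m'.idx c) (by simp)
          ⟨fun r hr => by rw [Memory.setIdx_idx, if_neg (by omega), hQ.1 r hr], hQ.2⟩, by simp⟩
        (by
          rintro j m₁ - ⟨hQ₁, hi⟩
          obtain ⟨h1, h2⟩ := hbody _ m₁ i j hQ₁ hi
          refine ⟨hQcongr (fun i' j' => ?_) h1, h2⟩
          omega)
      rw [hc'] at hinner
      exact hQcongr (fun i' j' => by omega) hinner.1)
  obtain ⟨q1, q2, q3⟩ := houter
  refine ⟨fun r hr => q1 r hr, fun a ha => ?_, ?_⟩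
  · simp only [den, Memory.setArr_val]
    split_ifs with haA
    · subst haA
      funext i j
      rw [← h.idx b hb]
      split_ifs with hij
      · exact (q3 i j).1 hij
      · exact (q3 i j).2 hij
    · exact q2 a ha haA
  · exact (q1 15 (by norm_num)).trans ((h.idx 15 (by norm_num)).symm.trans h.zero)

theorem toProgram_spec (s : Stmt) (hs : s.ok = true) :
    ∀ {m m' : Memory}, Agree m m' → Agree (s.toProgram.run m).1 (s.den m') := by
  induction s with
  | assign A b c e => exact fun h => assign_spec hs h
  | seq s t hs' ht' =>
    intro m m' h
    simp only [ok, Bool.and_eq_true] at hs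
    exact ht' hs.2 (hs' hs.1 h)
  | loop r b s hs' =>
    intro m m' h
    simp only [ok, Bool.and_eq_true, decide_eq_true_eq] at hs
    obtain ⟨⟨hr, hb⟩, hs⟩ := hs
    have hset : ∀ {m m' : Memory} (t : ℕ), Agree m m' → Agree (m.setIdx r t) (m'.setIdx r t) := by
      intro m m' t h
      refine ⟨fun r' hr' => ?_, h.val, ?_⟩
      · simp only [Memory.setIdx_idx]
        split_ifs
        · rfl
        · exact h.idx r' hr'
      · rw [Memory.setIdx_idx, if_neg (by omega), h.zero]
    have key := Program.loop_induction (r := r) (b := b) (p := s.toProgram) (m := m)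
      (fun T m₁ => Agree m₁ ((List.range T).foldl (fun m' t => s.den (m'.setIdx r t)) m'))
      h (by
        intro t m₁ _ h₁
        rw [List.range_succ, List.foldl_append]
        exact hs' hs (hset t h₁))
    rw [h.idx b hb] at key
    simp only [toProgram, den]
    rw [← h.idx b hb] at key ⊢
    exact key

end Stmt

end Statements

/-! ### The Faddeev–LeVerrier iteration as a program -/

section DeterminantProgram

instance : Add ArithExpr := ⟨.bin .add⟩
instance : Sub ArithExpr := ⟨.bin .sub⟩
instance : Mul ArithExpr := ⟨.bin .mul⟩
instance : Div ArithExpr := ⟨.bin .div⟩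

namespace ArithExpr

@[simp] theorem eval_add (e f : ArithExpr) (m : Memory) :
    (e + f).eval m = e.eval m + f.eval m := rfl
@[simp] theorem eval_sub (e f : ArithExpr) (m : Memory) :
    (e - f).eval m = e.eval m - f.eval m := rfl
@[simp] theorem eval_mul (e f : ArithExpr) (m : Memory) :
    (e * f).eval m = e.eval m * f.eval m := rfl
@[simp] theorem eval_div (e f : ArithExpr) (m : Memory) :
    (e / f).eval m = e.eval m / f.eval m := rfl

/-- The entry of the array `a` at the contents of the registers `r` and `c`. -/
def at_ (a r c : ℕ) : ArithExpr := cell ⟨a, r, c⟩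

@[simp] theorem eval_at (a r c : ℕ) (m : Memory) :
    (at_ a r c).eval m = m.val a (m.idx r) (m.idx c) := rfl

/-- Case distinction on the equality of two registers. -/
def ifEq (a b : ℕ) (e f : ArithExpr) : ArithExpr := ifLe a b (ifLe b a e f) f

@[simp] theorem eval_ifEq (a b : ℕ) (e f : ArithExpr) (m : Memory) :
    (ifEq a b e f).eval m = if m.idx a = m.idx b then e.eval m else f.eval m := by
  simp only [ifEq, eval]
  split_ifs <;> first | rfl | omega

end ArithExpr

open ArithExpr

/-- One round of the Faddeev–LeVerrier iteration for minus the matrix in array `8`. -/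
def leverrierStmt (N : ℕ) : Stmt :=
  -- The new matrix passes through the buffer array `11`, since an assignment may not read its own
  -- target.
  .seq (.assign 11 N N (ifEq 16 17 (at_ 10 15 15) zero - sum 18 N (at_ 8 16 18 * at_ 9 18 17))) <|
  .seq (.assign 9 N N (at_ 11 16 17)) <|
  .assign 10 7 7 (sum 18 N (sum 19 N (at_ 8 18 19 * at_ 9 19 18)) / sum 18 N (ifLe 18 13 one zero))

/-- Stores in array `out` the determinant of the matrix in array `8`, with size in register `N`. -/
def detStmt (N out : ℕ) : Stmt :=
  .seq (.assign 9 N N zero) <| .seq (.assign 10 7 7 one) <|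
  .seq (.loop 13 N (leverrierStmt N)) (.assign out 7 7 (at_ 10 15 15))

/-- `N` is a register number, not a size: register `3` holds `2n` for the plain minors and register
`4` holds `2n + 1` for the bordered one. The matrix is stored as `A`, and the minus sign of the
iteration sits in the formulas. -/
theorem leverrierStmt_den {N N₀ t : ℕ} (hN : N = 3 ∨ N = 4) {m : Memory} (h7 : m.idx 7 = 1)
    (h15 : m.idx 15 = 0) (hN₀ : m.idx N = N₀) (h13 : m.idx 13 = t) (ht : t < N₀)
    {A : Matrix (Fin N₀) (Fin N₀) ℂ} (hA : ∀ i j : Fin N₀, m.val 8 i j = A i j)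
    (h9 : ∀ i j : Fin N₀, m.val 9 i j = (leverrierMat (-A) t).1 i j)
    (h10 : m.val 10 0 0 = (leverrierMat (-A) t).2) :
    let m' := (leverrierStmt N).den m
    m'.idx = m.idx ∧ (∀ a, a ≠ 9 → a ≠ 10 → a ≠ 11 → m'.val a = m.val a) ∧
    (∀ i j : Fin N₀, m'.val 9 i j = (leverrierMat (-A) (t + 1)).1 i j) ∧
    m'.val 10 0 0 = (leverrierMat (-A) (t + 1)).2 := by
  subst hN₀ h13
  have hstep1 : ∀ i j : Fin (m.idx N), (if (i : ℕ) = j then m.val 10 0 0 else 0) -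
      ∑ k ∈ Finset.range (m.idx N), m.val 8 i k * m.val 9 k j =
      (leverrierMat (-A) (m.idx 13 + 1)).1 i j := by
    intro i j
    rw [Finset.sum_range]
    have h1 : (leverrierMat (-A) (m.idx 13 + 1)).1 =
        -A * (leverrierMat (-A) (m.idx 13)).1 + (leverrierMat (-A) (m.idx 13)).2 • 1 := rfl
    rw [h1, h10]
    simp only [Matrix.add_apply, Matrix.neg_mul, Matrix.neg_apply, mul_apply,
      Matrix.smul_apply, one_apply, hA, h9, Fin.ext_iff]
    split_ifs <;> simp
    ring
  -- A register cannot be read as a complex number, so the divisor `t + 1` is obtained by counting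
  -- the indices not exceeding the loop counter. This count needs `t < N₀`.
  have hcount : ∑ t ∈ Finset.range (m.idx N), (if t ≤ m.idx 13 then (1 : ℂ) else 0) =
      m.idx 13 + 1 := by
    rw [← Finset.sum_filter, Finset.sum_const, nsmul_eq_mul, mul_one]
    have : (Finset.range (m.idx N)).filter (· ≤ m.idx 13) = Finset.range (m.idx 13 + 1) := by
      ext t
      simp only [Finset.mem_filter, Finset.mem_range]
      omega
    rw [this, Finset.card_range]
    push_cast
    rfl
  have hstep2 : (∑ i ∈ Finset.range (m.idx N), ∑ k ∈ Finset.range (m.idx N), m.val 8 i k *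
      ((if (k : ℕ) = i then m.val 10 0 0 else 0) -
      ∑ l ∈ Finset.range (m.idx N), m.val 8 k l * m.val 9 l i)) / (m.idx 13 + 1) =
      (leverrierMat (-A) (m.idx 13 + 1)).2 := by
    have h1 : (leverrierMat (-A) (m.idx 13 + 1)).2 =
      -(-A * (leverrierMat (-A) (m.idx 13 + 1)).1).trace / (m.idx 13 + 1) := rfl
    rw [h1, Matrix.neg_mul, trace_neg, neg_neg, Finset.sum_range]
    congr 1
    rw [trace]
    refine Finset.sum_congr rfl fun i _ => ?_
    rw [Finset.sum_range, diag_apply, mul_apply]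
    refine Finset.sum_congr rfl fun k _ => ?_
    rw [← hstep1 k i, hA]
  rcases hN with rfl | rfl <;>
  · refine ⟨rfl, ?_, ?_, ?_⟩
    · intro a h9 h10 h11
      simp [leverrierStmt, Stmt.den, h9, h10, h11]
    · intro i j
      rw [← hstep1]
      simp [leverrierStmt, Stmt.den, ArithOp.eval, h15]
    · rw [← hstep2, ← hcount]
      simp only [leverrierStmt, Stmt.den]
      simp [h7, h15, ArithOp.eval, Finset.sum_range]

end DeterminantProgram

/-! ### From the transition matrix to the form -/

section Tail

open ArithExpr

theorem detStmt_den {N N₀ out : ℕ} (hN : N = 3 ∨ N = 4) {m : Memory} (h7 : m.idx 7 = 1)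
    (h15 : m.idx 15 = 0) (hN₀ : m.idx N = N₀) {A : Matrix (Fin N₀) (Fin N₀) ℂ}
    (hA : ∀ i j : Fin N₀, m.val 8 i j = A i j) :
    let m' := (detStmt N out).den m
    (∀ r, r ≠ 13 → m'.idx r = m.idx r) ∧
    (∀ a, a ≠ 9 → a ≠ 10 → a ≠ 11 → a ≠ out → m'.val a = m.val a) ∧
    m'.val out 0 0 = A.det := by
  have hN13 : N ≠ 13 := by omega
  set m₁ := (Stmt.assign 10 7 7 one).den ((Stmt.assign 9 N N zero).den m) with hm₁
  have hval : ∀ a, a ≠ 9 → a ≠ 10 → m₁.val a = m.val a := by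
    intro a h9 h10
    simp [hm₁, Stmt.den, h9, h10]
  -- The invariant is that arrays `9` and `10` hold round `T` of the iteration while array `8` still
  -- holds `A`.
  have key : ∀ T, T ≤ N₀ → ∀ m₂, m₂ = (List.range T).foldl
      (fun m' t => (leverrierStmt N).den (m'.setIdx 13 t)) m₁ →
      (∀ r, r ≠ 13 → m₂.idx r = m.idx r) ∧
      (∀ a, a ≠ 9 → a ≠ 10 → a ≠ 11 → m₂.val a = m.val a) ∧
      (∀ i j : Fin N₀, m₂.val 9 i j = (leverrierMat (-A) T).1 i j) ∧
      m₂.val 10 0 0 = (leverrierMat (-A) T).2 := by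
    intro T
    induction T with
    | zero =>
      rintro - m₂ rfl
      refine ⟨fun r _ => rfl, fun a h9 h10 _ => hval a h9 h10, fun i j => ?_, ?_⟩
      · simp [hm₁, Stmt.den, leverrierMat, hN₀]
      · simp [hm₁, Stmt.den, leverrierMat, h7]
    | succ T ih =>
      intro hT m₂ hm₂
      rw [List.range_succ, List.foldl_append, List.foldl_cons, List.foldl_nil] at hm₂
      obtain ⟨i1, i2, i3, i4⟩ := ih (by omega) _ rfl
      set m₃ := (List.range T).foldl (fun m' t => (leverrierStmt N).den (m'.setIdx 13 t)) m₁
      obtain ⟨j1, j2, j3, j4⟩ := leverrierStmt_den hN (m := m₃.setIdx 13 T) (by simp [i1, h7])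
        (by simp [i1, h15]) (by simp [hN13, i1, hN₀]) (by simp) (Nat.lt_of_succ_le hT)
        (fun i j => by rw [Memory.setIdx_val, i2 8 (by decide) (by decide) (by decide), hA])
        i3 i4
      rw [← hm₂] at j1 j2 j3 j4
      refine ⟨fun r hr => ?_, fun a h9 h10 h11 => (j2 a h9 h10 h11).trans (i2 a h9 h10 h11),
        j3, j4⟩
      rw [j1, Memory.setIdx_idx, if_neg hr, i1 r hr]
  obtain ⟨k1, k2, -, k4⟩ := key N₀ le_rfl _ rfl
  have hden : (detStmt N out).den m = (Stmt.assign out 7 7 (at_ 10 15 15)).den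
      ((List.range N₀).foldl (fun m' t => (leverrierStmt N).den (m'.setIdx 13 t)) m₁) := by
    rw [← hN₀]
    rfl
  rw [hden]
  refine ⟨fun r hr => k1 r hr, fun a h9 h10 h11 ho => ?_, ?_⟩
  · rw [← k2 a h9 h10 h11]
    simp [Stmt.den, ho]
  · rw [← leverrierMat_det A, Fintype.card_fin, ← k4]
    simp [Stmt.den, k1, h7, h15]

/-- The matrix whose determinant is the minor of `u D uᵀ` with modes in `α`, for a diagonal
matrix `D` whose entries are given by `d`. -/
def minorExpr (d : ArithExpr) : ArithExpr :=
  at_ 1 15 16 * at_ 1 15 17 * sum 18 3 (d * (at_ 7 16 18 * at_ 7 17 18)) +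
    ifEq 16 17 (one - at_ 1 15 16) zero

variable {n k : ℕ}

theorem configVec_mem (α : Fin k ↪o Fin (2 * n)) (t : Fin k) : configVec α (α t) = 1 :=
  if_pos ⟨t, rfl⟩

theorem configVec_notMem (α : Fin k ↪o Fin (2 * n)) {i : Fin (2 * n)} (hi : i ∉ Set.range α) :
    configVec α i = 0 :=
  if_neg fun ⟨t, ht⟩ => hi ⟨t, Fin.ext ht⟩

theorem submatrix_mul_diagonal_mul (u : Matrix (Fin (2 * n)) (Fin (2 * n)) ℝ)
    (α : Fin k ↪o Fin (2 * n)) (d : Fin (2 * n) → ℝ) (t t' : Fin k) :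
    ((u.submatrix α id * diagonal d * (u.submatrix α id)ᵀ) t t' : ℂ) =
      ∑ l, (d l : ℂ) * (u (α t) l * u (α t') l) := by
  rw [mul_apply]
  simp only [mul_diagonal, submatrix_apply, transpose_apply, id]
  push_cast
  exact Finset.sum_congr rfl fun l _ => by ring

/-- A row outside `α` becomes a row of the identity and drops out. So a determinant of fixed size
gives the minor, and the program needs neither `k` nor a list of the modes in `α`. -/
theorem det_minor (u : Matrix (Fin (2 * n)) (Fin (2 * n)) ℝ) (α : Fin k ↪o Fin (2 * n))
    (d : Fin (2 * n) → ℝ) :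
    (of fun i j : Fin (2 * n) => configVec α i * configVec α j *
      ∑ l, (d l : ℂ) * (u i l * u j l) + if (i : ℕ) = j then 1 - configVec α i else 0).det =
      ((u.submatrix α id * diagonal d * (u.submatrix α id)ᵀ).det : ℝ) := by
  rw [det_eq_det_submatrix_of_rows _ α α.injective]
  · have h : ((u.submatrix α id * diagonal d * (u.submatrix α id)ᵀ).det : ℂ) =
        ((u.submatrix α id * diagonal d * (u.submatrix α id)ᵀ).map Complex.ofReal).det :=
      RingHom.map_det Complex.ofRealHom _
    rw [h]
    congr 1
    ext t t'
    rw [map_apply, submatrix_mul_diagonal_mul]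
    simp only [submatrix_apply, of_apply, configVec_mem, sub_self, ite_self, add_zero, one_mul]
  · intro i hi j
    simp [configVec_notMem α hi, Fin.ext_iff]

/-- The same padding, with the border as the last row and column instead of the first. Moving rows
and columns by the same injection `e` costs no sign. -/
theorem det_bordered_minor (u : Matrix (Fin (2 * n)) (Fin (2 * n)) ℝ) (α : Fin k ↪o Fin (2 * n))
    (s : Fin n) (f : ℕ → ℕ → ℂ)
    (h00 : f (2 * n) (2 * n) = 0)
    (h01 : ∀ j : Fin (2 * n), f (2 * n) j = configVec α j * u j (modeY s))
    (h10 : ∀ i : Fin (2 * n), f i (2 * n) = configVec α i * u i (modeX s))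
    (h11 : ∀ i j : Fin (2 * n), f i j = configVec α i * configVec α j *
      ∑ l, (outerSign s l : ℂ) * (u i l * u j l) + if (i : ℕ) = j then 1 - configVec α i else 0) :
    (of fun i j : Fin (2 * n + 1) => f i j).det = (borderedDet u α s : ℝ) := by
  set e : Fin 1 ⊕ Fin k → Fin (2 * n + 1) :=
    Sum.elim (fun _ => Fin.last (2 * n)) fun t => (α t).castSucc with he
  have hinj : Function.Injective e := by
    rintro (i | i) (j | j) h
    · rw [Subsingleton.elim i j]
    · exact absurd h.symm (Fin.castSucc_lt_last _).ne
    · exact absurd h (Fin.castSucc_lt_last _).ne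
    · rw [α.injective (Fin.castSucc_injective _ h)]
  rw [det_eq_det_submatrix_of_rows _ e hinj, borderedDet_eq]
  · rw [show ((fromBlocks (0 : Matrix (Fin 1) (Fin 1) ℝ) (of fun _ t => u (α t) (modeY s))
      (of fun t _ => u (α t) (modeX s)) (u.submatrix α id * diagonal (outerSign s) *
      (u.submatrix α id)ᵀ)).det : ℂ) = _ from RingHom.map_det Complex.ofRealHom _]
    congr 1
    ext (t | t) (t' | t')
    · simpa [he] using h00
    · simpa [he, configVec_mem] using h01 (α t')
    · simpa [he, configVec_mem] using h10 (α t)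
    · have := h11 (α t) (α t')
      simp only [configVec_mem, sub_self, ite_self, add_zero, one_mul] at this
      rw [← submatrix_mul_diagonal_mul] at this
      simpa [he] using this
  · intro i hi j
    induction i using Fin.lastCases with
    | last => exact absurd ⟨Sum.inl 0, rfl⟩ hi
    | cast i =>
      have hi' : i ∉ Set.range α := by
        rintro ⟨t, rfl⟩
        exact hi ⟨Sum.inr t, rfl⟩
      induction j using Fin.lastCases with
      | last =>
        have := h10 i
        rw [configVec_notMem α hi', zero_mul] at this
        simpa [(Fin.castSucc_lt_last i).ne] using this
      | cast j =>
        have := h11 i j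
        rw [configVec_notMem α hi'] at this
        simpa [Fin.ext_iff] using this

/-- The memory holds the transition matrix and the registers that the evaluation of the
correlator needs. -/
structure Ready (m : Memory) (u : Matrix (Fin (2 * n)) (Fin (2 * n)) ℝ)
    (α : Fin k ↪o Fin (2 * n)) (s : Fin n) (v : Fin 3 → ℂ) : Prop where
  idx3 : m.idx 3 = 2 * n
  idx4 : m.idx 4 = 2 * n + 1
  idx5 : m.idx 5 = 2 * s
  idx6 : m.idx 6 = 2 * s + 1
  idx7 : m.idx 7 = 1
  idx9 : m.idx 9 = 3
  idx15 : m.idx 15 = 0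
  matrix : ∀ i j : Fin (2 * n), m.val 7 i j = u i j
  modes : ∀ j, m.val 1 0 j = configVec α j
  vector : ∀ j, m.val 2 0 j = padVec v j

variable {u : Matrix (Fin (2 * n)) (Fin (2 * n)) ℝ} {α : Fin k ↪o Fin (2 * n)} {s : Fin n}
  {v : Fin 3 → ℂ} {m : Memory}

theorem Ready.of_eq (h : Ready m u α s v) {m' : Memory} (hidx : ∀ r, r ≠ 13 → m'.idx r = m.idx r)
    (h1 : m'.val 1 = m.val 1) (h2 : m'.val 2 = m.val 2) (h7 : m'.val 7 = m.val 7) :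
    Ready m' u α s v :=
  ⟨by rw [hidx _ (by decide), h.idx3], by rw [hidx _ (by decide), h.idx4],
    by rw [hidx _ (by decide), h.idx5], by rw [hidx _ (by decide), h.idx6],
    by rw [hidx _ (by decide), h.idx7], by rw [hidx _ (by decide), h.idx9],
    by rw [hidx _ (by decide), h.idx15], by rw [h7]; exact h.matrix, by rw [h1]; exact h.modes,
    by rw [h2]; exact h.vector⟩

/-- Stores the minor with diagonal entries `d` in the array `out`. -/
def minorStmt (d : ArithExpr) (out : ℕ) : Stmt :=
  .seq (.assign 8 3 3 (minorExpr d)) (detStmt 3 out)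

theorem minorExpr_eval (h : Ready m u α s v) {d : ArithExpr} {δ : Fin (2 * n) → ℝ}
    (hd : ∀ (i j : ℕ) (l : Fin (2 * n)),
      d.eval (((m.setIdx 16 i).setIdx 17 j).setIdx 18 l) = δ l) (i j : Fin (2 * n)) :
    (minorExpr d).eval ((m.setIdx 16 i).setIdx 17 j) = configVec α i * configVec α j *
      ∑ l, (δ l : ℂ) * (u i l * u j l) + if (i : ℕ) = j then 1 - configVec α i else 0 := by
  simp only [minorExpr, eval_add, eval_sub, eval_at, eval_ifEq, eval, Memory.setIdx_idx,
    Memory.setIdx_val, ArithOp.eval, Nat.reduceEqDiff, if_true, if_false, h.idx15, h.idx3,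
    h.modes]
  rw [Finset.sum_range]
  simp only [hd, h.matrix]

theorem minorStmt_den (h : Ready m u α s v) {d : ArithExpr} {out : ℕ} {δ : Fin (2 * n) → ℝ}
    (hd : ∀ (i j : ℕ) (l : Fin (2 * n)),
      d.eval (((m.setIdx 16 i).setIdx 17 j).setIdx 18 l) = δ l) :
    let m' := (minorStmt d out).den m
    (∀ r, r ≠ 13 → m'.idx r = m.idx r) ∧
    (∀ a, a ≠ 8 → a ≠ 9 → a ≠ 10 → a ≠ 11 → a ≠ out → m'.val a = m.val a) ∧
    m'.val out 0 0 = ((u.submatrix α id * diagonal δ * (u.submatrix α id)ᵀ).det : ℝ) := by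
  set m₁ := (Stmt.assign 8 3 3 (minorExpr d)).den m with hm₁
  obtain ⟨a1, a2, a3⟩ := detStmt_den (N := 3) (out := out) (m := m₁) (.inl rfl) h.idx7 h.idx15
    h.idx3 (A := of fun i j : Fin (2 * n) => configVec α i * configVec α j *
      ∑ l, (δ l : ℂ) * (u i l * u j l) + if (i : ℕ) = j then 1 - configVec α i else 0) (by
      intro i j
      rw [of_apply, ← minorExpr_eval h hd]
      simp [hm₁, Stmt.den, h.idx3])
  refine ⟨a1, fun a h8 h9 h10 h11 ho => (a2 a h9 h10 h11 ho).trans ?_, a3.trans (det_minor u α δ)⟩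
  simp [hm₁, Stmt.den, h8]

/-- Stores the bordered minor in the array `out`. -/
def borderedStmt (out : ℕ) : Stmt :=
  .seq (.assign 8 4 4 (ifLe 3 16 (ifLe 3 17 zero (at_ 1 15 17 * at_ 7 17 6))
    (ifLe 3 17 (at_ 1 15 16 * at_ 7 16 5)
      (minorExpr (ifLe 18 6 (ifLe 5 18 zero one) (zero - one)))))) (detStmt 4 out)

theorem borderedStmt_den (h : Ready m u α s v) {out : ℕ} :
    let m' := (borderedStmt out).den m
    (∀ r, r ≠ 13 → m'.idx r = m.idx r) ∧
    (∀ a, a ≠ 8 → a ≠ 9 → a ≠ 10 → a ≠ 11 → a ≠ out → m'.val a = m.val a) ∧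
    m'.val out 0 0 = (borderedDet u α s : ℝ) := by
  have hout : ∀ (i j : ℕ) (l : Fin (2 * n)),
      (ifLe 18 6 (ifLe 5 18 zero one) (zero - one)).eval
        (((m.setIdx 16 i).setIdx 17 j).setIdx 18 l) = outerSign s l := by
    intro i j l
    simp only [outerSign, modeX, modeY, Fin.lt_def, Fin.ext_iff]
    simp [h.idx5, h.idx6]
    split_ifs <;> first | omega | simp
  set m₁ := (Stmt.assign 8 4 4 (ifLe 3 16 (ifLe 3 17 zero (at_ 1 15 17 * at_ 7 17 6))
    (ifLe 3 17 (at_ 1 15 16 * at_ 7 16 5)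
      (minorExpr (ifLe 18 6 (ifLe 5 18 zero one) (zero - one)))))).den m with hm₁
  obtain ⟨a1, a2, a3⟩ := detStmt_den (N := 4) (out := out) (m := m₁) (.inr rfl) h.idx7 h.idx15
    h.idx4 (A := of fun i j : Fin (2 * n + 1) => m₁.val 8 i j) (fun i j => rfl)
  refine ⟨a1, fun a h8 h9 h10 h11 ho => (a2 a h9 h10 h11 ho).trans ?_,
    a3.trans (det_bordered_minor u α s _ ?_ ?_ ?_ ?_)⟩
  · simp [hm₁, Stmt.den, h8]
  · simp [hm₁, Stmt.den, h.idx3, h.idx4]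
  · intro j
    have h1 := h.matrix j (modeY s)
    simp only [modeY] at h1
    simp [hm₁, Stmt.den, h.idx3, h.idx4, h.idx15, h.idx6, ArithOp.eval, h.modes, h1, modeY]
  · intro i
    have h1 := h.matrix i (modeX s)
    simp only [modeX] at h1
    simp [hm₁, Stmt.den, h.idx3, h.idx4, h.idx15, h.idx5, ArithOp.eval, h.modes, h1, modeX]
  · intro i j
    rw [← minorExpr_eval h hout]
    simp [hm₁, Stmt.den, h.idx3, h.idx4, i.2.not_ge, j.2.not_ge]

/-- The diagonal entries for `σ^x`. -/
def signX : ArithExpr := ifLe 18 5 one (zero - one)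

/-- The diagonal entries for `σ^y`. -/
def signY : ArithExpr := ifLe 18 6 (ifEq 18 5 (zero - one) one) (zero - one)

/-- The diagonal entries for `σ^z`. -/
def signZ : ArithExpr := ifEq 18 5 (zero - one) (ifEq 18 6 (zero - one) one)

/-- The matrix of the form, from the four determinants. -/
def formMatrixExpr : ArithExpr :=
  ifEq 16 17
    (ifEq 16 15 ((one - at_ 12 15 15) / (one + one))
      (ifEq 16 7 ((one - at_ 13 15 15) / (one + one)) ((one - at_ 14 15 15) / (one + one))))
    (ifLe 16 7 (ifLe 17 7 (at_ 15 15 15) zero) zero)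

/-- The value of the form. -/
def formValueExpr : ArithExpr :=
  sum 18 9 (sum 19 9 (conj (at_ 2 15 18) * (at_ 5 18 19 * at_ 2 15 19)))

/-- Evaluates matrix and form from the transition matrix in array `7`. -/
def evalStmt : Stmt :=
  .seq (minorStmt signX 12) <| .seq (minorStmt signY 13) <| .seq (minorStmt signZ 14) <|
  .seq (borderedStmt 15) <| .seq (.assign 5 9 9 formMatrixExpr) (.assign 6 7 7 formValueExpr)

theorem quadForm_eq_sum (M : Matrix (Fin 3) (Fin 3) ℂ) (v : Fin 3 → ℂ) :
    quadForm M v = ∑ a, ∑ b, star (v a) * (M a b * v b) := by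
  simp only [quadForm, dotProduct, mulVec, Finset.mul_sum, Pi.star_apply]

theorem evalStmt_den (h : Ready m u α s v) :
    outMatrix (evalStmt.den m) = (otoMatrix u α s).map Complex.ofReal ∧
      outValue (evalStmt.den m) = quadForm ((otoMatrix u α s).map Complex.ofReal) v := by
  have hx : ∀ {m : Memory}, Ready m u α s v → ∀ (i j : ℕ) (l : Fin (2 * n)),
      signX.eval (((m.setIdx 16 i).setIdx 17 j).setIdx 18 l) =
        ((-(if l ∈ Finset.univ.filter fun μ => μ ≤ modeX s then -1 else 1) : ℝ) : ℂ) := by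
    intro m h i j l
    simp only [Finset.mem_filter, Finset.mem_univ, true_and, modeX, Fin.le_def]
    simp [signX, h.idx5]
    split_ifs <;> simp
  have hy : ∀ {m : Memory}, Ready m u α s v → ∀ (i j : ℕ) (l : Fin (2 * n)),
      signY.eval (((m.setIdx 16 i).setIdx 17 j).setIdx 18 l) =
        ((-(if l ∈ Finset.univ.filter fun μ => μ < modeX s ∨ μ = modeY s then -1 else 1) : ℝ) :
          ℂ) := by
    intro m h i j l
    simp only [Finset.mem_filter, Finset.mem_univ, true_and, modeX, modeY, Fin.lt_def, Fin.ext_iff]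
    simp [signY, h.idx5, h.idx6]
    split_ifs <;> first | omega | simp
  have hz : ∀ {m : Memory}, Ready m u α s v → ∀ (i j : ℕ) (l : Fin (2 * n)),
      signZ.eval (((m.setIdx 16 i).setIdx 17 j).setIdx 18 l) =
        ((if l ∈ ({modeX s, modeY s} : Finset (Fin (2 * n))) then -1 else 1 : ℝ) : ℂ) := by
    intro m h i j l
    simp only [Finset.mem_insert, Finset.mem_singleton, modeX, modeY, Fin.ext_iff]
    simp [signZ, h.idx5, h.idx6]
    split_ifs <;> first | omega | simp
  obtain ⟨a1, a2, a3⟩ := minorStmt_den h (out := 12) (hx h)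
  set m₁ := (minorStmt signX 12).den m
  have h₁ := h.of_eq a1 (a2 1 (by decide) (by decide) (by decide) (by decide) (by decide))
    (a2 2 (by decide) (by decide) (by decide) (by decide) (by decide))
    (a2 7 (by decide) (by decide) (by decide) (by decide) (by decide))
  obtain ⟨b1, b2, b3⟩ := minorStmt_den h₁ (out := 13) (hy h₁)
  set m₂ := (minorStmt signY 13).den m₁
  have h₂ := h₁.of_eq b1 (b2 1 (by decide) (by decide) (by decide) (by decide) (by decide))
    (b2 2 (by decide) (by decide) (by decide) (by decide) (by decide))
    (b2 7 (by decide) (by decide) (by decide) (by decide) (by decide))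
  obtain ⟨c1, c2, c3⟩ := minorStmt_den h₂ (out := 14) (hz h₂)
  set m₃ := (minorStmt signZ 14).den m₂
  have h₃ := h₂.of_eq c1 (c2 1 (by decide) (by decide) (by decide) (by decide) (by decide))
    (c2 2 (by decide) (by decide) (by decide) (by decide) (by decide))
    (c2 7 (by decide) (by decide) (by decide) (by decide) (by decide))
  obtain ⟨d1, d2, d3⟩ := borderedStmt_den h₃ (out := 15)
  set m₄ := (borderedStmt 15).den m₃
  have h₄ := h₃.of_eq d1 (d2 1 (by decide) (by decide) (by decide) (by decide) (by decide))
    (d2 2 (by decide) (by decide) (by decide) (by decide) (by decide))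
    (d2 7 (by decide) (by decide) (by decide) (by decide) (by decide))
  -- The stored minor uses the negated reflection, so `(-1)^k` is already inside the determinant and
  -- the program never computes the parity of `k`.
  have hX : m₄.val 12 0 0 =
      ((-1) ^ k * (reflDet u α (Finset.univ.filter fun μ => μ ≤ modeX s)) : ℝ) := by
    rw [← det_submatrix_neg_reflection, reflection_eq_diagonal, diagonal_neg, ← a3,
      d2 12 (by decide) (by decide) (by decide) (by decide) (by decide),
      c2 12 (by decide) (by decide) (by decide) (by decide) (by decide),
      b2 12 (by decide) (by decide) (by decide) (by decide) (by decide)]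
  have hY : m₄.val 13 0 0 = ((-1) ^ k *
      (reflDet u α (Finset.univ.filter fun μ => μ < modeX s ∨ μ = modeY s)) : ℝ) := by
    rw [← det_submatrix_neg_reflection, reflection_eq_diagonal, diagonal_neg, ← b3,
      d2 13 (by decide) (by decide) (by decide) (by decide) (by decide),
      c2 13 (by decide) (by decide) (by decide) (by decide) (by decide)]
  have hZ : m₄.val 14 0 0 = (reflDet u α {modeX s, modeY s} : ℝ) := by
    rw [reflDet, reflection_eq_diagonal, ← c3,
      d2 14 (by decide) (by decide) (by decide) (by decide) (by decide)]
  set m₅ := (Stmt.assign 5 9 9 formMatrixExpr).den m₄ with hm₅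
  have hmat : ∀ a b : Fin 3, m₅.val 5 a b = (otoMatrix u α s a b : ℂ) := by
    intro a b
    have h1 : m₅.val 5 a b = formMatrixExpr.eval ((m₄.setIdx 16 a).setIdx 17 b) := by
      simp [hm₅, Stmt.den, h₄.idx9]
    rw [h1]
    simp only [formMatrixExpr, eval_ifEq, eval, eval_div, eval_sub, eval_at,
      Memory.setIdx_idx, Memory.setIdx_val, ArithOp.eval, Nat.reduceEqDiff, if_true,
      if_false, h₄.idx15, h₄.idx7, hX, hY, hZ, d3, otoMatrix]
    fin_cases a <;> fin_cases b <;> simp <;> ring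
  have hden : evalStmt.den m = (Stmt.assign 6 7 7 formValueExpr).den m₅ := rfl
  have hmatrix : outMatrix (evalStmt.den m) = (otoMatrix u α s).map Complex.ofReal := by
    ext a b
    rw [hden, map_apply, ← hmat a b, outMatrix, of_apply]
    simp [Stmt.den]
  refine ⟨hmatrix, ?_⟩
  have hvec : ∀ a : Fin 3, m₅.val 2 0 a = v a := by
    intro a
    have h1 : m₅.val 2 = m₄.val 2 := by simp [hm₅, Stmt.den]
    rw [h1, h₄.vector, padVec, dif_pos a.2]
  have h1 : outValue (evalStmt.den m) = formValueExpr.eval ((m₅.setIdx 16 0).setIdx 17 0) := by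
    rw [hden]
    have : m₅.idx 7 = 1 := h₄.idx7
    simp [outValue, Stmt.den, this]
  rw [h1, quadForm_eq_sum]
  have h9 : m₅.idx 9 = 3 := h₄.idx9
  have h15 : m₅.idx 15 = 0 := h₄.idx15
  simp only [formValueExpr, eval, eval_at, Memory.setIdx_idx, Memory.setIdx_val, ArithOp.eval,
    Nat.reduceEqDiff, if_true, if_false, h9, h15, map_apply]
  rw [Finset.sum_range]
  refine Finset.sum_congr rfl fun a _ => ?_
  rw [Finset.sum_range]
  refine Finset.sum_congr rfl fun b _ => ?_
  rw [hmat, hvec, hvec]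

end Tail

/-! ### From the gate list to the transition matrix -/

section CircuitProgram

open ArithExpr

/-- The columns of `gateColumn`, from the entries of `V` in row number `idx 14` of array `3`. -/
def gateColumnExpr : ArithExpr :=
  ifEq 16 15 (ifEq 17 15 (at_ 3 14 8) (at_ 3 14 15)) <|
  ifEq 16 7 (ifEq 17 15 (zero - imag * at_ 3 14 8) (imag * at_ 3 14 15)) <|
  ifEq 16 8 (ifEq 17 15 (at_ 3 14 15) (zero - at_ 3 14 8)) <|
  ifEq 17 15 (imag * at_ 3 14 15) (imag * at_ 3 14 8)

/-- The columns of `gateImage`, from array `18` and the entries of `W` in array `4`. -/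
def gateImageExpr : ArithExpr :=
  ifEq 17 15 (conj (at_ 4 14 15) * at_ 18 16 15 + conj (at_ 4 14 8) * at_ 18 16 7)
    (conj (at_ 4 14 7) * at_ 18 16 15 + conj (at_ 4 14 9) * at_ 18 16 7)

/-- The real part. -/
def reExpr (e : ArithExpr) : ArithExpr := (e + conj e) / (one + one)

/-- The imaginary part. -/
def imExpr (e : ArithExpr) : ArithExpr := (e - conj e) / ((one + one) * imag)

/-- The coefficients `gateCoeff`, from array `17`. -/
def gateCoeffExpr : ArithExpr :=
  ifEq 17 15 (reExpr (at_ 17 16 7)) <| ifEq 17 7 (imExpr (at_ 17 16 7)) <|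
  ifEq 17 8 (reExpr (at_ 17 16 15)) (imExpr (at_ 17 16 15))

/-- The transition matrix of the gate number `idx 14`, from array `16`. -/
def gateMatrixExpr : ArithExpr :=
  -- The position of a gate is an indicator vector of cells, which cannot serve as an address.
  -- Summing over all positions against it puts the position in register `18`; registers `19` and
  -- `20` then hold `2 pos` and `2 pos + 4`.
  sum 18 0 (at_ 0 14 18 * bindAdd 19 18 18 (bindAdd 20 19 10
    (ifLe 20 16 (ifEq 16 17 one zero) (ifLe 20 17 (ifEq 16 17 one zero)
    (ifLe 19 16 (ifLe 19 17 (bindSub 21 16 19 (bindSub 22 17 19 (at_ 16 21 22)))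
      (ifEq 16 17 one zero)) (ifEq 16 17 one zero))))))

/-- Multiplies array `7` by the transition matrix of the gate number `idx 14`. -/
def gateStmt : Stmt :=
  .seq (.assign 18 10 8 gateColumnExpr) <| .seq (.assign 17 10 8 gateImageExpr) <|
  .seq (.assign 16 10 10 gateCoeffExpr) <| .seq (.assign 19 3 3 gateMatrixExpr) <|
  .seq (.assign 11 3 3 (sum 18 3 (at_ 7 16 18 * at_ 19 18 17))) (.assign 7 3 3 (at_ 11 16 17))

/-- Stores the transition matrix of the circuit in array `7`. -/
def circuitStmt : Stmt :=
  .seq (.assign 7 3 3 (ifEq 16 17 one zero)) (.loop 14 2 gateStmt)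

variable {n k : ℕ}

theorem reExpr_eval (e : ArithExpr) (m : Memory) : (reExpr e).eval m = ((e.eval m).re : ℂ) := by
  rw [Complex.re_eq_add_conj]
  simp [reExpr, eval, one_add_one_eq_two, ArithOp.eval]

theorem imExpr_eval (e : ArithExpr) (m : Memory) : (imExpr e).eval m = ((e.eval m).im : ℂ) := by
  rw [Complex.im_eq_sub_conj]
  simp [imExpr, eval, one_add_one_eq_two, ArithOp.eval]

/-- The memory holds the gate `g` as the gate number `idx 14`. -/
structure HasGate (m : Memory) (g : Matchgate n) : Prop where
  idx0 : m.idx 0 = n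
  idx3 : m.idx 3 = 2 * n
  idx7 : m.idx 7 = 1
  idx8 : m.idx 8 = 2
  idx9 : m.idx 9 = 3
  idx10 : m.idx 10 = 4
  idx15 : m.idx 15 = 0
  pos : ∀ j, m.val 0 (m.idx 14) j = if g.pos = j then 1 else 0
  fst : ∀ j, m.val 3 (m.idx 14) j = flatten g.V.1 j
  snd : ∀ j, m.val 4 (m.idx 14) j = flatten g.W.1 j

theorem gateStmt_den {m : Memory} {g : Matchgate n} (h : HasGate m g)
    {u : Matrix (Fin (2 * n)) (Fin (2 * n)) ℝ} (hu : ∀ i j : Fin (2 * n), m.val 7 i j = u i j) :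
    (gateStmt.den m).idx = m.idx ∧ (∀ a, a < 5 → (gateStmt.den m).val a = m.val a) ∧
    ∀ i j : Fin (2 * n), (gateStmt.den m).val 7 i j = ((u * g.transition) i j : ℝ) := by
  obtain ⟨h0, h3, h7, h8, h9, h10, h15, hp, hV, hW⟩ := h
  set m₁ := (Stmt.assign 18 10 8 gateColumnExpr).den m with hm₁
  have hi₁ : m₁.idx = m.idx := rfl
  have hv₁ : ∀ a, a ≠ 18 → m₁.val a = m.val a := fun a ha => by simp [hm₁, Stmt.den, ha]
  have hf : ∀ q, q < 4 → m₁.val 18 q 0 = (gateColumn g.V.1 q).1 ∧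
      m₁.val 18 q 1 = (gateColumn g.V.1 q).2 := by
    intro q hq
    interval_cases q <;>
      simp [hm₁, Stmt.den, gateColumnExpr, gateColumn, h7, h8, h10, h15, hV, flatten, ArithOp.eval]
  set m₂ := (Stmt.assign 17 10 8 gateImageExpr).den m₁ with hm₂
  have hi₂ : m₂.idx = m.idx := rfl
  have hv₂ : ∀ a, a ≠ 18 → a ≠ 17 → m₂.val a = m.val a := fun a ha ha' => by
    rw [← hv₁ a ha]; simp [hm₂, Stmt.den, ha']
  have hK : ∀ q, q < 4 → m₂.val 17 q 0 = (gateImage g.V.1 g.W.1 q).1 ∧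
      m₂.val 17 q 1 = (gateImage g.V.1 g.W.1 q).2 := by
    intro q hq
    obtain ⟨f1, f2⟩ := hf q hq
    simp [hm₂, Stmt.den, gateImageExpr, gateImage, hi₁, h7, h8, h9, h10, h15, hv₁, hW, flatten, f1,
      f2, hq, ArithOp.eval]
  set m₃ := (Stmt.assign 16 10 10 gateCoeffExpr).den m₂ with hm₃
  have hi₃ : m₃.idx = m.idx := rfl
  have hv₃ : ∀ a, a ≠ 18 → a ≠ 17 → a ≠ 16 → m₃.val a = m.val a := fun a ha ha' ha'' => by
    rw [← hv₂ a ha ha']; simp [hm₃, Stmt.den, ha'']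
  have hQ : ∀ q r, q < 4 → r < 4 → m₃.val 16 q r = (gateCoeff g.V.1 g.W.1 q r : ℂ) := by
    intro q r hq hr
    obtain ⟨f1, f2⟩ := hK q hq
    interval_cases r <;>
    simp [hm₃, Stmt.den, gateCoeffExpr, gateCoeff, hi₂, h7, h8, h10, h15, f1,
      f2, hq, reExpr_eval, imExpr_eval]
  set m₄ := (Stmt.assign 19 3 3 gateMatrixExpr).den m₃ with hm₄
  have hi₄ : m₄.idx = m.idx := rfl
  have hG : ∀ i j : Fin (2 * n), m₄.val 19 i j = (g.transition i j : ℂ) := by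
    intro i j
    have hval : m₄.val 19 i j = gateMatrixExpr.eval ((m₃.setIdx 16 i).setIdx 17 j) := by
      simp [hm₄, Stmt.den, hi₃, h3]
    have hpos : g.pos < n := by have := g.pos_lt; omega
    rw [hval]
    simp only [gateMatrixExpr, eval, ArithOp.eval, eval_at, eval_ifEq, Memory.setIdx_idx,
      Memory.setIdx_val, Nat.reduceEqDiff, if_true, if_false, hi₃, h0, h10,
      hv₃ 0 (by decide) (by decide) (by decide), hp]
    rw [Finset.sum_eq_single_of_mem g.pos (Finset.mem_range.2 hpos) fun b _ hb => by
      rw [if_neg (Ne.symm hb), zero_mul], if_pos rfl, one_mul, Matchgate.transition, of_apply,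
      Matchgate.coeff]
    by_cases hc : 2 * g.pos ≤ i ∧ i < 2 * g.pos + 4 ∧ 2 * g.pos ≤ j ∧ (j : ℕ) < 2 * g.pos + 4
    · rw [if_pos hc, if_neg (by omega), if_neg (by omega), if_pos (by omega), if_pos (by omega),
        ← two_mul, hQ _ _ (by omega) (by omega)]
    · rw [if_neg hc]
      split_ifs <;> first | omega | simp
  set m₅ := (Stmt.assign 11 3 3 (sum 18 3 (at_ 7 16 18 * at_ 19 18 17))).den m₄ with hm₅
  have hden : gateStmt.den m = (Stmt.assign 7 3 3 (at_ 11 16 17)).den m₅ := rfl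
  have hv₄ : ∀ a, a < 8 → m₄.val a = m.val a := fun a ha => by
    rw [← hv₃ a (by omega) (by omega) (by omega)]
    simp [hm₄, Stmt.den, show a ≠ 19 by omega]
  rw [hden]
  refine ⟨rfl, fun a ha => ?_, fun i j => ?_⟩
  · rw [← hv₄ a (by omega)]
    simp [hm₅, Stmt.den, show a ≠ 7 by omega, show a ≠ 11 by omega]
  · have hval : ((Stmt.assign 7 3 3 (at_ 11 16 17)).den m₅).val 7 i j =
        ∑ l ∈ Finset.range (2 * n), m₄.val 7 i l * m₄.val 19 l j := by
      simp [Stmt.den, h3, hm₅, hi₄, ArithOp.eval]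
    rw [hval, Finset.sum_range, mul_apply]
    push_cast
    exact Finset.sum_congr rfl fun l _ => by rw [hv₄ 7 (by norm_num), hu, hG]

/-- Sets the registers that the statements use. -/
def setupProgram : Program :=
  .seq (.addIdx 3 0 0) <| .seq (.putIdx 7 1) <| .seq (.addIdx 4 3 7) <| .seq (.addIdx 5 1 1) <|
  .seq (.addIdx 6 5 7) <| .seq (.putIdx 8 2) <| .seq (.putIdx 9 3) (.putIdx 10 4)

/-- After `T` rounds array `7` holds the transition matrix of the first `T` gates. Each further gate
multiplies on the right, matching the order of operators in the circuit. -/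
theorem circuitStmt_den {m : Memory} {L : List (Matchgate n)} (h0 : m.idx 0 = n)
    (h2 : m.idx 2 = L.length) (h3 : m.idx 3 = 2 * n) (h7 : m.idx 7 = 1) (h8 : m.idx 8 = 2)
    (h9 : m.idx 9 = 3) (h10 : m.idx 10 = 4) (h15 : m.idx 15 = 0)
    (hp : ∀ (t : ℕ) (ht : t < L.length) j, m.val 0 t j = if L[t].pos = j then 1 else 0)
    (hV : ∀ (t : ℕ) (ht : t < L.length) j, m.val 3 t j = flatten L[t].V.1 j)
    (hW : ∀ (t : ℕ) (ht : t < L.length) j, m.val 4 t j = flatten L[t].W.1 j) :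
    (∀ r, r ≠ 14 → (circuitStmt.den m).idx r = m.idx r) ∧
    (∀ a, a < 5 → (circuitStmt.den m).val a = m.val a) ∧
    ∀ i j : Fin (2 * n), (circuitStmt.den m).val 7 i j = (circuitTransition L i j : ℂ) := by
  set m₁ := (Stmt.assign 7 3 3 (ifEq 16 17 one zero)).den m with hm₁
  have key := foldl_range_induction (fun m' t => gateStmt.den (m'.setIdx 14 t))
    (fun T m' => (∀ r, r ≠ 14 → m'.idx r = m.idx r) ∧ (∀ a, a < 5 → m'.val a = m.val a) ∧
      ∀ i j : Fin (2 * n), m'.val 7 i j = (circuitTransition (L.take T) i j : ℂ))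
    (N := L.length) (x := m₁)
    ⟨fun _ _ => rfl, fun a ha => by simp [hm₁, Stmt.den, show a ≠ 7 by omega], fun i j => by
      simp only [hm₁, Stmt.den, h3, circuitTransition, List.take_zero, List.map_nil, List.prod_nil,
        one_apply, Fin.ext_iff]
      simp
      split_ifs <;> simp⟩
    (by
      rintro t m' ht ⟨i1, i2, i3⟩
      have hg : HasGate (m'.setIdx 14 t) L[t] :=
        { idx0 := by simp [i1, h0]
          idx3 := by simp [i1, h3]
          idx7 := by simp [i1, h7]
          idx8 := by simp [i1, h8]
          idx9 := by simp [i1, h9]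
          idx10 := by simp [i1, h10]
          idx15 := by simp [i1, h15]
          pos := by simpa [i2] using hp t ht
          fst := by simpa [i2] using hV t ht
          snd := by simpa [i2] using hW t ht }
      obtain ⟨j1, j2, j3⟩ := gateStmt_den hg i3
      refine ⟨fun r hr => ?_, fun a ha => (j2 a ha).trans (i2 a ha), fun i j => ?_⟩
      · rw [j1, Memory.setIdx_idx, if_neg hr, i1 r hr]
      · rw [j3, circuitTransition, circuitTransition, List.take_succ_eq_append_getElem ht,
          List.map_append, List.prod_append, List.map_singleton, List.prod_singleton])
  rw [List.take_length] at key
  have hden : circuitStmt.den m =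
      (List.range L.length).foldl (fun m' t => gateStmt.den (m'.setIdx 14 t)) m₁ := by
    rw [← h2]
    rfl
  rw [hden]
  exact key

theorem setupProgram_spec (m : Memory) :
    (setupProgram.run m).2 = 8 ∧ (setupProgram.run m).1.val = m.val ∧
    (∀ r, r ≤ 2 ∨ 10 < r → (setupProgram.run m).1.idx r = m.idx r) ∧
    (setupProgram.run m).1.idx 3 = 2 * m.idx 0 ∧ (setupProgram.run m).1.idx 4 = 2 * m.idx 0 + 1 ∧
    (setupProgram.run m).1.idx 5 = 2 * m.idx 1 ∧ (setupProgram.run m).1.idx 6 = 2 * m.idx 1 + 1 ∧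
    (setupProgram.run m).1.idx 7 = 1 ∧ (setupProgram.run m).1.idx 8 = 2 ∧
    (setupProgram.run m).1.idx 9 = 3 ∧ (setupProgram.run m).1.idx 10 = 4 := by
  refine ⟨rfl, rfl, fun r hr => ?_, ?_⟩
  · simp only [setupProgram, Program.run, Memory.setIdx_idx]
    simp [show r ≠ 3 by omega, show r ≠ 4 by omega, show r ≠ 5 by omega, show r ≠ 6 by omega,
      show r ≠ 7 by omega, show r ≠ 8 by omega, show r ≠ 9 by omega, show r ≠ 10 by omega]
  · simp [setupProgram, Program.run, two_mul]

/-- The registers that bound the loops. -/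
def loopRegisters : List ℕ := [0, 2, 3, 4, 7, 8, 9, 10]

/-- After setup every loop register is at most `2 (n + N) + 4`, with `n` and `N` the contents of
registers `0` and `2`. Substituting this into the syntactic cost and adding the eight setup steps
gives the polynomial. -/
theorem exists_program (S : Stmt) (hS : S.ok = true)
    (hB : S.toProgram.boundedBy loopRegisters = true) :
    ∃ (P : Program) (p : Polynomial ℕ), ∀ m : Memory, m.idx 15 = 0 →
      (P.run m).2 ≤ p.eval (m.idx 0 + m.idx 2) ∧
      Stmt.Agree (P.run m).1 (S.den (setupProgram.run m).1) := by
  refine ⟨.seq setupProgram S.toProgram, 8 + S.toProgram.cost.comp (2 * Polynomial.X + 4),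
    fun m hm => ?_⟩
  obtain ⟨h1, h2, h3, i3, i4, i5, i6, i7, i8, i9, i10⟩ := setupProgram_spec m
  refine ⟨?_, S.toProgram_spec hS ⟨fun _ _ => rfl, fun _ _ => rfl, (h3 15 (by norm_num)).trans hm⟩⟩
  have hle := (S.toProgram.steps_le hB (N := 2 * (m.idx 0 + m.idx 2) + 4) (setupProgram.run m).1 (by
    simp only [loopRegisters, List.mem_cons, List.not_mem_nil, or_false, forall_eq_or_imp,
      forall_eq, i3, i4, i7, i8, i9, i10, h3 0 (by norm_num), h3 2 (by norm_num)]
    omega)).1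
  simp only [Program.run, Polynomial.eval_add, Polynomial.eval_comp, Polynomial.eval_mul,
    Polynomial.eval_X, Polynomial.eval_ofNat]
  omega

theorem outMatrix_congr {m m' : Memory} (h : Stmt.Agree m m') : outMatrix m = outMatrix m' := by
  rw [outMatrix, outMatrix, h.val 5 (by norm_num)]

theorem outValue_congr {m m' : Memory} (h : Stmt.Agree m m') : outValue m = outValue m' := by
  rw [outValue, outValue, h.val 6 (by norm_num)]

theorem exists_matrix_program : ∃ (P : Program) (p : Polynomial ℕ),
    ∀ (n k : ℕ) (u : Matrix (Fin (2 * n)) (Fin (2 * n)) ℝ)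
      (α : Fin k ↪o Fin (2 * n)) (s : Fin n) (v : Fin 3 → ℂ),
      let res := P.run (matrixInput u α s v)
      let M := (otoMatrix u α s).map Complex.ofReal
      res.2 ≤ p.eval n ∧ outMatrix res.1 = M ∧ outValue res.1 = quadForm M v := by
  obtain ⟨P, p, hP⟩ := exists_program (.seq (.assign 7 3 3 (at_ 0 16 17)) evalStmt) rfl rfl
  refine ⟨P, p, fun n k u α s v => ?_⟩
  set m := matrixInput u α s v with hm
  obtain ⟨h1, h2⟩ := hP m rfl
  -- With matrix input the gate count in register `2` is zero by default, so the bound depends on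
  -- `n` alone.
  have hn : m.idx 0 + m.idx 2 = n := rfl
  rw [hn] at h1
  obtain ⟨-, hv, hi, i3, i4, i5, i6, i7, i8, i9, i10⟩ := setupProgram_spec m
  set m₁ := (setupProgram.run m).1
  rw [Stmt.den] at h2
  set m₂ := (Stmt.assign 7 3 3 (at_ 0 16 17)).den m₁ with hm₂
  have hready : Ready m₂ u α s v :=
    { idx3 := i3
      idx4 := i4
      idx5 := i5
      idx6 := i6
      idx7 := i7
      idx9 := i9
      idx15 := hi 15 (by norm_num)
      matrix := fun i j => by
        have h3 : m₁.idx 3 = 2 * n := i3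
        simp [hm₂, Stmt.den, h3, hv, hm, matrixInput, padMatrix]
      modes := fun j => by simp [hm₂, Stmt.den, hv, hm, matrixInput]
      vector := fun j => by simp [hm₂, Stmt.den, hv, hm, matrixInput] }
  obtain ⟨e1, e2⟩ := evalStmt_den hready
  exact ⟨h1, (outMatrix_congr h2).trans e1, (outValue_congr h2).trans e2⟩

theorem exists_circuit_program : ∃ (P : Program) (p : Polynomial ℕ),
    ∀ (n k : ℕ) (L : List (Matchgate n)) (α : Fin k ↪o Fin (2 * n)) (s : Fin n) (v : Fin 3 → ℂ),
      let res := P.run (circuitInput L α s v)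
      let M := (otoMatrix (circuitTransition L) α s).map Complex.ofReal
      res.2 ≤ p.eval (n + L.length) ∧ outMatrix res.1 = M ∧ outValue res.1 = quadForm M v := by
  obtain ⟨P, p, hP⟩ := exists_program (.seq circuitStmt evalStmt) rfl rfl
  refine ⟨P, p, fun n k L α s v => ?_⟩
  set m := circuitInput L α s v with hm
  obtain ⟨h1, h2⟩ := hP m rfl
  obtain ⟨-, hv, hi, i3, i4, i5, i6, i7, i8, i9, i10⟩ := setupProgram_spec m
  set m₁ := (setupProgram.run m).1
  obtain ⟨c1, c2, c3⟩ := circuitStmt_den (m := m₁) (L := L) (hi 0 (by norm_num))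
    (hi 2 (by norm_num)) i3 i7 i8 i9 i10 (hi 15 (by norm_num))
    (fun t ht j => by rw [hv]; exact dif_pos ht) (fun t ht j => by rw [hv]; exact dif_pos ht)
    (fun t ht j => by rw [hv]; exact dif_pos ht)
  have hready : Ready (circuitStmt.den m₁) (circuitTransition L) α s v :=
    { idx3 := (c1 3 (by decide)).trans i3
      idx4 := (c1 4 (by decide)).trans i4
      idx5 := (c1 5 (by decide)).trans i5
      idx6 := (c1 6 (by decide)).trans i6
      idx7 := (c1 7 (by decide)).trans i7
      idx9 := (c1 9 (by decide)).trans i9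
      idx15 := (c1 15 (by decide)).trans (hi 15 (by norm_num))
      matrix := c3
      modes := fun j => by rw [c2 1 (by norm_num), hv]; rfl
      vector := fun j => by rw [c2 2 (by norm_num), hv]; rfl }
  obtain ⟨e1, e2⟩ := evalStmt_den hready
  exact ⟨h1, (outMatrix_congr h2).trans e1, (outValue_congr h2).trans e2⟩

end CircuitProgram

end

end MatchgateOTO

theorem mainTheorem3 :
    -- every matchgate circuit is a unitary with a unique transition matrix, in `SO(2n)`
    (∀ (n : ℕ) (L : List (MatchgateOTO.Matchgate n)),
      MatchgateOTO.circuitOp L ∈ Matrix.unitaryGroup (Fin n → Fin 2) ℂ ∧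
      ∃ u ∈ Matrix.specialOrthogonalGroup (Fin (2 * n)) ℝ,
        MatchgateOTO.IsModeTransition (MatchgateOTO.circuitOp L) u ∧
        ∀ u', MatchgateOTO.IsModeTransition (MatchgateOTO.circuitOp L) u' → u' = u) ∧
    -- the correlator is a quadratic form, and its matrix is the explicit one
    (∀ (n k : ℕ) (U : MatchgateOTO.Op n) (u : Matrix (Fin (2 * n)) (Fin (2 * n)) ℝ)
      (α : Fin k ↪o Fin (2 * n)) (s : Fin n),
      U ∈ Matrix.unitaryGroup (Fin n → Fin 2) ℂ → MatchgateOTO.IsModeTransition U u →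
      ∀ M : Matrix (Fin 3) (Fin 3) ℂ,
        (∀ v, MatchgateOTO.oto U α s v = MatchgateOTO.quadForm M v) ↔
          M = (MatchgateOTO.otoMatrix u α s).map Complex.ofReal) ∧
    -- one program computes matrix and form from the transition matrix in polynomially many steps
    (∃ (P : MatchgateOTO.Program) (p : Polynomial ℕ),
      ∀ (n k : ℕ) (u : Matrix (Fin (2 * n)) (Fin (2 * n)) ℝ)
        (α : Fin k ↪o Fin (2 * n)) (s : Fin n) (v : Fin 3 → ℂ),
        let res := P.run (MatchgateOTO.matrixInput u α s v)
        let M := (MatchgateOTO.otoMatrix u α s).map Complex.ofReal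
        res.2 ≤ p.eval n ∧ MatchgateOTO.outMatrix res.1 = M ∧
          MatchgateOTO.outValue res.1 = MatchgateOTO.quadForm M v) ∧
    -- one program computes matrix and form from the circuit in polynomially many steps
    (∃ (P : MatchgateOTO.Program) (p : Polynomial ℕ),
      ∀ (n k : ℕ) (L : List (MatchgateOTO.Matchgate n))
        (α : Fin k ↪o Fin (2 * n)) (s : Fin n) (v : Fin 3 → ℂ),
        let res := P.run (MatchgateOTO.circuitInput L α s v)
        res.2 ≤ p.eval (n + L.length) ∧
          (∀ w, MatchgateOTO.oto (MatchgateOTO.circuitOp L) α s w =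
            MatchgateOTO.quadForm (MatchgateOTO.outMatrix res.1) w) ∧
          MatchgateOTO.outValue res.1 =
            MatchgateOTO.oto (MatchgateOTO.circuitOp L) α s v) := by
  refine ⟨fun n L => ⟨MatchgateOTO.circuitOp_mem_unitaryGroup L, MatchgateOTO.circuitTransition L,
    MatchgateOTO.circuitTransition_mem L, MatchgateOTO.isModeTransition_circuit L,
    fun u' h => (MatchgateOTO.isModeTransition_circuit L).unique h⟩,
    fun n k U u α s hU h M => MatchgateOTO.oto_eq_quadForm_iff h hU α s M,
    MatchgateOTO.exists_matrix_program, ?_⟩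
  obtain ⟨P, p, hP⟩ := MatchgateOTO.exists_circuit_program
  refine ⟨P, p, fun n k L α s v => ?_⟩
  obtain ⟨h1, h2, h3⟩ := hP n k L α s v
  have key := (MatchgateOTO.oto_eq_quadForm_iff (MatchgateOTO.isModeTransition_circuit L)
    (MatchgateOTO.circuitOp_mem_unitaryGroup L) α s _).2 h2
  exact ⟨h1, key, by rw [h3, key v, h2]⟩
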